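/- **Coverage instances.** Let $\mathcal F$ be a family of $n$ sets over a ground set $\mathcal E$ of $m$ elements, every element lying in at least one set. For $S\subseteq\mathcal F$ let $\mathcal C(S)=|\bigcup_{U\in S}U|$, and for $1\le k\le n$ let $\mathrm{Opt}_k$ be the maximum of $\mathcal C(S)$ over all $S\subseteq\mathcal F$ with $|S|=k$. The instance is viewed as a bipartite graph between $\mathcal F$ and $\mathcal E$ and is given by its edge lists: for each set the list of its elements, and for each element the list of the sets that contain it, all without repetitions and in arbitrary order. **RAM model.** A program is a finite sequence of instructions for a random access machine with words of $w$ bits. The instructions are loading constants, word arithmetic ($+,-,\times,\div$), direct and indirect memory access, jumps, drawing a fresh uniformly random element of $\{0,\dots,b-1\}$ for a word $b$, reading one entry of one edge list (a position past the end of the list returns an end marker), and writing an output word. Every instruction takes one unit of time. At the start the machine is given $n$, $m$ and $k$. **Theorem.** For every $\varepsilon\in(0,1]$ there are a RAM program $P$, a constant $d$ and a function $T:\mathbb N\to\mathbb N$ with $T(n)=\tilde O(n)$, i.e. $T(n)=O(n\log^{c}n)$ for some constant $c$ (all depending only on $\varepsilon$), such that for all $n,m,k$ with $1\le k\le n$,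 every coverage instance with $n$ sets and $m$ elements as above, and every word length $w\ge d(\lfloor\log_2(n+m)\rfloor+1)$ with $2^w>n+m$: 1. $P$ halts within $T(n)$ steps, whatever the outcomes of its random draws; and 2. with probability at least $1-\frac1n$, $P$ outputs $k$ different sets $S\subseteq\mathcal F$ with $\mathcal C(S)\ge\left(1-\frac1e-\varepsilon\right)\mathrm{Opt}_k$. -/

import Mathlib

open Filter Asymptotics

namespace KCover

/-! ### Coverage problems -/

/-- A coverage input: a bipartite graph between `n` sets and `m` elements, given by its edge lists.
Every set has a list of its elements and every element has a list of the sets that contain it. The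
lists are without repetitions, describe the same edges, and are otherwise in arbitrary order. -/
structure CoverageInput (n m : ℕ) where
  /-- the edge list of a set -/
  setList : Fin n → List (Fin m)
  /-- the edge list of an element -/
  elemList : Fin m → List (Fin n)
  nodup_setList : ∀ s, (setList s).Nodup
  nodup_elemList : ∀ e, (elemList e).Nodup
  mem_iff : ∀ s e, e ∈ setList s ↔ s ∈ elemList e

/-- No element is isolated: every element lies in some set. -/
def CoverageInput.NoIsolated {n m : ℕ} (G : CoverageInput n m) : Prop :=
  ∀ e : Fin m, ∃ s : Fin n, e ∈ G.setList s

/-- The coverage function: the size of the union of the sets in `S`. -/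
def CoverageInput.coverage {n m : ℕ} (G : CoverageInput n m) (S : Finset (Fin n)) : ℕ :=
  (S.biUnion fun s => (G.setList s).toFinset).card

/-- The largest coverage of a family of exactly `k` sets. -/
def CoverageInput.opt {n m : ℕ} (G : CoverageInput n m) (k : ℕ) : ℕ :=
  ((Finset.univ : Finset (Fin n)).powersetCard k).sup G.coverage

/-- `out` lists (the indices of) `k` different sets that together cover at least `α` times as many
elements as an optimal choice of `k` sets. -/
def CoverageInput.IsApproxSolution {n m : ℕ} (G : CoverageInput n m) (k : ℕ) (α : ℝ)
    (out : List ℕ) : Prop :=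
  ∃ l : List (Fin n), out = l.map Fin.val ∧ l.Nodup ∧ l.length = k ∧
    α * (G.opt k : ℝ) ≤ (G.coverage l.toFinset : ℝ)

/-- Entry `j` of the edge list of set `s`; the value `m`, which is not an element, marks the end of
the list. -/
def CoverageInput.lookupSet {n m : ℕ} (G : CoverageInput n m) (s j : ℕ) : ℕ :=
  if h : s < n then (((G.setList ⟨s, h⟩)[j]?).map Fin.val).getD m else m

/-- Entry `j` of the edge list of element `e`; the value `n`, which is not a set, marks the end of
the list. -/
def CoverageInput.lookupElem {n m : ℕ} (G : CoverageInput n m) (e j : ℕ) : ℕ :=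
  if h : e < m then (((G.elemList ⟨e, h⟩)[j]?).map Fin.val).getD n else n

/-! ### Randomized random access machines -/

/-- The arithmetic operations of the machine. -/
inductive ArithOp where
  | add
  | sub
  | mul
  | div

/-- Operations on natural numbers: `sub` is truncated at `0`, `div` rounds down. -/
def ArithOp.eval : ArithOp → ℕ → ℕ → ℕ
  | add, a, b => a + b
  | sub, a, b => a - b
  | mul, a, b => a * b
  | div, a, b => a / b

/-- The instructions. Numbers `a`, `b`, `d` name registers, `l` is a position in the program. -/
inductive Instr where
  /-- `reg d := v` -/
  | const (d v : ℕ)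
  /-- `reg d := reg a op reg b` -/
  | arith (op : ArithOp) (d a b : ℕ)
  /-- `reg d := mem (reg a)` -/
  | load (d a : ℕ)
  /-- `mem (reg a) := reg b` -/
  | store (a b : ℕ)
  /-- go to position `l` -/
  | jump (l : ℕ)
  /-- go to position `l` if `reg a = 0` -/
  | jumpZero (a l : ℕ)
  /-- `reg d :=` a fresh uniformly random element of `{0, …, reg a - 1}` (`0` if `reg a = 0`) -/
  | rand (d a : ℕ)
  /-- `reg d :=` entry `reg b` of the edge list of set `reg a` -/
  | readSet (d a b : ℕ)
  /-- `reg d :=` entry `reg b` of the edge list of element `reg a` -/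
  | readElem (d a b : ℕ)
  /-- append `reg a` to the output -/
  | write (a : ℕ)

/-- A program is a finite sequence of instructions. -/
abbrev Program := List Instr

/-- A configuration: program counter, registers, memory cells, and the output so far. -/
structure Config where
  pc : ℕ
  reg : ℕ → ℕ
  mem : ℕ → ℕ
  out : List ℕ

/-- The machine halts when the program counter leaves the program. -/
def Config.Halted (P : Program) (c : Config) : Prop := P.length ≤ c.pc

/-- Write `v` to register `d`, as a word of `w` bits, and proceed to the next instruction. -/
def Config.setReg (w : ℕ) (c : Config) (d v : ℕ) : Config :=
  { c with pc := c.pc + 1, reg := Function.update c.reg d (v % 2 ^ w) }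

/-- The uniform distribution on `{0, …, b - 1}` (the point mass at `0` if `b = 0`). -/
noncomputable def uniformBelow (b : ℕ) : PMF ℕ :=
  PMF.uniformOfFinset (Finset.range (max b 1)) ⟨0, by simp⟩

/-- Execution of one instruction on a machine with words of `w` bits and input `G`. -/
noncomputable def exec {n m : ℕ} (w : ℕ) (G : CoverageInput n m) (c : Config) : Instr → PMF Config
  | .const d v => PMF.pure (c.setReg w d v)
  | .arith op d a b => PMF.pure (c.setReg w d (op.eval (c.reg a) (c.reg b)))
  | .load d a => PMF.pure (c.setReg w d (c.mem (c.reg a)))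
  | .store a b =>
      PMF.pure { c with pc := c.pc + 1, mem := Function.update c.mem (c.reg a) (c.reg b) }
  | .jump l => PMF.pure { c with pc := l }
  | .jumpZero a l => PMF.pure { c with pc := if c.reg a = 0 then l else c.pc + 1 }
  | .rand d a => (uniformBelow (c.reg a)).map (c.setReg w d)
  | .readSet d a b => PMF.pure (c.setReg w d (G.lookupSet (c.reg a) (c.reg b)))
  | .readElem d a b => PMF.pure (c.setReg w d (G.lookupElem (c.reg a) (c.reg b)))
  | .write a => PMF.pure { c with pc := c.pc + 1, out := c.out ++ [c.reg a] }

/-- One time step: one instruction is executed; a halted machine does not move. -/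
noncomputable def step {n m : ℕ} (w : ℕ) (G : CoverageInput n m) (P : Program) (c : Config) :
    PMF Config :=
  match P[c.pc]? with
  | none => PMF.pure c
  | some i => exec w G c i

/-- The initial configuration: registers `0`, `1`, `2` hold `n`, `m`, `k`, all other registers and
all memory cells hold `0`, and nothing has been output. -/
def initConfig (n m k : ℕ) : Config where
  pc := 0
  reg := fun r => if r = 0 then n else if r = 1 then m else if r = 2 then k else 0
  mem := fun _ => 0
  out := []

/-- The distribution of the configuration after `t` time steps. -/
noncomputable def run {n m : ℕ} (w : ℕ) (G : CoverageInput n m) (k : ℕ) (P : Program) :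
    ℕ → PMF Config
  | 0 => PMF.pure (initConfig n m k)
  | t + 1 => (run w G k P t).bind (step w G P)

/-- `T(n) = Õ(n)`, that is, `T(n) = O(n (log n) ^ c)` for some constant `c`. -/
def IsSoftLinear (T : ℕ → ℕ) : Prop :=
  ∃ c : ℕ, (fun n : ℕ => (T n : ℝ)) =O[atTop] fun n : ℕ => (n : ℝ) * Real.log n ^ c

end KCover

/-!
The program samples elements, looks only at the beginnings of their edge lists, and solves the small
instance that it has seen by the greedy algorithm with decreasing thresholds. Let `q ≥ 5 / ε`.

*Truncation.* Only the first `D ≈ 2 q² n / k` sets in the list of an element are ever used. An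
element whose list is cut off lies in `D` sets of the truncated instance, so some `k / q` sets hit
all but the part `1 / q` of these elements; put in place of the `k / q` least useful sets of an
optimal solution, they show that truncation lowers the optimum by at most the part `2 / q`
(`CoverageInput.exists_trunc_near_opt`). Conversely, if the truncated instance has `E` edges, then
the greedy choice of `k` sets covers an amount `a` with `k E = O(n a)` (`exists_covCount_ge`), that
is, an average element has only `O(n a / (k m))` edges.

*Sampling.* To estimate the coverage of all families of `k` sets up to the error `a / q` it
suffices, by Chernoff's bound and a union bound over at most `n ^ k` families, to have
`R₀ ≈ k m log n / a` uniformly random elements. By the bound on `E` these have only `O(n log n)`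
edges. The program draws `B = O(n log n)` elements, without knowing `a`, and reads their truncated
lists until `B` edges have been seen; then at least the first `R₀` elements have been read. The
number of elements that are read depends on the sample, so the union bound runs over all possible
values of this number as well (`card_bad_samples_le`, `Outcome.isApproxSolution`).

*Greedy.* A pass through all sets selects every set whose number of uncovered sample elements
reaches the threshold; after each pass the threshold is multiplied by about `1 - 1 / q`. So each
selected set is within the factor `1 - 1 / q` of the best one, which costs `1 / q` in the ratio
`1 - 1 / e` (`GreedySeq.le_covCount`), and there are `O(q log B)` passes (`passes_le`). The numbers
of uncovered elements are kept in a table; as every edge of the sample is deleted at most once, all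
updates take time `O(B)` (`GreedyState.greedy`).

*The machine.* The deterministic parts are written in a small structured language with an exact step
count, and `Exec.runFrom` translates its executions to runs of the machine. Overflow is excluded by
`Fits`, which holds for words of `d (log₂ (n + m) + 1)` bits (`exists_fits`). `run_program` says
that the final configuration is a function of a uniformly random vector of `B` elements, so that
probabilities become numbers of vectors.
-/

namespace KCover

/-! ### Deterministic runs of the machine -/

/-- The distribution of the configuration `t` steps after the configuration `c`. -/
noncomputable def runFrom {n m : ℕ} (w : ℕ) (G : CoverageInput n m) (P : Program) :
    ℕ → Config → PMF Config
  | 0, c => PMF.pure c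
  | t + 1, c => (runFrom w G P t c).bind (step w G P)

section
variable {n m : ℕ} {w : ℕ} {G : CoverageInput n m} {P : Program}

theorem run_eq_runFrom (k t : ℕ) : run w G k P t = runFrom w G P t (initConfig n m k) := by
  induction t with
  | zero => rfl
  | succ t ih => simp only [run, runFrom, ih]

theorem runFrom_add (s t : ℕ) (c : Config) :
    runFrom w G P (s + t) c = (runFrom w G P s c).bind (runFrom w G P t) := by
  induction t with
  | zero =>
    change runFrom w G P s c = (runFrom w G P s c).bind PMF.pure
    rw [PMF.bind_pure]
  | succ t ih =>
    rw [← add_assoc]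
    change (runFrom w G P (s + t) c).bind _ = (runFrom w G P s c).bind fun c' =>
      (runFrom w G P t c').bind _
    rw [ih, PMF.bind_bind]

theorem runFrom_one (c : Config) : runFrom w G P 1 c = step w G P c := by
  change (PMF.pure c).bind _ = _
  rw [PMF.pure_bind]

theorem runFrom_trans {s t : ℕ} {c c' : Config} {μ : PMF Config}
    (h : runFrom w G P s c = PMF.pure c') (h' : runFrom w G P t c' = μ) :
    runFrom w G P (s + t) c = μ := by
  rw [runFrom_add, h, PMF.pure_bind, h']

theorem runFrom_of_halted {c : Config} (h : c.Halted P) (t : ℕ) :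
    runFrom w G P t c = PMF.pure c := by
  induction t with
  | zero => rfl
  | succ t ih =>
    have h0 : P[c.pc]? = none := List.getElem?_eq_none h
    simp [runFrom, ih, PMF.pure_bind, step, h0]
end

/-! ### A structured language on top of the machine -/

/-- The data part of a configuration: all but the program counter. -/
structure St where
  reg : ℕ → ℕ
  mem : ℕ → ℕ
  out : List ℕ

/-- The configuration with data `σ` and program counter `pc`. -/
def St.at (σ : St) (pc : ℕ) : Config := ⟨pc, σ.reg, σ.mem, σ.out⟩

/-- The number that a deterministic instruction writes to a register, before it is reduced modulo
the word size, and `0` if the instruction writes no register. -/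
def Instr.value {n m : ℕ} (G : CoverageInput n m) (σ : St) : Instr → ℕ
  | .const _ v => v
  | .arith op _ a b => op.eval (σ.reg a) (σ.reg b)
  | .load _ a => σ.mem (σ.reg a)
  | .readSet _ a b => G.lookupSet (σ.reg a) (σ.reg b)
  | .readElem _ a b => G.lookupElem (σ.reg a) (σ.reg b)
  | _ => 0

/-- Overwrite register `d`. -/
def St.set (σ : St) (d v : ℕ) : St := { σ with reg := Function.update σ.reg d v }

/-- The effect of a straight-line instruction on unbounded numbers. Jumps and draws, which have no
place in a straight-line block, are given no effect. -/
def Instr.apply {n m : ℕ} (G : CoverageInput n m) (σ : St) : Instr → St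
  | .const d v => σ.set d v
  | .arith op d a b => σ.set d (op.eval (σ.reg a) (σ.reg b))
  | .load d a => σ.set d (σ.mem (σ.reg a))
  | .store a b => { σ with mem := Function.update σ.mem (σ.reg a) (σ.reg b) }
  | .readSet d a b => σ.set d (G.lookupSet (σ.reg a) (σ.reg b))
  | .readElem d a b => σ.set d (G.lookupElem (σ.reg a) (σ.reg b))
  | .write a => { σ with out := σ.out ++ [σ.reg a] }
  | _ => σ

/-- Instructions that neither jump nor draw random numbers. -/
def Instr.straight : Instr → Bool
  | .jump _ => false
  | .jumpZero _ _ => false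
  | .rand _ _ => false
  | _ => true

/-- Execution of a list of straight-line instructions on unbounded numbers. -/
def applyAll {n m : ℕ} (G : CoverageInput n m) : List Instr → St → St
  | [], σ => σ
  | i :: l, σ => applyAll G l (i.apply G σ)

/-- Every instruction of the list is a straight-line instruction, and no number exceeds the word
size `2 ^ w` when the list is executed. -/
def Safe {n m : ℕ} (w : ℕ) (G : CoverageInput n m) : List Instr → St → Prop
  | [], _ => True
  | i :: l, σ => i.straight = true ∧ i.value G σ < 2 ^ w ∧ Safe w G l (i.apply G σ)

/-- Structured programs: straight-line blocks, composition, conditionals and loops. -/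
inductive Stmt where
  /-- execute the straight-line block `l` -/
  | blk (l : List Instr)
  /-- execute `s`, then `t` -/
  | seq (s t : Stmt)
  /-- if `reg a = 0` then `s` else `t` -/
  | ite (a : ℕ) (s t : Stmt)
  /-- repeat: execute `p`, leave the loop if `reg a = 0`, execute `s` -/
  | loop (p : Stmt) (a : ℕ) (s : Stmt)

/-- The number of machine instructions that a structured program compiles to. -/
def Stmt.size : Stmt → ℕ
  | blk l => l.length
  | seq s t => s.size + t.size
  | ite _ s t => t.size + s.size + 2
  | loop p _ s => p.size + s.size + 2

/-- The machine code of a structured program whose first instruction is at position `o`. In the code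
of a conditional, the branch for nonzero registers comes first and ends with a jump over the other
branch. -/
def Stmt.code : Stmt → ℕ → List Instr
  | blk l, _ => l
  | seq s t, o => s.code o ++ t.code (o + s.size)
  | ite a s t, o => .jumpZero a (o + 1 + t.size + 1) ::
      (t.code (o + 1) ++ .jump (o + 1 + t.size + 1 + s.size) :: s.code (o + 1 + t.size + 1))
  | loop p a s, o => p.code o ++ .jumpZero a (o + p.size + 1 + s.size + 1) ::
      (s.code (o + p.size + 1) ++ [.jump o])

theorem Stmt.length_code (s : Stmt) (o : ℕ) : (s.code o).length = s.size := by
  induction s generalizing o with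
  | blk l => rfl
  | seq s t hs ht => simp [code, size, hs, ht]
  | ite a s t hs ht => simp [code, size, hs, ht]; omega
  | loop p a s hp hs => simp [code, size, hp, hs]; omega

/-- Execution of a structured program with its exact number of machine steps: `Exec w G s σ t σ'`
says that `s`, started in `σ`, ends in `σ'` after `t` steps without overflow. -/
inductive Exec {n m : ℕ} (w : ℕ) (G : CoverageInput n m) : Stmt → St → ℕ → St → Prop
  | blk (l : List Instr) (σ : St) (h : Safe w G l σ) :
      Exec w G (.blk l) σ l.length (applyAll G l σ)
  | seq {s t : Stmt} {σ σ₁ σ₂ : St} {c₁ c₂ : ℕ} (h₁ : Exec w G s σ c₁ σ₁)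
      (h₂ : Exec w G t σ₁ c₂ σ₂) : Exec w G (.seq s t) σ (c₁ + c₂) σ₂
  | iteZero {a : ℕ} {s t : Stmt} {σ σ₁ : St} {c : ℕ} (h : σ.reg a = 0)
      (h₁ : Exec w G s σ c σ₁) : Exec w G (.ite a s t) σ (1 + c) σ₁
  | iteNonzero {a : ℕ} {s t : Stmt} {σ σ₁ : St} {c : ℕ} (h : σ.reg a ≠ 0)
      (h₁ : Exec w G t σ c σ₁) : Exec w G (.ite a s t) σ (1 + c + 1) σ₁
  | loopDone {p : Stmt} {a : ℕ} {s : Stmt} {σ σ₁ : St} {c : ℕ} (h₁ : Exec w G p σ c σ₁)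
      (h : σ₁.reg a = 0) : Exec w G (.loop p a s) σ (c + 1) σ₁
  | loopStep {p : Stmt} {a : ℕ} {s : Stmt} {σ σ₁ σ₂ σ₃ : St} {c₁ c₂ c₃ : ℕ}
      (h₁ : Exec w G p σ c₁ σ₁) (h : σ₁.reg a ≠ 0) (h₂ : Exec w G s σ₁ c₂ σ₂)
      (h₃ : Exec w G (.loop p a s) σ₂ c₃ σ₃) :
      Exec w G (.loop p a s) σ (c₁ + 1 + c₂ + 1 + c₃) σ₃

/-- The list `l` stands in the program `P` from position `o` on. -/
def Located (P : Program) (o : ℕ) (l : List Instr) : Prop :=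
  ∀ i < l.length, P[o + i]? = l[i]?

theorem located_append {P : Program} {o : ℕ} {l l' : List Instr} :
    Located P o (l ++ l') ↔ Located P o l ∧ Located P (o + l.length) l' := by
  constructor
  · intro h
    refine ⟨fun i hi => ?_, fun i hi => ?_⟩
    · rw [h i (by simp; omega), List.getElem?_append_left hi]
    · rw [add_assoc, h (l.length + i) (by simp; omega),
        List.getElem?_append_right (by omega), Nat.add_sub_cancel_left]
  · rintro ⟨h, h'⟩ i hi
    by_cases hl : i < l.length
    · rw [h i hl, List.getElem?_append_left hl]
    · have := h' (i - l.length) (by simp at hi; omega)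
      rw [List.getElem?_append_right (by omega), ← this]
      congr 1; omega

theorem located_cons {P : Program} {o : ℕ} {i : Instr} {l : List Instr} :
    Located P o (i :: l) ↔ P[o]? = some i ∧ Located P (o + 1) l := by
  have := located_append (P := P) (o := o) (l := [i]) (l' := l)
  rw [List.singleton_append] at this
  rw [this]
  simp [Located]

section
variable {n m : ℕ} {w : ℕ} {G : CoverageInput n m} {P : Program}

theorem step_straight {i : Instr} {σ : St} {o : ℕ} (hP : P[o]? = some i)
    (hi : i.straight = true) (hv : i.value G σ < 2 ^ w) :
    step w G P (σ.at o) = PMF.pure ((i.apply G σ).at (o + 1)) := by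
  have hP' : P[(σ.at o).pc]? = some i := hP
  unfold step
  rw [hP']
  cases i <;>
    simp_all [Instr.straight, exec, Instr.apply, St.at, Config.setReg, St.set, Instr.value,
      Nat.mod_eq_of_lt]

theorem runFrom_applyAll {l : List Instr} {σ : St} {o : ℕ} (hP : Located P o l)
    (h : Safe w G l σ) :
    runFrom w G P l.length (σ.at o) = PMF.pure ((applyAll G l σ).at (o + l.length)) := by
  induction l generalizing σ o with
  | nil => rfl
  | cons i l ih =>
    obtain ⟨h₁, h₂, h₃⟩ := h
    obtain ⟨hi, hl⟩ := located_cons.1 hP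
    have := runFrom_trans ((runFrom_one _).trans (step_straight hi h₁ h₂)) (ih hl h₃)
    rw [List.length_cons, add_comm l.length 1, this]
    simp [applyAll, add_assoc]

theorem step_jump {σ : St} {o l : ℕ} (hP : P[o]? = some (.jump l)) :
    step w G P (σ.at o) = PMF.pure (σ.at l) := by
  have hP' : P[(σ.at o).pc]? = some (.jump l) := hP
  unfold step
  rw [hP']
  rfl

theorem step_jumpZero {σ : St} {o a l : ℕ} (hP : P[o]? = some (.jumpZero a l)) :
    step w G P (σ.at o) = PMF.pure (σ.at (if σ.reg a = 0 then l else o + 1)) := by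
  have hP' : P[(σ.at o).pc]? = some (.jumpZero a l) := hP
  unfold step
  rw [hP']
  rfl

/-- Correctness of the compilation of structured programs. -/
theorem Exec.runFrom {s : Stmt} {σ σ' : St} {t : ℕ} (h : Exec w G s σ t σ') {o : ℕ}
    (hP : Located P o (s.code o)) :
    runFrom w G P t (σ.at o) = PMF.pure (σ'.at (o + s.size)) := by
  induction h generalizing o with
  | blk l σ h => exact runFrom_applyAll hP h
  | seq h₁ h₂ ih₁ ih₂ =>
    obtain ⟨p₁, p₂⟩ := located_append.1 hP
    rw [Stmt.length_code] at p₂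
    rw [runFrom_trans (ih₁ p₁) (ih₂ p₂), Stmt.size, add_assoc]
  | @iteZero a s t σ σ₁ c h h₁ ih₁ =>
    obtain ⟨p₁, p₂⟩ := located_cons.1 hP
    obtain ⟨p₂, p₃⟩ := located_append.1 p₂
    obtain ⟨p₃, p₄⟩ := located_cons.1 p₃
    rw [Stmt.length_code] at p₃ p₄
    have := step_jumpZero (w := w) (G := G) (σ := σ) p₁
    rw [if_pos h] at this
    rw [runFrom_trans ((runFrom_one _).trans this) (ih₁ p₄)]
    congr 2; simp only [Stmt.size]; omega
  | @iteNonzero a s t σ σ₁ c h h₁ ih₁ =>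
    obtain ⟨p₁, p₂⟩ := located_cons.1 hP
    obtain ⟨p₂, p₃⟩ := located_append.1 p₂
    obtain ⟨p₃, p₄⟩ := located_cons.1 p₃
    rw [Stmt.length_code] at p₃ p₄
    have := step_jumpZero (w := w) (G := G) (σ := σ) p₁
    rw [if_neg h] at this
    rw [runFrom_trans (runFrom_trans ((runFrom_one _).trans this) (ih₁ p₂))
      ((runFrom_one _).trans (step_jump p₃))]
    congr 2; simp only [Stmt.size]; omega
  | @loopDone p a s σ σ₁ c h₁ h ih₁ =>
    obtain ⟨p₁, p₂⟩ := located_append.1 hP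
    obtain ⟨p₂, p₃⟩ := located_cons.1 p₂
    rw [Stmt.length_code] at p₂ p₃
    have := step_jumpZero (w := w) (G := G) (σ := σ₁) p₂
    rw [if_pos h] at this
    rw [runFrom_trans (ih₁ p₁) ((runFrom_one _).trans this)]
    congr 2; simp only [Stmt.size]; omega
  | @loopStep p a s σ σ₁ σ₂ σ₃ c₁ c₂ c₃ h₁ h h₂ h₃ ih₁ ih₂ ih₃ =>
    obtain ⟨p₁, p₂⟩ := located_append.1 hP
    obtain ⟨p₂, p₃⟩ := located_cons.1 p₂
    obtain ⟨p₃, p₄⟩ := located_append.1 p₃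
    obtain ⟨p₄, -⟩ := located_cons.1 p₄
    rw [Stmt.length_code] at p₂ p₃ p₄
    rw [Stmt.length_code] at p₄
    have := step_jumpZero (w := w) (G := G) (σ := σ₁) p₂
    rw [if_neg h] at this
    exact runFrom_trans (runFrom_trans (runFrom_trans (runFrom_trans (ih₁ p₁)
      ((runFrom_one _).trans this)) (ih₂ p₃)) ((runFrom_one _).trans (step_jump p₄))) (ih₃ hP)
end

/-! ### Total correctness with time bounds -/

section
variable {n m : ℕ} {w : ℕ} {G : CoverageInput n m}

/-- Total correctness with a time bound: `s`, started in `σ`, ends after at most `C` steps in a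
state that satisfies `Q`. -/
def Ends (w : ℕ) (G : CoverageInput n m) (s : Stmt) (σ : St) (C : ℕ) (Q : St → Prop) : Prop :=
  ∃ t ≤ C, ∃ σ', Exec w G s σ t σ' ∧ Q σ'

theorem Ends.blk {l : List Instr} {σ : St} {C : ℕ} {Q : St → Prop} (h : Safe w G l σ)
    (hC : l.length ≤ C) (hQ : Q (applyAll G l σ)) : Ends w G (.blk l) σ C Q :=
  ⟨_, hC, _, .blk l σ h, hQ⟩

theorem Ends.skip {σ : St} {Q : St → Prop} (hQ : Q σ) : Ends w G (.blk []) σ 0 Q :=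
  Ends.blk trivial le_rfl hQ

theorem Ends.seq {s t : Stmt} {σ : St} {C₁ C₂ : ℕ} {R Q : St → Prop} (h : Ends w G s σ C₁ R)
    (h' : ∀ σ', R σ' → Ends w G t σ' C₂ Q) : Ends w G (.seq s t) σ (C₁ + C₂) Q := by
  obtain ⟨c, hc, σ', h₁, hR⟩ := h
  obtain ⟨c', hc', σ'', h₂, hQ⟩ := h' σ' hR
  exact ⟨_, add_le_add hc hc', _, .seq h₁ h₂, hQ⟩

theorem Ends.mono {s : Stmt} {σ : St} {C C' : ℕ} {Q Q' : St → Prop} (h : Ends w G s σ C Q)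
    (hC : C ≤ C') (hQ : ∀ σ', Q σ' → Q' σ') : Ends w G s σ C' Q' := by
  obtain ⟨c, hc, σ', h₁, h₂⟩ := h
  exact ⟨c, hc.trans hC, σ', h₁, hQ _ h₂⟩

theorem Ends.iteZero {a : ℕ} {s t : Stmt} {σ : St} {C : ℕ} {Q : St → Prop} (h : σ.reg a = 0)
    (h₁ : Ends w G s σ C Q) : Ends w G (.ite a s t) σ (C + 1) Q := by
  obtain ⟨c, hc, σ', h₂, hQ⟩ := h₁
  exact ⟨_, by omega, _, .iteZero h h₂, hQ⟩

theorem Ends.iteNonzero {a : ℕ} {s t : Stmt} {σ : St} {C : ℕ} {Q : St → Prop} (h : σ.reg a ≠ 0)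
    (h₁ : Ends w G t σ C Q) : Ends w G (.ite a s t) σ (C + 2) Q := by
  obtain ⟨c, hc, σ', h₂, hQ⟩ := h₁
  exact ⟨_, by omega, _, .iteNonzero h h₂, hQ⟩

theorem Ends.loopDone {p : Stmt} {a : ℕ} {s : Stmt} {σ : St} {C : ℕ} {Q : St → Prop}
    (h : Ends w G p σ C fun σ' => σ'.reg a = 0 ∧ Q σ') : Ends w G (.loop p a s) σ (C + 1) Q := by
  obtain ⟨c, hc, σ', h₂, h0, hQ⟩ := h
  exact ⟨_, by omega, _, .loopDone h₂ h0, hQ⟩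

theorem Ends.loopStep {p : Stmt} {a : ℕ} {s : Stmt} {σ : St} {C₁ C₂ C₃ : ℕ} {Q R S : St → Prop}
    (h : Ends w G p σ C₁ fun σ' => σ'.reg a ≠ 0 ∧ R σ')
    (h' : ∀ σ', R σ' → Ends w G s σ' C₂ S)
    (h'' : ∀ σ', S σ' → Ends w G (.loop p a s) σ' C₃ Q) :
    Ends w G (.loop p a s) σ (C₁ + C₂ + C₃ + 2) Q := by
  obtain ⟨c, hc, σ₁, h₁, h0, hR⟩ := h
  obtain ⟨c', hc', σ₂, h₂, hS⟩ := h' σ₁ hR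
  obtain ⟨c'', hc'', σ₃, h₃, hQ⟩ := h'' σ₂ hS
  exact ⟨_, by omega, _, .loopStep h₁ h0 h₂ h₃, hQ⟩

/-! ### Scanning the truncated edge list of an element -/

/-- The first `D` sets in the edge list of element `e`; the empty list if `e` is no element. -/
def CoverageInput.trunc (G : CoverageInput n m) (D e : ℕ) : List ℕ :=
  if h : e < m then ((G.elemList ⟨e, h⟩).map Fin.val).take D else []

theorem CoverageInput.length_trunc_le (G : CoverageInput n m) (D e : ℕ) :
    (G.trunc D e).length ≤ D := by
  unfold trunc; split <;> simp

theorem CoverageInput.trunc_of_le (G : CoverageInput n m) (D : ℕ) {e : ℕ} (h : m ≤ e) :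
    G.trunc D e = [] := by
  simp [trunc, h]

theorem CoverageInput.lt_of_mem_trunc (G : CoverageInput n m) {D e v : ℕ}
    (h : v ∈ G.trunc D e) : v < n := by
  unfold trunc at h
  split at h
  · obtain ⟨s, -, rfl⟩ := List.mem_map.1 (List.mem_of_mem_take h)
    exact s.2
  · simp at h

theorem CoverageInput.nodup_trunc (G : CoverageInput n m) (D e : ℕ) : (G.trunc D e).Nodup := by
  unfold trunc
  split
  · exact ((G.nodup_elemList _).map Fin.val_injective).sublist (List.take_sublist _ _)
  · simp

theorem CoverageInput.lookupElem_le (G : CoverageInput n m) (e j : ℕ) : G.lookupElem e j ≤ n := by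
  unfold lookupElem
  split
  · rename_i h
    cases (G.elemList ⟨e, h⟩)[j]? with
    | none => simp
    | some s => simp [s.2.le]
  · exact le_rfl

theorem CoverageInput.lookupElem_eq_getElem (G : CoverageInput n m) {D e j : ℕ}
    (h : j < (G.trunc D e).length) : G.lookupElem e j = (G.trunc D e)[j] := by
  by_cases he : e < m
  · simp only [trunc, he, dif_pos] at h ⊢
    have hj : j < (G.elemList ⟨e, he⟩).length := by simp at h; omega
    simp [lookupElem, he, hj]
  · simp [trunc, he] at h

/-- The machine recognizes the end of a truncated list by an arithmetic test: the first factor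
vanishes at the end marker `n` of the list, the second one at the position `D`. -/
theorem CoverageInput.lookupElem_test (G : CoverageInput n m) (D e j : ℕ) :
    (n - G.lookupElem e j) * (D - j) ≠ 0 ↔ j < (G.trunc D e).length := by
  constructor
  · intro h
    obtain ⟨h₁, h₂⟩ := mul_ne_zero_iff.1 h
    have he : e < m := by
      by_contra he
      simp [lookupElem, he] at h₁
    simp only [trunc, he, dif_pos, List.length_take, List.length_map]
    have : j < (G.elemList ⟨e, he⟩).length := by
      by_contra hj
      simp [lookupElem, he, List.getElem?_eq_none (not_lt.1 hj)] at h₁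
    omega
  · intro h
    have h₁ := G.lt_of_mem_trunc (List.getElem_mem h)
    rw [← G.lookupElem_eq_getElem h] at h₁
    have := (G.length_trunc_le D e)
    exact mul_ne_zero (by omega) (by omega)

/-- Run through the truncated edge list of the element in register `11`, with the position in
register `12` and the entry in register `13`. Registers `0`, `4`, `5` hold `n`, the truncation
bound, and `1`. -/
def scan (body : List Instr) : Stmt :=
  .loop (.blk [.readElem 13 11 12, .arith .sub 8 0 13, .arith .sub 9 4 12, .arith .mul 8 8 9]) 8
    (.blk (body ++ [.arith .add 12 12 5]))

/-- Loop rule for `scan`: the invariant `I j` holds when `j` entries have been processed. -/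
theorem Ends.scan {body : List Instr} {D e : ℕ} (I : ℕ → St → Prop)
    (hn : n < 2 ^ w) (hD : D < 2 ^ w) (hnD : n * D < 2 ^ w)
    (hreg : ∀ j σ, I j σ → σ.reg 0 = n ∧ σ.reg 4 = D ∧ σ.reg 5 = 1 ∧ σ.reg 11 = e ∧ σ.reg 12 = j)
    (htest : ∀ j σ, I j σ → ∀ a b c d, I j ((((σ.set 13 a).set 8 b).set 9 c).set 8 d))
    (hbody : ∀ j σ, (hj : j < (G.trunc D e).length) → I j σ → σ.reg 13 = (G.trunc D e)[j] →
      Safe w G (body ++ [.arith .add 12 12 5]) σ ∧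
        I (j + 1) (applyAll G (body ++ [.arith .add 12 12 5]) σ))
    {σ : St} (hσ : I 0 σ) :
    Ends w G (KCover.scan body) σ ((G.trunc D e).length * (body.length + 7) + 5)
      (I (G.trunc D e).length) := by
  suffices H : ∀ i j, j + i = (G.trunc D e).length → ∀ σ, I j σ →
      Ends w G (KCover.scan body) σ (i * (body.length + 7) + 5) (I (G.trunc D e).length) from
    H _ 0 (by simp) σ hσ
  have hpre : ∀ j σ, I j σ →
      Ends w G (.blk [.readElem 13 11 12, .arith .sub 8 0 13, .arith .sub 9 4 12,
        .arith .mul 8 8 9]) σ 4 fun σ' => (σ'.reg 8 ≠ 0 ↔ j < (G.trunc D e).length) ∧ I j σ' ∧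
          σ'.reg 13 = G.lookupElem e j := by
    intro j σ h
    obtain ⟨h0, h4, h5, h11, h12⟩ := hreg j σ h
    have hl := G.lookupElem_le e j
    have hmul : (n - G.lookupElem e j) * (D - j) ≤ n * D :=
      Nat.mul_le_mul (Nat.sub_le _ _) (Nat.sub_le _ _)
    refine Ends.blk ?_ le_rfl ⟨?_, ?_, ?_⟩
    · simp [Safe, Instr.straight, Instr.value, Instr.apply, St.set, ArithOp.eval, h0, h4, h11,
        h12]
      omega
    · simpa [applyAll, Instr.apply, St.set, ArithOp.eval, h0, h4, h11, h12] using
        G.lookupElem_test D e j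
    · exact htest j σ h _ _ _ _
    · simp [applyAll, Instr.apply, St.set, ArithOp.eval, h11, h12]
  intro i
  induction i with
  | zero =>
    intro j hj σ h
    refine (Ends.loopDone (C := 4) ?_).mono (by omega) fun _ => id
    refine (hpre j σ h).mono le_rfl fun σ' h' => ⟨?_, ?_⟩
    · by_contra h8
      have := h'.1.1 h8
      omega
    · rw [← hj]; exact h'.2.1
  | succ i ih =>
    intro j hj σ h
    have hj' : j < (G.trunc D e).length := by omega
    refine (Ends.loopStep (C₁ := 4) (C₂ := body.length + 1) (C₃ := i * (body.length + 7) + 5)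
      (S := I (j + 1)) ((hpre j σ h).mono le_rfl fun σ' h' => ⟨h'.1.2 hj', h'.2⟩) ?_ ?_).mono
      (by rw [add_mul]; omega) fun _ => id
    · rintro σ' ⟨h₁, h₂⟩
      obtain ⟨hs, hI⟩ := hbody j σ' hj' h₁ (by rw [h₂, G.lookupElem_eq_getElem hj'])
      exact Ends.blk hs (by simp) hI
    · exact ih (j + 1) (by omega)

/-! ### Memory layout -/

/-- The layout of the memory: cells `0, …, B - 1` hold the sampled elements `x`, the next `B` cells
hold the table `val`, indexed by sets, and `adj u p`, the `p`-th entry of a list that belongs to the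
set `u`, is interleaved with the lists of the other sets. So all lists can grow without knowing
their lengths in advance; position `0` of each list stays empty. -/
structure MemIs (n B : ℕ) (mem x val : ℕ → ℕ) (adj : ℕ → ℕ → ℕ) : Prop where
  x : ∀ r < B, mem r = x r
  val : ∀ v < n, mem (B + v) = val v
  adj : ∀ u < n, ∀ p, mem (2 * B + p * n + u) = adj u p

theorem MemIs.setX {B : ℕ} {mem x val : ℕ → ℕ} {adj : ℕ → ℕ → ℕ} (h : MemIs n B mem x val adj)
    (r y : ℕ) (hr : r < B) :
    MemIs n B (Function.update mem r y) (Function.update x r y) val adj where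
  x r' hr' := by simp only [Function.update_apply, h.x r' hr']
  val v hv := by rw [Function.update_of_ne (by omega), h.val v hv]
  adj u hu p := by rw [Function.update_of_ne (by omega), h.adj u hu p]

theorem MemIs.setVal {B : ℕ} {mem x val : ℕ → ℕ} {adj : ℕ → ℕ → ℕ} (h : MemIs n B mem x val adj)
    (hB : n ≤ B) (v y : ℕ) (hv : v < n) :
    MemIs n B (Function.update mem (B + v) y) x (Function.update val v y) adj where
  x r' hr' := by rw [Function.update_of_ne (by omega), h.x r' hr']
  val v' hv' := by simp only [Function.update_apply, h.val v' hv', add_right_inj]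
  adj u hu p := by rw [Function.update_of_ne (by omega), h.adj u hu p]

theorem MemIs.setAdj {B : ℕ} {mem x val : ℕ → ℕ} {adj : ℕ → ℕ → ℕ} (h : MemIs n B mem x val adj)
    (hB : n ≤ B) (v p y : ℕ) (hv : v < n) :
    MemIs n B (Function.update mem (2 * B + p * n + v) y) x val
      (Function.update adj v (Function.update (adj v) p y)) where
  x r' hr' := by rw [Function.update_of_ne (by omega), h.x r' hr']
  val v' hv' := by rw [Function.update_of_ne (by omega), h.val v' hv']
  adj u hu p' := by
    by_cases huv : u = v
    · subst huv
      by_cases hp : p' = p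
      · subst hp; simp
      · rw [Function.update_of_ne, h.adj u hu p', Function.update_self, Function.update_of_ne hp]
        intro h'
        have : p' * n = p * n := by omega
        exact hp (Nat.eq_of_mul_eq_mul_right (by omega) this)
    · rw [Function.update_of_ne, h.adj u hu p', Function.update_of_ne huv]
      intro h'
      -- modulo `n`, the address determines the set
      have h₁ : (u + n * p') % n = (v + n * p) % n := by
        rw [mul_comm n, mul_comm n]; congr 1; omega
      rw [Nat.add_mul_mod_self_left, Nat.add_mul_mod_self_left, Nat.mod_eq_of_lt hu,
        Nat.mod_eq_of_lt hv] at h₁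
      exact huv h₁

/-- The lists `adj v 1, …, adj v (val v - 1)` enumerate the numbers `r + 1` for which `v` and `r`
are related by `ρ`; behind them there are only zeros. Storing `r + 1` makes `0` an end marker. -/
structure AdjIs (n : ℕ) (val : ℕ → ℕ) (adj : ℕ → ℕ → ℕ) (ρ : ℕ → ℕ → Prop) : Prop where
  pos : ∀ v < n, 1 ≤ val v
  sound : ∀ v < n, ∀ p, 1 ≤ p → p < val v → ∃ r, adj v p = r + 1 ∧ ρ v r
  complete : ∀ v < n, ∀ r, ρ v r → ∃ p, 1 ≤ p ∧ p < val v ∧ adj v p = r + 1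
  zero : ∀ v < n, ∀ p, val v ≤ p → adj v p = 0

theorem AdjIs.insert {val : ℕ → ℕ} {adj : ℕ → ℕ → ℕ} {ρ : ℕ → ℕ → Prop} (h : AdjIs n val adj ρ)
    (v r : ℕ) :
    AdjIs n (Function.update val v (val v + 1))
      (Function.update adj v (Function.update (adj v) (val v) (r + 1)))
      (fun v' r' => ρ v' r' ∨ (v' = v ∧ r' = r)) where
  pos v' hv' := by
    by_cases hv : v' = v
    · subst hv; simp
    · simpa [hv] using h.pos v' hv'
  sound v' hv' p hp hp' := by
    by_cases hv : v' = v
    · subst hv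
      by_cases hpv : p = val v'
      · subst hpv; simp
      · obtain ⟨r', h₁, h₂⟩ := h.sound v' hv' p hp (by simp at hp'; omega)
        exact ⟨r', by simpa [hpv] using h₁, .inl h₂⟩
    · obtain ⟨r', h₁, h₂⟩ := h.sound v' hv' p hp (by simpa [hv] using hp')
      exact ⟨r', by simpa [hv] using h₁, .inl h₂⟩
  complete v' hv' r' hr' := by
    rcases hr' with hr' | ⟨rfl, rfl⟩
    · obtain ⟨p, h₁, h₂, h₃⟩ := h.complete v' hv' r' hr'
      refine ⟨p, h₁, ?_, ?_⟩
      · by_cases hv : v' = v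
        · subst hv; simp; omega
        · simpa [hv] using h₂
      · by_cases hv : v' = v
        · subst hv
          simpa [h₂.ne] using h₃
        · simpa [hv] using h₃
    · exact ⟨val v', h.pos v' hv', by simp, by simp⟩
  zero v' hv' p hp := by
    by_cases hv : v' = v
    · subst hv
      rw [Function.update_self] at hp
      have hpv : p ≠ val v' := by omega
      simpa [hpv] using h.zero v' hv' p (by omega)
    · simpa [hv] using h.zero v' hv' p (by simpa [hv] using hp)

theorem AdjIs.congr {val : ℕ → ℕ} {adj : ℕ → ℕ → ℕ} {ρ ρ' : ℕ → ℕ → Prop} (h : AdjIs n val adj ρ)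
    (hρ : ∀ v r, ρ v r ↔ ρ' v r) : AdjIs n val adj ρ' := by
  have : ρ = ρ' := by ext v r; exact hρ v r
  exact this ▸ h
end

/-! ### Collecting the edges of the sample -/

/-- Bounds that exclude overflow: `B` is the number of samples, `D` the truncation bound, `q` the
constant of the threshold rule. -/
structure Fits (w n m B D q : ℕ) : Prop where
  le_B : n ≤ B
  lt_pow : 4 * ((B + D + n + 3) * (B + D + n + 3)) + m + q + 1 < 2 ^ w

/-- The registers that keep their values once they are set. -/
structure Consts (n m B D q : ℕ) (σ : St) : Prop where
  r0 : σ.reg 0 = n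
  r1 : σ.reg 1 = m
  r3 : σ.reg 3 = B
  r4 : σ.reg 4 = D
  r5 : σ.reg 5 = 1
  r6 : σ.reg 6 = 2 * B
  r19 : σ.reg 19 = q

theorem Consts.set {n m B D q : ℕ} {σ : St} (h : Consts n m B D q σ) {d v : ℕ}
    (hd : d ≠ 0 ∧ d ≠ 1 ∧ d ≠ 3 ∧ d ≠ 4 ∧ d ≠ 5 ∧ d ≠ 6 ∧ d ≠ 19) :
    Consts n m B D q (σ.set d v) := by
  obtain ⟨h0, h1, h3, h4, h5, h6, h19⟩ := hd
  constructor <;> simp [St.set, *, Ne.symm, h.r0, h.r1, h.r3, h.r4, h.r5, h.r6, h.r19]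

theorem Consts.congr {n m B D q : ℕ} {σ σ' : St} (h : Consts n m B D q σ) (h' : σ'.reg = σ.reg) :
    Consts n m B D q σ' := by
  constructor <;> simp [h', h.r0, h.r1, h.r3, h.r4, h.r5, h.r6, h.r19]

section
variable {n m : ℕ} {w : ℕ} {G : CoverageInput n m}

/-- The number of the elements `x 0, …, x (R - 1)` whose truncated lists contain the set `v`. -/
def CoverageInput.hits (G : CoverageInput n m) (D : ℕ) (x : ℕ → ℕ) (R v : ℕ) : ℕ :=
  ∑ r ∈ Finset.range R, (G.trunc D (x r)).count v

/-- The number of edges in the truncated lists of `x 0, …, x (R - 1)`. -/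
def CoverageInput.total (G : CoverageInput n m) (D : ℕ) (x : ℕ → ℕ) (R : ℕ) : ℕ :=
  ∑ r ∈ Finset.range R, (G.trunc D (x r)).length

theorem CoverageInput.hits_succ (G : CoverageInput n m) (D : ℕ) (x : ℕ → ℕ) (R v : ℕ) :
    G.hits D x (R + 1) v = G.hits D x R v + (G.trunc D (x R)).count v := by
  simp [hits, Finset.sum_range_succ]

theorem CoverageInput.total_succ (G : CoverageInput n m) (D : ℕ) (x : ℕ → ℕ) (R : ℕ) :
    G.total D x (R + 1) = G.total D x R + (G.trunc D (x R)).length := by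
  simp [total, Finset.sum_range_succ]

theorem CoverageInput.hits_le_total (G : CoverageInput n m) (D : ℕ) (x : ℕ → ℕ) (R v : ℕ) :
    G.hits D x R v ≤ G.total D x R :=
  Finset.sum_le_sum fun _ _ => List.count_le_length

/-- Append the sample number in register `7`, plus one, to the list of the set in register `13`. The
table entry of this set is the next free position of its list; it is increased by one. -/
def addEdge : List Instr :=
  [.arith .add 14 3 13, .load 15 14, .arith .mul 16 15 0, .arith .add 16 16 13,
    .arith .add 16 16 6, .arith .add 17 7 5, .store 16 17, .arith .add 15 15 5, .store 14 15,
    .arith .add 10 10 5]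

/-- Read the truncated edge lists of the samples one after the other until all samples are read, or
at least `B` edges. Register `7` counts samples and register `10` counts edges. -/
def build : Stmt :=
  .loop (.blk [.arith .sub 8 3 7, .arith .sub 9 3 10, .arith .mul 8 8 9]) 8
    (.seq (.seq (.blk [.load 11 7, .const 12 0]) (scan addEdge)) (.blk [.arith .add 7 7 5]))

/-- The state when `build` has read `r` samples and `j` edges of the next sample, which is `e`. The
table entry of a set is one more than the number of samples in its list. -/
structure BuildState (G : CoverageInput n m) (B D q k : ℕ) (x : ℕ → ℕ) (r e j : ℕ) (σ : St) :
    Prop where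
  consts : Consts n m B D q σ
  r2 : σ.reg 2 = k
  r7 : σ.reg 7 = r
  r10 : σ.reg 10 = G.total D x r + j
  out : σ.out = []
  mem : ∃ val adj, MemIs n B σ.mem x val adj ∧
    AdjIs n val adj (fun v r' => (r' < r ∧ v ∈ G.trunc D (x r')) ∨
      (r' = r ∧ v ∈ (G.trunc D e).take j)) ∧
    ∀ v < n, val v = 1 + G.hits D x r v + ((G.trunc D e).take j).count v

theorem BuildState.set {B D q k : ℕ} {x : ℕ → ℕ} {r e j : ℕ} {σ : St}
    (h : BuildState G B D q k x r e j σ) {d v : ℕ}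
    (hd : d ≠ 0 ∧ d ≠ 1 ∧ d ≠ 3 ∧ d ≠ 4 ∧ d ≠ 5 ∧ d ≠ 6 ∧ d ≠ 19) (h2 : d ≠ 2) (h7 : d ≠ 7)
    (h10 : d ≠ 10) : BuildState G B D q k x r e j (σ.set d v) where
  consts := h.consts.set hd
  r2 := by simp [St.set, Ne.symm h2, h.r2]
  r7 := by simp [St.set, Ne.symm h7, h.r7]
  r10 := by simp [St.set, Ne.symm h10, h.r10]
  out := h.out
  mem := h.mem

/-- One round of the scan of the sample `e`: its `j`-th edge is added to the lists. -/
theorem BuildState.addEdge {B D q k : ℕ} {x : ℕ → ℕ} {r e j : ℕ} {σ : St}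
    (h : BuildState G B D q k x r e j σ) (hF : Fits w n m B D q) (hr : r < B)
    (htot : G.total D x r < B) (hj : j < (G.trunc D e).length) (h12 : σ.reg 12 = j)
    (h13 : σ.reg 13 = (G.trunc D e)[j]) :
    Safe w G (addEdge ++ [.arith .add 12 12 5]) σ ∧
      BuildState G B D q k x r e (j + 1) (applyAll G (addEdge ++ [.arith .add 12 12 5]) σ) := by
  obtain ⟨⟨h0, h1, h3, h4, h5, h6, h19⟩, h2, h7, h10, hout, val, adj, hmem, hadj, hval⟩ := h
  have hW := hF.lt_pow
  have hB := hF.le_B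
  set v := (G.trunc D e)[j] with hv_def
  have hv : v < n := G.lt_of_mem_trunc (List.getElem_mem hj)
  have hD := G.length_trunc_le D e
  have hvalv : val v ≤ B + D := by
    have h₁ := G.hits_le_total D x r v
    have h₂ : ((G.trunc D e).take j).count v ≤ j :=
      List.count_le_length.trans (by simp)
    rw [hval v hv]; omega
  have hmul : val v * n ≤ (B + D + n + 3) * (B + D + n + 3) :=
    Nat.mul_le_mul (by omega) (by omega)
  have hZ : B + D + n + 3 ≤ (B + D + n + 3) * (B + D + n + 3) := Nat.le_mul_self _
  have hm := hmem.val v hv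
  constructor
  · simp [KCover.addEdge, Safe, Instr.straight, Instr.value, Instr.apply, St.set, ArithOp.eval, h0,
      h3, h5, h6, h7, h10, h12, h13, hm]
    omega
  · refine ⟨⟨?_, ?_, ?_, ?_, ?_, ?_, ?_⟩, ?_, ?_, ?_, ?_, Function.update val v (val v + 1),
      Function.update adj v (Function.update (adj v) (val v) (r + 1)), ?_, ?_, ?_⟩
    · simpa [applyAll, KCover.addEdge, Instr.apply, St.set] using h0
    · simpa [applyAll, KCover.addEdge, Instr.apply, St.set] using h1
    · simpa [applyAll, KCover.addEdge, Instr.apply, St.set] using h3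
    · simpa [applyAll, KCover.addEdge, Instr.apply, St.set] using h4
    · simpa [applyAll, KCover.addEdge, Instr.apply, St.set] using h5
    · simpa [applyAll, KCover.addEdge, Instr.apply, St.set] using h6
    · simpa [applyAll, KCover.addEdge, Instr.apply, St.set] using h19
    · simpa [applyAll, KCover.addEdge, Instr.apply, St.set] using h2
    · simpa [applyAll, KCover.addEdge, Instr.apply, St.set] using h7
    · simp [applyAll, KCover.addEdge, Instr.apply, St.set, ArithOp.eval, h10, h5, add_assoc]
    · simpa [applyAll, KCover.addEdge, Instr.apply, St.set] using hout
    · have := (hmem.setAdj hB v (val v) (r + 1) hv).setVal hB v (val v + 1) hv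
      have ha : val v * n + v + 2 * B = 2 * B + val v * n + v := by omega
      simpa [applyAll, KCover.addEdge, Instr.apply, St.set, ArithOp.eval, h0, h3, h5, h6, h7, h13,
        hm, ha] using this
    · refine (hadj.insert v r).congr fun v' r' => ?_
      rw [List.take_add_one, List.getElem?_eq_getElem hj]
      simp only [List.mem_append, Option.toList_some, List.mem_singleton]
      tauto
    · intro v' hv'
      rw [List.take_add_one, List.getElem?_eq_getElem hj, Option.toList_some, List.count_append,
        ← hv_def]
      by_cases hvv : v' = v
      · rw [hvv, Function.update_self, hval v hv]; simp; omega
      · rw [Function.update_of_ne hvv, hval v' hv']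
        simp [Ne.symm hvv]

/-- All edges of the sample `e` are added to the lists. -/
theorem BuildState.scan {B D q k : ℕ} {x : ℕ → ℕ} {r e : ℕ} {σ : St}
    (h : BuildState G B D q k x r e 0 σ) (hF : Fits w n m B D q) (hr : r < B)
    (htot : G.total D x r < B) (h11 : σ.reg 11 = e) (h12 : σ.reg 12 = 0) :
    Ends w G (scan KCover.addEdge) σ ((G.trunc D e).length * 17 + 5)
      (BuildState G B D q k x r e (G.trunc D e).length) := by
  have hW := hF.lt_pow
  have hmul : n * D ≤ (B + D + n + 3) * (B + D + n + 3) :=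
    Nat.mul_le_mul (by omega) (by omega)
  have hZ : B + D + n + 3 ≤ (B + D + n + 3) * (B + D + n + 3) := Nat.le_mul_self _
  refine (Ends.scan (D := D) (e := e)
    (fun j σ => BuildState G B D q k x r e j σ ∧ σ.reg 11 = e ∧ σ.reg 12 = j) (by omega) (by omega)
    (by omega) ?_ ?_ ?_ ⟨h, h11, h12⟩).mono le_rfl fun σ' h' => h'.1
  · rintro j σ ⟨h, h11, h12⟩
    exact ⟨h.consts.r0, h.consts.r4, h.consts.r5, h11, h12⟩
  · rintro j σ ⟨h, h11, h12⟩ a b c d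
    refine ⟨?_, by simpa [St.set] using h11, by simpa [St.set] using h12⟩
    exact (((h.set (by decide) (by decide) (by decide) (by decide)).set (by decide) (by decide)
      (by decide) (by decide)).set (by decide) (by decide) (by decide) (by decide)).set (by decide)
      (by decide) (by decide) (by decide)
  · rintro j σ hj ⟨h, h11, h12⟩ h13
    obtain ⟨h₁, h₂⟩ := h.addEdge hF hr htot hj h12 h13
    refine ⟨h₁, h₂, ?_, ?_⟩
    · simpa [applyAll, KCover.addEdge, Instr.apply, St.set] using h11
    · simp [applyAll, KCover.addEdge, Instr.apply, St.set, ArithOp.eval, h12, h.consts.r5]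

/-- Passing to the next sample: a completely read sample `r` counts among the first `r + 1` ones. -/
theorem BuildState.next {B D q k : ℕ} {x : ℕ → ℕ} {r e e' : ℕ} {σ σ' : St} (he : e = x r)
    (h : BuildState G B D q k x r e (G.trunc D e).length σ)
    (hc : Consts n m B D q σ') (h2 : σ'.reg 2 = k) (h7 : σ'.reg 7 = r + 1)
    (h10 : σ'.reg 10 = σ.reg 10) (ho : σ'.out = σ.out) (hm : σ'.mem = σ.mem) :
    BuildState G B D q k x (r + 1) e' 0 σ' := by
  subst he
  obtain ⟨val, adj, h₁, h₂, h₃⟩ := h.mem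
  refine ⟨hc, h2, h7, by rw [h10, h.r10, G.total_succ, add_zero], by rw [ho, h.out], val, adj,
    by rw [hm]; exact h₁, h₂.congr fun v r' => ?_, fun v hv => ?_⟩
  · simp only [List.take_length, List.take_zero, List.not_mem_nil, and_false, or_false,
      Nat.lt_succ_iff_lt_or_eq]
    constructor
    · rintro (⟨h, h'⟩ | ⟨rfl, h'⟩)
      exacts [⟨.inl h, h'⟩, ⟨.inr rfl, h'⟩]
    · rintro ⟨h | rfl, h'⟩
      exacts [.inl ⟨h, h'⟩, .inr ⟨rfl, h'⟩]
  · rw [h₃ v hv, G.hits_succ, List.take_length]; simp; omega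

/-- The samples are read until there are none left or `B` edges have been seen; as a list has at
most `D` entries, at most `B + D` edges are read. Each sample costs 15 steps and each edge 17 steps.
-/
theorem BuildState.build {B D q k : ℕ} {x : ℕ → ℕ} {r e : ℕ} {σ : St}
    (h : BuildState G B D q k x r e 0 σ) (hF : Fits w n m B D q) (hx : ∀ r, x r ≤ m) (hr : r ≤ B)
    (htot : G.total D x r ≤ B + D) (hlt : ∀ r' < r, G.total D x r' < B) :
    Ends w G build σ ((B - r) * 15 + (B + D - G.total D x r) * 17 + 4) fun σ' =>
      ∃ R ≤ B, (∀ r' < R, G.total D x r' < B) ∧ (R = B ∨ B ≤ G.total D x R) ∧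
        G.total D x R ≤ B + D ∧ BuildState G B D q k x R 0 0 σ' := by
  have hW := hF.lt_pow
  have hmul : (B - r) * (B - G.total D x r) ≤ (B + D + n + 3) * (B + D + n + 3) :=
    Nat.mul_le_mul (by omega) (by omega)
  have hZ : B + D + n + 3 ≤ (B + D + n + 3) * (B + D + n + 3) := Nat.le_mul_self _
  have hpre : Ends w G (.blk [.arith .sub 8 3 7, .arith .sub 9 3 10, .arith .mul 8 8 9]) σ 3
      fun σ' => (σ'.reg 8 ≠ 0 ↔ r < B ∧ G.total D x r < B) ∧ BuildState G B D q k x r e 0 σ' := by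
    refine Ends.blk ?_ le_rfl ⟨?_, ?_⟩
    · simp [Safe, Instr.straight, Instr.value, Instr.apply, St.set, ArithOp.eval, h.consts.r3,
        h.r7, h.r10]
      omega
    · simp [applyAll, Instr.apply, St.set, ArithOp.eval, h.consts.r3, h.r7, h.r10]
      omega
    · exact ((h.set (by decide) (by decide) (by decide) (by decide)).set (by decide) (by decide)
        (by decide) (by decide)).set (by decide) (by decide) (by decide) (by decide)
  by_cases hc : r < B ∧ G.total D x r < B
  · obtain ⟨hrB, htB⟩ := hc
    refine (Ends.loopStep (C₁ := 3) (C₂ := 2 + ((G.trunc D (x r)).length * 17 + 5) + 1)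
      (S := BuildState G B D q k x (r + 1) e 0)
      (C₃ := (B - (r + 1)) * 15 + (B + D - G.total D x (r + 1)) * 17 + 4)
      (hpre.mono le_rfl fun σ' h' => ⟨h'.1.2 ⟨hrB, htB⟩, h'.2⟩) ?_ ?_).mono ?_ fun _ => id
    · intro σ' h'
      refine Ends.seq (R := BuildState G B D q k x r (x r) (G.trunc D (x r)).length) (Ends.seq
        (R := fun σ => BuildState G B D q k x r (x r) 0 σ ∧ σ.reg 11 = x r ∧ σ.reg 12 = 0)
        (Ends.blk ?_ le_rfl ?_) ?_) ?_
      · obtain ⟨val, adj, h₁, -⟩ := h'.mem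
        have := hx r
        simp [Safe, Instr.straight, Instr.value, h'.r7, h₁.x r hrB]
        omega
      · obtain ⟨val, adj, h₁, h₂, h₃⟩ := h'.mem
        refine ⟨?_, ?_, ?_⟩
        · have : BuildState G B D q k x r (x r) 0 σ' :=
            ⟨h'.consts, h'.r2, h'.r7, h'.r10, h'.out, val, adj, h₁, by simpa using h₂,
              by simpa using h₃⟩
          exact (this.set (by decide) (by decide) (by decide) (by decide)).set (by decide)
            (by decide) (by decide) (by decide)
        · simp [applyAll, Instr.apply, St.set, h'.r7, h₁.x r hrB]
        · simp [applyAll, Instr.apply, St.set]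
      · rintro σ'' ⟨h₁, h₂, h₃⟩
        exact h₁.scan hF hrB htB h₂ h₃
      · intro σ'' h''
        refine Ends.blk ?_ le_rfl (h''.next rfl ?_ ?_ ?_ ?_ ?_ ?_)
        · simp [Safe, Instr.straight, Instr.value, ArithOp.eval, h''.r7, h''.consts.r5]
          omega
        · exact h''.consts.set (by decide)
        · simpa [applyAll, Instr.apply, St.set] using h''.r2
        · simp [applyAll, Instr.apply, St.set, ArithOp.eval, h''.r7, h''.consts.r5]
        · simp [applyAll, Instr.apply, St.set]
        · rfl
        · rfl
    · intro σ' h'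
      refine h'.build hF hx hrB ?_ ?_
      · have := G.length_trunc_le D (x r)
        rw [G.total_succ]; omega
      · intro r' hr'
        rcases Nat.lt_succ_iff_lt_or_eq.1 hr' with h₁ | rfl
        exacts [hlt r' h₁, htB]
    · have := G.length_trunc_le D (x r)
      rw [G.total_succ]; omega
  · refine (Ends.loopDone (C := 3) ?_).mono (by omega) fun _ => id
    refine hpre.mono le_rfl fun σ' h' => ⟨?_, r, hr, hlt, by omega, htot, ?_⟩
    · by_contra h8
      exact hc (h'.1.1 h8)
    · obtain ⟨val, adj, h₁, h₂, h₃⟩ := h'.2.mem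
      exact ⟨h'.2.consts, h'.2.r2, h'.2.r7, h'.2.r10, h'.2.out, val, adj, h₁, by simpa using h₂,
        by simpa using h₃⟩
termination_by B - r
end

/-! ### The threshold greedy algorithm on the sample -/

section
variable {n m : ℕ} {w : ℕ} {G : CoverageInput n m}

open Classical in
/-- The sample `x` after the sets in `S` have been selected: the covered elements are replaced by
`m`, which is no element and has an empty edge list. So `hits` for this sample counts the uncovered
elements in a set. -/
noncomputable def CoverageInput.resid (G : CoverageInput n m) (D : ℕ) (x : ℕ → ℕ) (S : List ℕ)
    (r : ℕ) : ℕ :=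
  if ∃ s ∈ S, s ∈ G.trunc D (x r) then m else x r

/-- `S` is a sequence of different sets, each of which covers, at its turn, at least `(q - 1) / q`
times as many new elements of the sample `x 0, …, x (R - 1)` as any other set. -/
inductive GreedySeq (G : CoverageInput n m) (D : ℕ) (x : ℕ → ℕ) (R q : ℕ) : List ℕ → Prop
  | nil : GreedySeq G D x R q []
  | snoc {S : List ℕ} {u : ℕ} (h : GreedySeq G D x R q S) (hu : u < n) (hS : u ∉ S)
      (hmax : ∀ v < n, (q - 1) * G.hits D (G.resid D x S) R v ≤
        q * G.hits D (G.resid D x S) R u) : GreedySeq G D x R q (S ++ [u])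

theorem GreedySeq.lt {D : ℕ} {x : ℕ → ℕ} {R q : ℕ} {S : List ℕ} (h : GreedySeq G D x R q S) :
    ∀ v ∈ S, v < n := by
  induction h with
  | nil => simp
  | snoc h hu hS _ ih =>
    intro v hv
    rcases List.mem_append.1 hv with hv | hv
    · exact ih v hv
    · rw [List.mem_singleton.1 hv]; exact hu

theorem GreedySeq.nodup {D : ℕ} {x : ℕ → ℕ} {R q : ℕ} {S : List ℕ} (h : GreedySeq G D x R q S) :
    S.Nodup := by
  induction h with
  | nil => simp
  | snoc h hu hS _ ih =>
    rw [List.nodup_append]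
    refine ⟨ih, by simp, ?_⟩
    rintro a ha b hb rfl
    exact hS (by simpa [List.mem_singleton.1 hb] using ha)

theorem CoverageInput.hits_congr (G : CoverageInput n m) (D : ℕ) {x y : ℕ → ℕ} {R : ℕ}
    (h : ∀ r < R, x r = y r) (v : ℕ) : G.hits D x R v = G.hits D y R v :=
  Finset.sum_congr rfl fun r hr => by rw [h r (Finset.mem_range.1 hr)]

theorem CoverageInput.total_congr (G : CoverageInput n m) (D : ℕ) {x y : ℕ → ℕ} {R : ℕ}
    (h : ∀ r < R, x r = y r) : G.total D x R = G.total D y R :=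
  Finset.sum_congr rfl fun r hr => by rw [h r (Finset.mem_range.1 hr)]

theorem CoverageInput.hits_update (G : CoverageInput n m) (D : ℕ) (x : ℕ → ℕ) {R r : ℕ}
    (hr : r < R) (v : ℕ) :
    G.hits D (Function.update x r m) R v + (G.trunc D (x r)).count v = G.hits D x R v := by
  have hr' := Finset.mem_range.2 hr
  unfold hits
  rw [← Finset.sum_erase_add _ _ hr', ← Finset.sum_erase_add (Finset.range R)
    (fun r => (G.trunc D (x r)).count v) hr', Function.update_self, G.trunc_of_le D le_rfl]
  simp only [List.count_nil, add_zero, add_left_inj]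
  exact Finset.sum_congr rfl fun r' h => by rw [Function.update_of_ne (Finset.ne_of_mem_erase h)]

theorem CoverageInput.total_update (G : CoverageInput n m) (D : ℕ) (x : ℕ → ℕ) {R r : ℕ}
    (hr : r < R) :
    G.total D (Function.update x r m) R + (G.trunc D (x r)).length = G.total D x R := by
  have hr' := Finset.mem_range.2 hr
  unfold total
  rw [← Finset.sum_erase_add _ _ hr', ← Finset.sum_erase_add (Finset.range R)
    (fun r => (G.trunc D (x r)).length) hr', Function.update_self, G.trunc_of_le D le_rfl]
  simp only [List.length_nil, add_zero, add_left_inj]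
  exact Finset.sum_congr rfl fun r' h => by rw [Function.update_of_ne (Finset.ne_of_mem_erase h)]

theorem CoverageInput.hits_resid_of_mem (G : CoverageInput n m) (D : ℕ) (x : ℕ → ℕ) (R : ℕ)
    {S : List ℕ} {v : ℕ} (hv : v ∈ S) : G.hits D (G.resid D x S) R v = 0 := by
  refine Finset.sum_eq_zero fun r _ => List.count_eq_zero.2 fun h => ?_
  unfold resid at h
  split at h
  · simp [G.trunc_of_le D le_rfl] at h
  · rename_i h'
    exact h' ⟨v, hv, h⟩

theorem CoverageInput.hits_resid_append_le (G : CoverageInput n m) (D : ℕ) (x : ℕ → ℕ) (R : ℕ)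
    (S S' : List ℕ) (v : ℕ) :
    G.hits D (G.resid D x (S ++ S')) R v ≤ G.hits D (G.resid D x S) R v := by
  refine Finset.sum_le_sum fun r _ => ?_
  by_cases h : ∃ s ∈ S ++ S', s ∈ G.trunc D (x r)
  · simp [resid, if_pos h, G.trunc_of_le D le_rfl]
  · have h' : ¬ ∃ s ∈ S, s ∈ G.trunc D (x r) := fun ⟨s, hs, hs'⟩ =>
      h ⟨s, List.mem_append_left _ hs, hs'⟩
    simp only [resid, if_neg h, if_neg h', le_refl]

theorem CoverageInput.total_resid_append_le (G : CoverageInput n m) (D : ℕ) (x : ℕ → ℕ) (R : ℕ)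
    (S S' : List ℕ) : G.total D (G.resid D x (S ++ S')) R ≤ G.total D (G.resid D x S) R := by
  refine Finset.sum_le_sum fun r _ => ?_
  by_cases h : ∃ s ∈ S ++ S', s ∈ G.trunc D (x r)
  · simp [resid, if_pos h, G.trunc_of_le D le_rfl]
  · have h' : ¬ ∃ s ∈ S, s ∈ G.trunc D (x r) := fun ⟨s, hs, hs'⟩ =>
      h ⟨s, List.mem_append_left _ hs, hs'⟩
    simp only [resid, if_neg h, if_neg h', le_refl]

theorem CoverageInput.total_le_of_resid (G : CoverageInput n m) (D : ℕ) (x : ℕ → ℕ) (R : ℕ)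
    (S : List ℕ) : G.total D (G.resid D x S) R ≤ G.total D x R := by
  refine Finset.sum_le_sum fun r _ => ?_
  unfold resid
  split
  · simp [G.trunc_of_le D le_rfl]
  · exact le_rfl

/-- Lower the table entry of the set in register `13` by one. -/
def decrement : List Instr :=
  [.arith .add 16 3 13, .load 15 16, .arith .sub 15 15 5, .store 16 15]

/-- Output the set in register `10`, whose table entry is at the address in register `14`. Remove
all elements that it covers from the sample, update the table, and clear its own entry. The entry
`0` marks a selected set: the entries of all other sets are positive. -/
def select : Stmt :=
  .seq (.blk [.write 10, .arith .sub 2 2 5, .arith .add 18 0 10, .arith .add 18 18 6])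
    (.seq (.loop (.blk [.load 17 18]) 17
        (.seq (.seq (.blk [.arith .sub 17 17 5, .load 11 17, .store 17 1, .const 12 0])
          (scan decrement)) (.blk [.arith .add 18 18 0])))
      (.blk [.const 8 0, .store 14 8]))

/-- Registers `2`, `7`, `10` hold the number of sets still to be selected, the threshold, and the
current set. Select the current set if it meets the threshold, that is, if its table entry exceeds
the threshold; go to the next set; after the last set, lower the threshold from `t` to
`(t - 1) - (t - 1) / q` and start again with the first set. -/
def greedy : Stmt :=
  .loop (.blk []) 2
    (.seq (.blk [.arith .add 14 3 10, .load 15 14, .arith .sub 8 15 7])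
      (.seq (.ite 8 (.blk []) select)
        (.seq (.blk [.arith .add 10 10 5, .arith .sub 8 0 10])
          (.ite 8 (.blk [.const 10 0, .arith .sub 7 7 5, .arith .div 8 7 19, .arith .sub 7 7 8])
            (.blk [])))))

/-- The registers that the selection of a set leaves alone, and the output. -/
structure Frame (n m B D q a t u : ℕ) (out : List ℕ) (σ : St) : Prop where
  consts : Consts n m B D q σ
  r2 : σ.reg 2 = a
  r7 : σ.reg 7 = t
  r10 : σ.reg 10 = u
  r14 : σ.reg 14 = B + u
  out : σ.out = out

theorem Frame.set {B D q a t u : ℕ} {out : List ℕ} {σ : St} (h : Frame n m B D q a t u out σ)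
    {d v : ℕ} (hd : d ≠ 0 ∧ d ≠ 1 ∧ d ≠ 3 ∧ d ≠ 4 ∧ d ≠ 5 ∧ d ≠ 6 ∧ d ≠ 19)
    (hd' : d ≠ 2 ∧ d ≠ 7 ∧ d ≠ 10 ∧ d ≠ 14) : Frame n m B D q a t u out (σ.set d v) := by
  obtain ⟨h2, h7, h10, h14⟩ := hd'
  refine ⟨h.consts.set hd, ?_, ?_, ?_, ?_, h.out⟩ <;>
    simp [St.set, *, Ne.symm, h.r2, h.r7, h.r10, h.r14]

theorem Frame.setMem {B D q a t u : ℕ} {out : List ℕ} {σ : St} (h : Frame n m B D q a t u out σ)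
    (mem : ℕ → ℕ) : Frame n m B D q a t u out { σ with mem := mem } :=
  ⟨h.consts.congr rfl, h.r2, h.r7, h.r10, h.r14, h.out⟩

/-- The state while the table is updated for an element `e` that has just been covered: `j` entries
of its list are done. The table entries were `val` before. -/
structure DecState (G : CoverageInput n m) (B D q a t u : ℕ) (out : List ℕ) (e : ℕ)
    (x val : ℕ → ℕ) (adj : ℕ → ℕ → ℕ) (addr : ℕ) (j : ℕ) (σ : St) : Prop where
  frame : Frame n m B D q a t u out σ
  r11 : σ.reg 11 = e
  r12 : σ.reg 12 = j
  r18 : σ.reg 18 = addr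
  mem : ∃ val', MemIs n B σ.mem x val' adj ∧
    ∀ v < n, val' v + ((G.trunc D e).take j).count v = val v

/-- When an element `e` gets covered, the table entries of all sets in its truncated list decrease
by one. -/
theorem DecState.scan {B D q a t u : ℕ} {out : List ℕ} {e : ℕ} {x val : ℕ → ℕ}
    {adj : ℕ → ℕ → ℕ} {addr : ℕ} {σ : St}
    (h : DecState G B D q a t u out e x val adj addr 0 σ) (hF : Fits w n m B D q)
    (hval : ∀ v < n, val v ≤ B + D + 1) (hcount : ∀ v, (G.trunc D e).count v ≤ val v) :
    Ends w G (scan decrement) σ ((G.trunc D e).length * 11 + 5)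
      (DecState G B D q a t u out e x val adj addr (G.trunc D e).length) := by
  have hW := hF.lt_pow
  have hB := hF.le_B
  have hmul : n * D ≤ (B + D + n + 3) * (B + D + n + 3) :=
    Nat.mul_le_mul (by omega) (by omega)
  have hZ : B + D + n + 3 ≤ (B + D + n + 3) * (B + D + n + 3) := Nat.le_mul_self _
  refine Ends.scan (D := D) (e := e) _ (by omega) (by omega) (by omega) ?_ ?_ ?_ h
  · intro j σ h
    exact ⟨h.frame.consts.r0, h.frame.consts.r4, h.frame.consts.r5, h.r11, h.r12⟩
  · intro j σ h a b c d
    refine ⟨(((h.frame.set (by decide) (by decide)).set (by decide) (by decide)).set (by decide)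
      (by decide)).set (by decide) (by decide), ?_, ?_, ?_, h.mem⟩
    · simpa [St.set] using h.r11
    · simpa [St.set] using h.r12
    · simpa [St.set] using h.r18
  · intro j σ hj h h13
    obtain ⟨val', hmem, hval'⟩ := h.mem
    set v := (G.trunc D e)[j] with hv_def
    have hv : v < n := G.lt_of_mem_trunc (List.getElem_mem hj)
    have hm := hmem.val v hv
    have hv1 := hval' v hv
    have hv2 := hval v hv
    have hlen := G.length_trunc_le D e
    have hc1 : ((G.trunc D e).take (j + 1)).count v = ((G.trunc D e).take j).count v + 1 := by
      rw [List.take_add_one, List.getElem?_eq_getElem hj]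
      simp [← hv_def]
    have hc2 : ((G.trunc D e).take (j + 1)).count v ≤ (G.trunc D e).count v :=
      (List.take_sublist _ _).count_le _
    have hc3 := hcount v
    constructor
    · simp [decrement, Safe, Instr.straight, Instr.value, Instr.apply, St.set, ArithOp.eval,
        h.frame.consts.r3, h.frame.consts.r5, h13, hm, h.r12]
      omega
    · refine ⟨?_, ?_, ?_, ?_, Function.update val' v (val' v - 1), ?_, ?_⟩
      · exact ((((h.frame.set (by decide) (by decide)).set (by decide) (by decide)).set (by decide)
          (by decide)).setMem _).set (by decide) (by decide)
      · simpa [applyAll, decrement, Instr.apply, St.set] using h.r11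
      · simp [applyAll, decrement, Instr.apply, St.set, ArithOp.eval, h.r12, h.frame.consts.r5]
      · simpa [applyAll, decrement, Instr.apply, St.set] using h.r18
      · simpa [applyAll, decrement, Instr.apply, St.set, ArithOp.eval, h.frame.consts.r3,
          h.frame.consts.r5, h13, hm] using hmem.setVal hB v (val' v - 1) hv
      · intro v' hv'
        by_cases hvv : v' = v
        · subst hvv; rw [Function.update_self, hc1]; omega
        · rw [Function.update_of_ne hvv, ← hval' v' hv', List.take_add_one,
            List.getElem?_eq_getElem hj]
          simp [← hv_def, Ne.symm hvv]

open Classical in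
/-- The sample `x` after the elements listed in `adj u 1, …, adj u (p - 1)` have been removed. -/
noncomputable def cleared (m : ℕ) (adj : ℕ → ℕ → ℕ) (u p : ℕ) (x : ℕ → ℕ) (r : ℕ) : ℕ :=
  if ∃ p', 1 ≤ p' ∧ p' < p ∧ adj u p' = r + 1 then m else x r

theorem cleared_one (m : ℕ) (adj : ℕ → ℕ → ℕ) (u : ℕ) (x : ℕ → ℕ) : cleared m adj u 1 x = x := by
  ext r
  rw [cleared, if_neg]
  rintro ⟨p', h₁, h₂, -⟩
  omega

theorem cleared_succ {adj : ℕ → ℕ → ℕ} {u p r : ℕ} (x : ℕ → ℕ) (hp : 1 ≤ p)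
    (h : adj u p = r + 1) :
    cleared m adj u (p + 1) x = Function.update (cleared m adj u p x) r m := by
  ext r'
  by_cases hr : r' = r
  · subst hr
    rw [Function.update_self, cleared, if_pos ⟨p, hp, by omega, h⟩]
  · have hiff : (∃ p', 1 ≤ p' ∧ p' < p + 1 ∧ adj u p' = r' + 1) ↔
        ∃ p', 1 ≤ p' ∧ p' < p ∧ adj u p' = r' + 1 := by
      constructor
      · rintro ⟨p', h₁, h₂, h₃⟩
        rcases Nat.lt_succ_iff_lt_or_eq.1 h₂ with h₂ | rfl
        · exact ⟨p', h₁, h₂, h₃⟩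
        · exact absurd (by omega) hr
      · rintro ⟨p', h₁, h₂, h₃⟩
        exact ⟨p', h₁, by omega, h₃⟩
    rw [Function.update_of_ne hr]
    by_cases hc : ∃ p', 1 ≤ p' ∧ p' < p ∧ adj u p' = r' + 1
    · rw [cleared, cleared, if_pos hc, if_pos (hiff.2 hc)]
    · rw [cleared, cleared, if_neg hc, if_neg fun h' => hc (hiff.1 h')]

theorem cleared_le {adj : ℕ → ℕ → ℕ} {u : ℕ} {x : ℕ → ℕ} (hx : ∀ r, x r ≤ m) (p r : ℕ) :
    cleared m adj u p x r ≤ m := by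
  unfold cleared; split
  exacts [le_rfl, hx r]

theorem CoverageInput.total_cleared_anti (G : CoverageInput n m) (D : ℕ) (adj : ℕ → ℕ → ℕ) (u : ℕ)
    (x : ℕ → ℕ) (R : ℕ) {p l : ℕ} (h : p ≤ l) :
    G.total D (cleared m adj u l x) R ≤ G.total D (cleared m adj u p x) R := by
  refine Finset.sum_le_sum fun r _ => ?_
  by_cases hl : ∃ p', 1 ≤ p' ∧ p' < l ∧ adj u p' = r + 1
  · rw [cleared, if_pos hl, G.trunc_of_le D le_rfl]; simp
  · have hp : ¬ ∃ p', 1 ≤ p' ∧ p' < p ∧ adj u p' = r + 1 := fun ⟨p', h₁, h₂, h₃⟩ =>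
      hl ⟨p', h₁, by omega, h₃⟩
    rw [cleared, cleared, if_neg hl, if_neg hp]

/-- The state while the elements covered by the set `u` are removed from the sample: the entries of
its list at positions below `p` are done. The sample was `x` before, and `s v` is the difference
between the table entry of `v` and the number of remaining elements that `v` covers. -/
structure SelState (G : CoverageInput n m) (B D q a t u : ℕ) (out : List ℕ) (R : ℕ)
    (x s : ℕ → ℕ) (adj : ℕ → ℕ → ℕ) (p : ℕ) (σ : St) : Prop where
  frame : Frame n m B D q a t u out σ
  r18 : σ.reg 18 = 2 * B + p * n + u
  mem : ∃ val, MemIs n B σ.mem (cleared m adj u p x) val adj ∧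
    ∀ v < n, val v = s v + G.hits D (cleared m adj u p x) R v

/-- Removal of one sample element `r` that the set `u` covers. If this element is already covered,
then it has been replaced by `m`, and there is nothing to scan. -/
theorem SelState.body {B D q a t u : ℕ} {out : List ℕ} {R : ℕ} {x s : ℕ → ℕ}
    {adj : ℕ → ℕ → ℕ} {p : ℕ} {σ : St} {r : ℕ}
    (h : SelState G B D q a t u out R x s adj p σ) (hF : Fits w n m B D q) (hu : u < n)
    (hr : r < R) (hRB : R ≤ B) (hx : ∀ r, x r ≤ m) (hs : ∀ v, s v ≤ 1)
    (htot : G.total D x R ≤ B + D) (hp : 1 ≤ p) (hpB : p ≤ B + D) (hadj : adj u p = r + 1)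
    (h17 : σ.reg 17 = r + 1) :
    Ends w G (.seq (.seq (.blk [.arith .sub 17 17 5, .load 11 17, .store 17 1, .const 12 0])
          (scan decrement)) (.blk [.arith .add 18 18 0]))
      σ ((G.trunc D (cleared m adj u p x r)).length * 11 + 10)
      (SelState G B D q a t u out R x s adj (p + 1)) := by
  obtain ⟨val, hmem, hval⟩ := h.mem
  have hW := hF.lt_pow
  have hB := hF.le_B
  have hmul : (p + 1) * n ≤ (B + D + n + 3) * (B + D + n + 3) :=
    Nat.mul_le_mul (by omega) (by omega)
  have hZ : B + D + n + 3 ≤ (B + D + n + 3) * (B + D + n + 3) := Nat.le_mul_self _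
  set y := cleared m adj u p x with hy
  have hyr := hmem.x r (by omega)
  have hym : y r ≤ m := cleared_le hx p r
  have htot' : G.total D y R ≤ G.total D x R := by
    have := G.total_cleared_anti D adj u x R hp
    rwa [cleared_one] at this
  have hy' : cleared m adj u (p + 1) x = Function.update y r m := cleared_succ x hp hadj
  have h18' : 2 * B + p * n + u + n = 2 * B + (p + 1) * n + u := by ring
  refine (Ends.seq (C₁ := 4 + ((G.trunc D (y r)).length * 11 + 5)) (C₂ := 1)
    (R := DecState G B D q a t u out (y r) (Function.update y r m) val adj
      (2 * B + p * n + u) (G.trunc D (y r)).length) (Ends.seq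
    (R := DecState G B D q a t u out (y r) (Function.update y r m) val adj
      (2 * B + p * n + u) 0) (Ends.blk ?_ le_rfl ?_) ?_) ?_).mono (by omega) fun _ => id
  · simp [Safe, Instr.straight, Instr.value, Instr.apply, St.set, ArithOp.eval, h17,
      h.frame.consts.r5, hyr]
    omega
  · refine ⟨?_, ?_, ?_, ?_, val, ?_, ?_⟩
    · exact (((h.frame.set (by decide) (by decide)).set (by decide) (by decide)).setMem _).set
        (by decide) (by decide)
    · simp [applyAll, Instr.apply, St.set, ArithOp.eval, h17, h.frame.consts.r5, hyr]
    · simp [applyAll, Instr.apply, St.set]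
    · simpa [applyAll, Instr.apply, St.set] using h.r18
    · simpa [applyAll, Instr.apply, St.set, ArithOp.eval, h17, h.frame.consts.r5,
        h.frame.consts.r1] using hmem.setX r m (by omega)
    · simp
  · intro σ' h'
    refine h'.scan hF (fun v hv => ?_) fun v => ?_
    · have h₁ := G.hits_le_total D y R v
      have h₂ := hs v
      rw [hval v hv]; omega
    · by_cases hv : v < n
      · rw [hval v hv, ← G.hits_update D y hr v]; omega
      · rw [List.count_eq_zero.2 fun hv' => hv (G.lt_of_mem_trunc hv')]; omega
  · intro σ' h'
    refine Ends.blk ?_ le_rfl ⟨h'.frame.set (by decide) (by decide), ?_, ?_⟩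
    · simp [Safe, Instr.straight, Instr.value, ArithOp.eval, h'.r18, h'.frame.consts.r0]
      omega
    · simp [applyAll, Instr.apply, St.set, ArithOp.eval, h'.r18, h'.frame.consts.r0, h18']
    · obtain ⟨val', hmem', hval'⟩ := h'.mem
      refine ⟨val', ?_, fun v hv => ?_⟩
      · rw [hy']; exact hmem'
      · have h₁ := hval' v hv
        have h₂ := hval v hv
        have h₃ := G.hits_update D y hr v
        rw [List.take_length] at h₁
        rw [hy']; omega

/-- Removal of all sample elements that the set `u` covers: 13 steps for each entry of its list, and
11 steps for each edge that disappears from the sample. -/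
theorem SelState.loop {B D q a t u : ℕ} {out : List ℕ} {R : ℕ} {x s : ℕ → ℕ}
    {adj : ℕ → ℕ → ℕ} {l : ℕ} (hF : Fits w n m B D q) (hu : u < n)
    (hRB : R ≤ B) (hx : ∀ r, x r ≤ m) (hs : ∀ v, s v ≤ 1) (htot : G.total D x R ≤ B + D)
    (hl : l ≤ B + D + 1)
    (hadj : ∀ p, 1 ≤ p → p < l → ∃ r, adj u p = r + 1 ∧ r < R) (hadj' : adj u l = 0)
    {p : ℕ} (hp : 1 ≤ p) (hpl : p ≤ l) {σ : St}
    (h : SelState G B D q a t u out R x s adj p σ) :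
    Ends w G (.loop (.blk [.load 17 18]) 17
        (.seq (.seq (.blk [.arith .sub 17 17 5, .load 11 17, .store 17 1, .const 12 0])
          (KCover.scan decrement)) (.blk [.arith .add 18 18 0])))
      σ ((l - p) * 13 + (G.total D (cleared m adj u p x) R -
        G.total D (cleared m adj u l x) R) * 11 + 2)
      (SelState G B D q a t u out R x s adj l) := by
  have hW := hF.lt_pow
  have hB := hF.le_B
  have hZ : B + D + n + 3 ≤ (B + D + n + 3) * (B + D + n + 3) := Nat.le_mul_self _
  have hadjB : adj u p < 2 ^ w := by
    rcases hpl.lt_or_eq with hlt | rfl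
    · obtain ⟨r, h₁, h₂⟩ := hadj p hp hlt
      omega
    · omega
  have hpre : Ends w G (.blk [.load 17 18]) σ 1 fun σ' => σ'.reg 17 = adj u p ∧
      SelState G B D q a t u out R x s adj p σ' := by
    obtain ⟨val, hmem, hval⟩ := h.mem
    refine Ends.blk ?_ le_rfl ⟨?_, h.frame.set (by decide) (by decide), ?_, val, hmem, hval⟩
    · simpa [Safe, Instr.straight, Instr.value, h.r18, hmem.adj u hu p] using hadjB
    · simp [applyAll, Instr.apply, St.set, h.r18, hmem.adj u hu p]
    · simpa [applyAll, Instr.apply, St.set] using h.r18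
  rcases hpl.lt_or_eq with hlt | rfl
  · obtain ⟨r, h₁, h₂⟩ := hadj p hp hlt
    refine (Ends.loopStep (C₁ := 1)
      (C₂ := (G.trunc D (cleared m adj u p x r)).length * 11 + 10)
      (C₃ := (l - (p + 1)) * 13 + (G.total D (cleared m adj u (p + 1) x) R -
        G.total D (cleared m adj u l x) R) * 11 + 2)
      (S := SelState G B D q a t u out R x s adj (p + 1))
      (hpre.mono le_rfl fun σ' h' => ⟨by omega, h'⟩) ?_ ?_).mono ?_ fun _ => id
    · rintro σ' ⟨h17, h'⟩
      exact h'.body hF hu h₂ hRB hx hs htot hp (by omega) h₁ (by omega)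
    · intro σ' h'
      exact SelState.loop hF hu hRB hx hs htot hl hadj hadj' (by omega) hlt h'
    · have h₃ := G.total_update D (cleared m adj u p x) h₂
      rw [← cleared_succ x hp h₁] at h₃
      have h₄ := G.total_cleared_anti D adj u x R (show p + 1 ≤ l from hlt)
      omega
  · refine (Ends.loopDone (C := 1) ?_).mono (by omega) fun _ => id
    exact hpre.mono le_rfl fun σ' h' => ⟨by omega, h'.2⟩
termination_by l - p
end

/-! ### Passes of the threshold rule -/

section
variable {n m : ℕ} {w : ℕ} {G : CoverageInput n m}

/-- The number of passes over all sets that the threshold rule makes when it starts with the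
threshold `t`. -/
def passes (q : ℕ) : ℕ → ℕ
  | 0 => 0
  | t + 1 => 1 + passes q (t - t / q)
termination_by t => t
decreasing_by exact Nat.lt_succ_of_le (Nat.sub_le _ _)

theorem passes_of_pos (q : ℕ) {t : ℕ} (ht : 0 < t) :
    passes q t = 1 + passes q (t - 1 - (t - 1) / q) := by
  obtain ⟨t, rfl⟩ : ∃ t', t = t' + 1 := ⟨t - 1, by omega⟩
  rw [passes, Nat.add_sub_cancel]

/-- The state of the greedy loop: the sets in `S` are selected, the threshold is `t`, the current
set is `u`, and the sets below `b` do not meet the threshold. Here `x₀` is the original sample,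
which the lists `adj` refer to throughout, and the memory holds the residual sample. -/
structure GreedyState (G : CoverageInput n m) (B D q k : ℕ) (x₀ : ℕ → ℕ) (R : ℕ) (S : List ℕ)
    (t u b : ℕ) (σ : St) : Prop where
  consts : Consts n m B D q σ
  r2 : σ.reg 2 = k - S.length
  r7 : σ.reg 7 = t
  r10 : σ.reg 10 = u
  out : σ.out = S
  length_le : S.length ≤ k
  t_le : t ≤ B
  seq : GreedySeq G D x₀ R q S
  mem : ∃ x val adj, MemIs n B σ.mem x val adj ∧ (∀ r, x r ≤ m) ∧
    (∀ r < R, x r = G.resid D x₀ S r) ∧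
    AdjIs n (fun v => 1 + G.hits D x₀ R v) adj (fun v r => r < R ∧ v ∈ G.trunc D (x₀ r)) ∧
    ∀ v < n, val v = if v ∈ S then 0 else 1 + G.hits D (G.resid D x₀ S) R v
  /-- the sets below `b` that have not been selected cover less than `t` uncovered elements -/
  done : ∀ v < n, v < b → v ∉ S → 1 + G.hits D (G.resid D x₀ S) R v ≤ t
  /-- a set that meets the threshold is nearly the best one -/
  max : ∃ M, (∀ v < n, G.hits D (G.resid D x₀ S) R v ≤ M) ∧ (q - 1) * M ≤ q * t

theorem CoverageInput.resid_append_singleton (G : CoverageInput n m) (D : ℕ) (x : ℕ → ℕ)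
    (S : List ℕ) (u r : ℕ) :
    (u ∈ G.trunc D (x r) → G.resid D x (S ++ [u]) r = m) ∧
      (u ∉ G.trunc D (x r) → G.resid D x (S ++ [u]) r = G.resid D x S r) := by
  constructor
  · intro h
    rw [resid, if_pos ⟨u, by simp, h⟩]
  · intro h
    by_cases hS : ∃ s ∈ S, s ∈ G.trunc D (x r)
    · obtain ⟨s, hs, hs'⟩ := hS
      rw [resid, if_pos ⟨s, List.mem_append_left _ hs, hs'⟩, resid, if_pos ⟨s, hs, hs'⟩]
    · rw [resid, resid, if_neg hS, if_neg]
      rintro ⟨s, hs, hs'⟩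
      rcases List.mem_append.1 hs with hs | hs
      · exact hS ⟨s, hs, hs'⟩
      · exact h (by rwa [List.mem_singleton.1 hs] at hs')

/-- The current set is selected if it meets the threshold. -/
theorem GreedyState.select {B D q k : ℕ} {x₀ : ℕ → ℕ} {R : ℕ} {S : List ℕ} {t u : ℕ} {σ : St}
    (h : GreedyState G B D q k x₀ R S t u u σ) (hF : Fits w n m B D q) (hRB : R ≤ B)
    (htot : G.total D x₀ R ≤ B + D) (hu : u < n) (hS : u ∉ S) (hk : S.length < k) (hkn : k ≤ n)
    (hut : t ≤ G.hits D (G.resid D x₀ S) R u) (h14 : σ.reg 14 = B + u) :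
    Ends w G KCover.select σ (G.hits D x₀ R u * 13 + (G.total D (G.resid D x₀ S) R -
        G.total D (G.resid D x₀ (S ++ [u])) R) * 11 + 8)
      (GreedyState G B D q k x₀ R (S ++ [u]) t u (u + 1)) := by
  obtain ⟨x, val, adj, hmem, hx, hres, hadj, hval⟩ := h.mem
  have hW := hF.lt_pow
  have hB := hF.le_B
  have hZ : B + D + n + 3 ≤ (B + D + n + 3) * (B + D + n + 3) := Nat.le_mul_self _
  have hhit := (G.hits_le_total D x₀ R u).trans htot
  set l := 1 + G.hits D x₀ R u with hl
  classical
  set s : ℕ → ℕ := fun v => if v ∈ S then 0 else 1 with hs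
  have hxR : G.total D x R = G.total D (G.resid D x₀ S) R := G.total_congr D hres
  have hxh : ∀ v, G.hits D x R v = G.hits D (G.resid D x₀ S) R v := G.hits_congr D hres
  have hxtot : G.total D x R ≤ B + D := by
    rw [hxR]; exact (G.total_le_of_resid D x₀ R S).trans htot
  have hval' : ∀ v < n, val v = s v + G.hits D x R v := by
    intro v hv
    rw [hval v hv, hxh, hs]
    by_cases hvS : v ∈ S
    · simp [hvS, G.hits_resid_of_mem D x₀ R hvS]
    · simp [hvS]
  have hres' : ∀ r < R, cleared m adj u l x r = G.resid D x₀ (S ++ [u]) r := by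
    intro r hr
    obtain ⟨h₁, h₂⟩ := G.resid_append_singleton D x₀ S u r
    by_cases hur : u ∈ G.trunc D (x₀ r)
    · rw [h₁ hur, cleared, if_pos (hadj.complete u hu r ⟨hr, hur⟩)]
    · rw [h₂ hur, cleared, if_neg, hres r hr]
      rintro ⟨p, hp, hpl, hpr⟩
      obtain ⟨r', h₃, -, h₄⟩ := hadj.sound u hu p hp hpl
      have : r' = r := by omega
      exact hur (this ▸ h₄)
  have hcR := G.total_congr D hres'
  have hch := G.hits_congr D hres'
  have hsub : k - (S ++ [u]).length = k - S.length - 1 := by simp; omega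
  refine (Ends.seq (C₁ := 4) (C₂ := ((l - 1) * 13 + (G.total D (cleared m adj u 1 x) R -
        G.total D (cleared m adj u l x) R) * 11 + 2) + 2)
      (R := SelState G B D q (k - S.length - 1) t u (S ++ [u]) R x s adj 1)
      (Ends.blk ?_ le_rfl ?_) fun σ₁ h₁ => Ends.seq (SelState.loop (l := l) hF hu hRB hx
        (fun v => ?_) hxtot (by omega) ?_ (hadj.zero u hu _ le_rfl) le_rfl (by omega) h₁)
      fun σ₂ h₂ => Ends.blk ?_ le_rfl ?_).mono ?_ fun _ => id
  · simp [Safe, Instr.straight, Instr.value, Instr.apply, St.set, ArithOp.eval, h.r2, h.r10,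
      h.consts.r0, h.consts.r5, h.consts.r6]
    omega
  · refine ⟨⟨?_, ?_, ?_, ?_, ?_, ?_⟩, ?_, val, ?_, ?_⟩
    · have h' : Consts n m B D q { σ with out := σ.out ++ [σ.reg 10] } := h.consts.congr rfl
      exact ((h'.set (d := 2) (by decide)).set (by decide)).set (by decide)
    · simp [applyAll, Instr.apply, St.set, ArithOp.eval, h.r2, h.consts.r5]
    · simpa [applyAll, Instr.apply, St.set] using h.r7
    · simpa [applyAll, Instr.apply, St.set] using h.r10
    · simpa [applyAll, Instr.apply, St.set] using h14
    · simp [applyAll, Instr.apply, St.set, h.out, h.r10]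
    · simp [applyAll, Instr.apply, St.set, ArithOp.eval, h.r10, h.consts.r0, h.consts.r6]
      omega
    · rw [cleared_one]; exact hmem
    · rw [cleared_one]; exact hval'
  · rw [hs]; dsimp only; split <;> omega
  · intro p hp hpl
    obtain ⟨r, h₃, h₄, -⟩ := hadj.sound u hu p hp hpl
    exact ⟨r, h₃, h₄⟩
  · simp [Safe, Instr.straight, Instr.value]
  · obtain ⟨val₂, hmem₂, hval₂⟩ := h₂.mem
    refine ⟨?_, ?_, ?_, ?_, ?_, ?_, h.t_le, ?_, ?_, ?_, ?_⟩
    · exact (h₂.frame.consts.set (d := 8) (v := 0) (by decide)).congr rfl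
    · rw [hsub, ← h₂.frame.r2]; simp [applyAll, Instr.apply, St.set]
    · simpa [applyAll, Instr.apply, St.set] using h₂.frame.r7
    · simpa [applyAll, Instr.apply, St.set] using h₂.frame.r10
    · simpa [applyAll, Instr.apply, St.set] using h₂.frame.out
    · simp; omega
    · refine h.seq.snoc hu hS fun v hv => ?_
      obtain ⟨M, hM, hM'⟩ := h.max
      exact (Nat.mul_le_mul_left _ (hM v hv)).trans (hM'.trans (Nat.mul_le_mul_left _ hut))
    · refine ⟨cleared m adj u l x, Function.update val₂ u 0, adj, ?_, cleared_le hx l, hres', hadj,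
        fun v hv => ?_⟩
      · simpa [applyAll, Instr.apply, St.set, h₂.frame.r14] using hmem₂.setVal hB u 0 hu
      · by_cases hvu : v = u
        · simp [hvu]
        · rw [Function.update_of_ne hvu, hval₂ v hv, hch, hs]
          by_cases hvS : v ∈ S
          · simp [hvS, G.hits_resid_of_mem D x₀ R
              (show v ∈ S ++ [u] from List.mem_append_left _ hvS)]
          · simp [hvS, hvu]
    · intro v hv hvb hvS
      have hvS' : v ∉ S ∧ v ≠ u := by simpa using hvS
      have h₃ := h.done v hv (by omega) hvS'.1
      have h₄ := G.hits_resid_append_le D x₀ R S [u] v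
      omega
    · obtain ⟨M, hM, hM'⟩ := h.max
      exact ⟨M, fun v hv => (G.hits_resid_append_le D x₀ R S [u] v).trans (hM v hv), hM'⟩
  · rw [hcR, cleared_one, hxR]; omega

/-- After the current set has been dealt with, the measure `passes q t * n + (n - u)` of the
remaining tests decreases: either the pass goes on with the next set, or a new pass with a lower
threshold starts. -/
theorem GreedyState.advance {B D q k : ℕ} {x₀ : ℕ → ℕ} {R : ℕ} {S : List ℕ} {t u : ℕ} {σ : St}
    (h : GreedyState G B D q k x₀ R S t u (u + 1) σ) (hF : Fits w n m B D q) (hu : u < n)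
    (hq : 1 ≤ q) (hkn : k ≤ n) :
    Ends w G (.seq (.blk [.arith .add 10 10 5, .arith .sub 8 0 10])
          (.ite 8 (.blk [.const 10 0, .arith .sub 7 7 5, .arith .div 8 7 19, .arith .sub 7 7 8])
            (.blk []))) σ 7 fun σ' => σ'.reg 2 = k - S.length ∧ σ'.out = S ∧
      (S.length < k → ∃ t' u', u' < n ∧ passes q t' * n + (n - u') < passes q t * n + (n - u) ∧
        GreedyState G B D q k x₀ R S t' u' u' σ') := by
  have hW := hF.lt_pow
  have hZ : B + D + n + 3 ≤ (B + D + n + 3) * (B + D + n + 3) := Nat.le_mul_self _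
  have hB := hF.le_B
  have ht := h.t_le
  refine Ends.seq (C₁ := 2) (C₂ := 5) (R := fun σ' => σ'.reg 8 = n - (u + 1) ∧
    GreedyState G B D q k x₀ R S t (u + 1) (u + 1) σ') (Ends.blk ?_ le_rfl ⟨?_, ?_⟩) ?_
  · simp [Safe, Instr.straight, Instr.value, Instr.apply, St.set, ArithOp.eval, h.r10,
      h.consts.r0, h.consts.r5]
    omega
  · simp [applyAll, Instr.apply, St.set, ArithOp.eval, h.r10, h.consts.r0, h.consts.r5]
  · refine ⟨?_, ?_, ?_, ?_, h.out, h.length_le, h.t_le, h.seq, h.mem, h.done, h.max⟩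
    · exact (h.consts.set (by decide)).set (by decide)
    · simpa [applyAll, Instr.apply, St.set] using h.r2
    · simpa [applyAll, Instr.apply, St.set] using h.r7
    · simp [applyAll, Instr.apply, St.set, ArithOp.eval, h.r10, h.consts.r5]
  · rintro σ' ⟨h8, h'⟩
    by_cases hun : u + 1 = n
    · refine Ends.iteZero (C := 4) (by omega) (Ends.blk ?_ le_rfl ⟨?_, ?_, ?_⟩)
      · have h₁ : (t - 1) / q ≤ t := (Nat.div_le_self _ _).trans (by omega)
        simp [Safe, Instr.straight, Instr.value, Instr.apply, St.set, ArithOp.eval, h'.r7,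
          h'.consts.r5, h'.consts.r19]
        generalize (t - 1) / q = y at h₁ ⊢
        omega
      · simpa [applyAll, Instr.apply, St.set] using h'.r2
      · simpa [applyAll, Instr.apply, St.set] using h'.out
      · intro hk
        -- with the threshold `0` every set has been selected at the end of the pass
        have htpos : 0 < t := by
          by_contra ht0
          have hall : ∀ v < n, v ∈ S := by
            intro v hv
            by_contra hvS
            have := h.done v hv (by omega) hvS
            omega
          have : (Finset.range n).card ≤ S.toFinset.card :=
            Finset.card_le_card fun v hv => by simpa using hall v (Finset.mem_range.1 hv)
          rw [Finset.card_range] at this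
          have := S.toFinset_card_le
          omega
        have hle : t - 1 - (t - 1) / q ≤ t - 1 := Nat.sub_le _ _
        refine ⟨t - 1 - (t - 1) / q, 0, by omega, ?_, ?_, ?_, ?_, ?_, h'.out, h'.length_le,
          hle.trans (by omega), h'.seq, h'.mem, fun v _ hv => absurd hv (by omega), t - 1, ?_, ?_⟩
        · rw [passes_of_pos q htpos, add_mul]; omega
        · exact (((h'.consts.set (by decide)).set (by decide)).set (by decide)).set (by decide)
        · simpa [applyAll, Instr.apply, St.set] using h'.r2
        · simp [applyAll, Instr.apply, St.set, ArithOp.eval, h'.r7, h'.consts.r5, h'.consts.r19]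
        · simp [applyAll, Instr.apply, St.set]
        · intro v hv
          by_cases hvS : v ∈ S
          · rw [G.hits_resid_of_mem D x₀ R hvS]; omega
          · have := h.done v hv (by omega) hvS
            omega
        · have h₁ : q * ((t - 1) / q) ≤ t - 1 := Nat.mul_div_le _ _
          rw [Nat.sub_mul, Nat.mul_sub q (t - 1) ((t - 1) / q), one_mul]
          exact Nat.sub_le_sub_left h₁ _
    · refine Ends.iteNonzero (C := 3) (by omega) ((Ends.skip ⟨h'.r2, h'.out, ?_⟩).mono
        (by omega) fun _ => id)
      intro hk
      exact ⟨t, u + 1, by omega, by omega, h'⟩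

open Classical in
/-- The total length of the lists of the sets that are not in `S`. It pays for the walks through the
lists of the sets that will be selected. -/
noncomputable def CoverageInput.pending (G : CoverageInput n m) (D : ℕ) (x : ℕ → ℕ) (R : ℕ)
    (S : List ℕ) : ℕ :=
  ∑ v ∈ (Finset.range n).filter (· ∉ S), G.hits D x R v

theorem CoverageInput.pending_append (G : CoverageInput n m) (D : ℕ) (x : ℕ → ℕ) (R : ℕ)
    {S : List ℕ} {u : ℕ} (hu : u < n) (hS : u ∉ S) :
    G.pending D x R (S ++ [u]) + G.hits D x R u = G.pending D x R S := by
  classical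
  unfold pending
  rw [← Finset.sum_erase_add (a := u) ((Finset.range n).filter (· ∉ S)) _ (by simp [hu, hS])]
  congr 1
  refine Finset.sum_congr ?_ fun _ _ => rfl
  ext v
  simp
  tauto

theorem CoverageInput.pending_nil (G : CoverageInput n m) (D : ℕ) (x : ℕ → ℕ) (R : ℕ) :
    G.pending D x R [] = G.total D x R := by
  classical
  simp only [pending, hits, total, List.not_mem_nil, not_false_eq_true, Finset.filter_true]
  rw [Finset.sum_comm]
  refine Finset.sum_congr rfl fun r _ => ?_
  have := Multiset.sum_count_eq_card (s := Finset.range n) (m := (G.trunc D (x r) : Multiset ℕ))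
    fun a ha => Finset.mem_range.2 (G.lt_of_mem_trunc (by simpa using ha))
  simpa using this

/-- The greedy loop ends with `k` selected sets. Each test of a set costs at most 22 steps; the
other costs are charged to the edges: each edge of the sample is deleted at most once, and each list
is walked through at most once. -/
theorem GreedyState.greedy {B D q k : ℕ} {x₀ : ℕ → ℕ} {R : ℕ} {S : List ℕ} {t u : ℕ} {σ : St}
    (h : GreedyState G B D q k x₀ R S t u u σ) (hF : Fits w n m B D q) (hRB : R ≤ B)
    (htot : G.total D x₀ R ≤ B + D) (hu : u < n) (hk : S.length < k) (hkn : k ≤ n) (hq : 1 ≤ q) :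
    Ends w G greedy σ ((passes q t * n + (n - u)) * 22 + G.total D (G.resid D x₀ S) R * 11 +
      G.pending D x₀ R S * 13 + 1) fun σ' => GreedySeq G D x₀ R q σ'.out ∧ σ'.out.length = k := by
  have hW := hF.lt_pow
  have hZ : B + D + n + 3 ≤ (B + D + n + 3) * (B + D + n + 3) := Nat.le_mul_self _
  have hB := hF.le_B
  -- what remains after the selection step, with `S'` the new list of selected sets
  have key : ∀ S', S'.length ≤ k → GreedySeq G D x₀ R q S' → ∀ σ',
      (σ'.reg 2 = k - S'.length ∧ σ'.out = S' ∧
        (S'.length < k → ∃ t' u', u' < n ∧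
          passes q t' * n + (n - u') < passes q t * n + (n - u) ∧
          GreedyState G B D q k x₀ R S' t' u' u' σ')) →
      Ends w G KCover.greedy σ' ((passes q t * n + (n - u) - 1) * 22 +
        G.total D (G.resid D x₀ S') R * 11 + G.pending D x₀ R S' * 13 + 1)
        fun σ' => GreedySeq G D x₀ R q σ'.out ∧ σ'.out.length = k := by
    rintro S' hS' hseq σ' ⟨h2, hout, hnext⟩
    rcases hS'.lt_or_eq with hlt | heq
    · obtain ⟨t', u', hu', hlt', h'⟩ := hnext hlt
      have := h'.greedy hF hRB htot hu' hlt hkn hq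
      exact this.mono (by omega) fun _ => id
    · refine (Ends.loopDone (C := 0) (Ends.skip ⟨?_, ?_, ?_⟩)).mono (by omega)
        fun _ => id
      · simp [h2, heq]
      · simpa [applyAll, hout] using hseq
      · simpa [applyAll, hout] using heq
  obtain ⟨x, val, adj, hmem, hx, hres, hadj, hval⟩ := h.mem
  have hvalu := hmem.val u hu
  have hvalB : val u ≤ B + D + 1 := by
    have h₁ := G.hits_le_total D (G.resid D x₀ S) R u
    have h₂ := G.total_le_of_resid D x₀ R S
    rw [hval u hu]
    split <;> omega
  have htest : Ends w G (.blk [.arith .add 14 3 10, .load 15 14, .arith .sub 8 15 7]) σ 3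
      fun σ' => σ'.reg 8 = val u - t ∧ σ'.reg 14 = B + u ∧
        GreedyState G B D q k x₀ R S t u u σ' := by
    refine Ends.blk ?_ le_rfl ⟨?_, ?_, ?_⟩
    · simp [Safe, Instr.straight, Instr.value, Instr.apply, St.set, ArithOp.eval, h.r10,
        h.consts.r3, h.r7, hvalu]
      omega
    · simp [applyAll, Instr.apply, St.set, ArithOp.eval, h.r10, h.consts.r3, h.r7, hvalu]
    · simp [applyAll, Instr.apply, St.set, ArithOp.eval, h.r10, h.consts.r3]
    · refine ⟨?_, ?_, ?_, ?_, h.out, h.length_le, h.t_le, h.seq, h.mem, h.done, h.max⟩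
      · exact ((h.consts.set (by decide)).set (by decide)).set (by decide)
      · simpa [applyAll, Instr.apply, St.set] using h.r2
      · simpa [applyAll, Instr.apply, St.set] using h.r7
      · simpa [applyAll, Instr.apply, St.set] using h.r10
  by_cases hsel : t < val u
  · have hS : u ∉ S := by
      intro hS
      rw [hval u hu, if_pos hS] at hsel
      omega
    have hut : t ≤ G.hits D (G.resid D x₀ S) R u := by
      rw [hval u hu, if_neg hS] at hsel
      omega
    have hlen : (S ++ [u]).length ≤ k := by simp; omega
    have hseq : GreedySeq G D x₀ R q (S ++ [u]) := by
      refine h.seq.snoc hu hS fun v hv => ?_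
      obtain ⟨M, hM, hM'⟩ := h.max
      exact (Nat.mul_le_mul_left _ (hM v hv)).trans (hM'.trans (Nat.mul_le_mul_left _ hut))
    refine (Ends.loopStep (C₁ := 0) (C₂ := 3 + ((G.hits D x₀ R u * 13 +
      (G.total D (G.resid D x₀ S) R - G.total D (G.resid D x₀ (S ++ [u])) R) * 11 + 8 + 2) + 7))
      (R := fun σ' => σ' = σ)
      (Ends.skip ⟨?_, rfl⟩) ?_ (key (S ++ [u]) hlen hseq)).mono ?_ fun _ => id
    · simp only [h.r2]; omega
    · rintro _ rfl
      exact Ends.seq htest fun σ'' h'' => Ends.seq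
        (Ends.iteNonzero (by omega) (h''.2.2.select hF hRB htot hu hS hk hkn hut h''.2.1))
        fun σ₃ h₃ => h₃.advance hF hu hq hkn
    · have h₁ := G.pending_append D x₀ R hu hS
      have h₂ := G.total_resid_append_le D x₀ R S [u]
      have h₃ : 1 ≤ passes q t * n + (n - u) := by omega
      omega
  · refine (Ends.loopStep (C₁ := 0) (C₂ := 3 + ((0 + 1) + 7)) (R := fun σ' => σ' = σ)
      (Ends.skip ⟨?_, rfl⟩) ?_ (key S hk.le h.seq)).mono ?_ fun _ => id
    · simp only [h.r2]; omega
    · rintro _ rfl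
      refine Ends.seq htest fun σ'' h'' => Ends.seq (R := GreedyState G B D q k x₀ R S t u (u + 1))
        (Ends.iteZero (by omega) (Ends.skip ?_))
        fun σ₃ h₃ => h₃.advance hF hu hq hkn
      refine { h''.2.2 with done := fun v hv hvb hvS => ?_ }
      rcases Nat.lt_succ_iff_lt_or_eq.1 hvb with hlt | rfl
      · exact h.done v hv hlt hvS
      · rw [hval v hv, if_neg hvS] at hsel
        omega
    · have h₃ : 1 ≤ passes q t * n + (n - u) := by omega
      omega
termination_by passes q t * n + (n - u)
end

/-! ### The whole machine -/

/-- The number of samples. -/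
def sampleCount (K n : ℕ) : ℕ := K * n * (Nat.log 2 n + 1)

/-- The truncation bound for the edge lists of the elements. -/
def truncBound (L n k : ℕ) : ℕ := n * L / k + 1

/-- Compute the number of samples in register `3`, the truncation bound in register `4`, and the
constants in registers `5`, `6`, `19`. The loop finds `Nat.log 2 n + 1` by repeated halving. -/
def setup (K L q : ℕ) : Stmt :=
  .seq (.blk [.const 5 1, .const 8 2, .const 3 0, .arith .add 9 0 3, .const 4 0])
    (.seq (.loop (.blk []) 9 (.blk [.arith .div 9 9 8, .arith .add 4 4 5]))
      (.blk [.const 3 K, .arith .mul 3 3 0, .arith .mul 3 3 4, .const 8 L, .arith .mul 4 0 8,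
        .arith .div 4 4 2, .arith .add 4 4 5, .arith .add 6 3 3, .const 19 q, .const 7 0]))

/-- The machine code at position `o` that draws the sample and fills the table with ones. -/
def sampling (o : ℕ) : List Instr :=
  [.arith .sub 8 3 7, .jumpZero 8 (o + 8), .rand 9 1, .store 7 9, .arith .add 8 3 7, .store 8 5,
    .arith .add 7 7 5, .jump o]

/-- The deterministic part of the program, after the sample has been drawn. -/
def cover : Stmt :=
  .seq (.blk [.const 10 0, .const 7 0])
    (.seq build (.seq (.blk [.const 8 0, .arith .add 7 3 8, .const 10 0]) greedy))

/-- The complete program. -/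
def program (K L q : ℕ) : Program :=
  (setup K L q).code 0 ++ sampling (setup K L q).size ++ cover.code ((setup K L q).size + 8)

/-- The time bound of the program: the setup, the sampling loop, and the deterministic part. -/
def timeBound (K L q n : ℕ) : ℕ :=
  4 * Nat.log 2 n + 20 + (8 * sampleCount K n + 2) + (10 + 15 * sampleCount K n +
    41 * (sampleCount K n + n * L + 1) + 22 * ((passes q (sampleCount K n) + 1) * n))

section
variable {n m : ℕ} {w : ℕ} {G : CoverageInput n m}

/-- The state after `i` samples have been drawn. -/
structure SampleState (n m B D q k : ℕ) (i : ℕ) (x : ℕ → ℕ) (σ : St) : Prop where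
  consts : Consts n m B D q σ
  r2 : σ.reg 2 = k
  r7 : σ.reg 7 = i
  out : σ.out = []
  x : ∀ r < i, σ.mem r = x r
  val : ∀ r < i, σ.mem (B + r) = 1
  zero : ∀ a, 2 * B ≤ a → σ.mem a = 0

/-- What is known of the output `out` for the sample `x`: it is an approximately greedy solution for
the first `R` samples, where `R` is the number of samples read by the program. -/
def Outcome (G : CoverageInput n m) (B D q k : ℕ) (x : ℕ → ℕ) (out : List ℕ) : Prop :=
  ∃ R ≤ B, (R = B ∨ B ≤ G.total D x R) ∧ GreedySeq G D x R q out ∧ out.length = k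

theorem CoverageInput.hits_le (G : CoverageInput n m) (D : ℕ) (x : ℕ → ℕ) (R v : ℕ) :
    G.hits D x R v ≤ R := by
  refine (Finset.sum_le_sum fun r _ =>
    List.nodup_iff_count_le_one.1 (G.nodup_trunc D (x r)) v).trans ?_
  simp

/-- The deterministic part of the program is correct and fast for every sample. -/
theorem SampleState.cover {B D q k : ℕ} {x : ℕ → ℕ} {σ : St}
    (h : SampleState n m B D q k B x σ) (hF : Fits w n m B D q) (hx : ∀ r, x r ≤ m) (hk : 1 ≤ k)
    (hkn : k ≤ n) (hq : 1 ≤ q) :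
    Ends w G cover σ (10 + 15 * B + 41 * (B + D) + 22 * ((passes q B + 1) * n)) fun σ' =>
      Outcome G B D q k x σ'.out := by
  have hW := hF.lt_pow
  have hZ : B + D + n + 3 ≤ (B + D + n + 3) * (B + D + n + 3) := Nat.le_mul_self _
  have hB := hF.le_B
  have hadj : AdjIs n (fun _ => 1) (fun _ _ => 0) (fun v r' => (r' < 0 ∧ v ∈ G.trunc D (x r')) ∨
      (r' = 0 ∧ v ∈ (G.trunc D 0).take 0)) :=
    ⟨fun _ _ => le_rfl, fun _ _ _ _ _ => by omega, fun _ _ _ h => by simp at h, fun _ _ _ _ => rfl⟩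
  refine (Ends.seq (C₁ := 2) (C₂ := (B * 15 + (B + D) * 17 + 4) + (3 +
    ((passes q B + 1) * n * 22 + (B + D) * 24 + 1))) (R := BuildState G B D q k x 0 0 0)
    (Ends.blk ?_ le_rfl ?_) fun σ₁ h₁ => Ends.seq ((h₁.build hF hx (Nat.zero_le _) (by simp
      [CoverageInput.total]) (by simp)).mono (by simp [CoverageInput.total]) fun _ => id)
      fun σ₂ h₂ => ?_).mono ?_ fun _ => id
  · simp [Safe, Instr.straight, Instr.value]
  · refine ⟨?_, ?_, ?_, ?_, h.out, fun _ => 1, fun _ _ => 0, ⟨h.x, fun v hv => h.val v (by omega),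
      fun u hu p => h.zero _ (by omega)⟩, hadj, ?_⟩
    · exact (h.consts.set (by decide)).set (by decide)
    · simpa [applyAll, Instr.apply, St.set] using h.r2
    · simp [applyAll, Instr.apply, St.set]
    · simp [applyAll, Instr.apply, St.set, CoverageInput.total]
    · simp [CoverageInput.hits]
  · obtain ⟨R, hRB, -, hR, htot, hb⟩ := h₂
    refine Ends.seq (C₁ := 3) (R := GreedyState G B D q k x R [] B 0 0) (Ends.blk ?_ le_rfl ?_)
      fun σ₃ h₃ => (h₃.greedy hF hRB htot (by omega) (by simpa using Nat.lt_of_succ_le hk) hkn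
        hq).mono ?_ fun σ' h' => ⟨R, hRB, hR, h'⟩
    · simp [Safe, Instr.straight, Instr.value, Instr.apply, St.set, ArithOp.eval, hb.consts.r3]
      omega
    · obtain ⟨val, adj, hm₁, hm₂, hm₃⟩ := hb.mem
      have hres : ∀ r, G.resid D x [] r = x r := fun r => by simp [CoverageInput.resid]
      have hres' : G.resid D x [] = x := funext hres
      refine ⟨?_, ?_, ?_, ?_, hb.out, by simp, le_rfl, .nil, ⟨x, val, adj, hm₁, hx,
        fun r _ => (hres r).symm, ?_, ?_⟩, fun v _ h => absurd h (by omega), B, ?_, ?_⟩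
      · exact ((hb.consts.set (by decide)).set (by decide)).set (by decide)
      · simpa [applyAll, Instr.apply, St.set] using hb.r2
      · simp [applyAll, Instr.apply, St.set, ArithOp.eval, hb.consts.r3]
      · simp [applyAll, Instr.apply, St.set]
      · simp only [List.take_zero, List.not_mem_nil, and_false, or_false, List.count_nil,
          add_zero] at hm₂ hm₃
        refine ⟨fun v _ => by simp, fun v hv p hp hp' => ?_, fun v hv r hr => ?_,
          fun v hv p hp => ?_⟩
        · exact hm₂.sound v hv p hp (by rw [hm₃ v hv]; exact hp')
        · simpa [hm₃ v hv] using hm₂.complete v hv r hr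
        · exact hm₂.zero v hv p (by rw [hm₃ v hv]; exact hp)
      · intro v hv
        simpa [hres'] using hm₃ v hv
      · intro v _
        exact (G.hits_le D _ R v).trans hRB
      · exact Nat.mul_le_mul_right _ (Nat.sub_le _ _)
    · rw [G.pending_nil, show G.resid D x [] = x from funext fun r => by
        simp [CoverageInput.resid]]
      have := add_mul (passes q B) 1 n
      omega
  · omega

/-- Repeated halving of register `9` adds the number of its binary digits to register `4`. The
number `s` is an upper bound for the number of rounds. -/
theorem ends_halving {s : ℕ} {σ : St} (h5 : σ.reg 5 = 1) (h8 : σ.reg 8 = 2)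
    (hw : s + σ.reg 4 < 2 ^ w) (hw9 : σ.reg 9 < 2 ^ w) (h9 : σ.reg 9 < 2 ^ s) :
    Ends w G (.loop (.blk []) 9 (.blk [.arith .div 9 9 8, .arith .add 4 4 5])) σ
      (4 * (if σ.reg 9 = 0 then 0 else Nat.log 2 (σ.reg 9) + 1) + 1) fun σ' =>
        σ'.reg 4 = σ.reg 4 + (if σ.reg 9 = 0 then 0 else Nat.log 2 (σ.reg 9) + 1) ∧
        σ'.reg 5 = 1 ∧ σ'.reg 0 = σ.reg 0 ∧ σ'.reg 1 = σ.reg 1 ∧ σ'.reg 2 = σ.reg 2 ∧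
        σ'.mem = σ.mem ∧ σ'.out = σ.out := by
  have hdone : σ.reg 9 = 0 → ∀ C, 1 ≤ C →
      Ends w G (.loop (.blk []) 9 (.blk [.arith .div 9 9 8, .arith .add 4 4 5])) σ C fun σ' =>
        σ'.reg 4 = σ.reg 4 + (if σ.reg 9 = 0 then 0 else Nat.log 2 (σ.reg 9) + 1) ∧
        σ'.reg 5 = 1 ∧ σ'.reg 0 = σ.reg 0 ∧ σ'.reg 1 = σ.reg 1 ∧ σ'.reg 2 = σ.reg 2 ∧
        σ'.mem = σ.mem ∧ σ'.out = σ.out := fun h0 C hC =>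
    (Ends.loopDone (Ends.skip ⟨h0, by simp [h0, h5]⟩)).mono hC fun _ => id
  induction s generalizing σ with
  | zero => exact hdone (by simpa using h9) _ (by omega)
  | succ s ih =>
    by_cases h0 : σ.reg 9 = 0
    · exact hdone h0 _ (by omega)
    · set σ₁ := applyAll G [.arith .div 9 9 8, .arith .add 4 4 5] σ with hσ₁
      have e9 : σ₁.reg 9 = σ.reg 9 / 2 := by simp [hσ₁, applyAll, Instr.apply, St.set,
        ArithOp.eval, h8]
      have e4 : σ₁.reg 4 = σ.reg 4 + 1 := by simp [hσ₁, applyAll, Instr.apply, St.set,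
        ArithOp.eval, h5]
      have e5 : σ₁.reg 5 = 1 := by simpa [hσ₁, applyAll, Instr.apply, St.set] using h5
      have e8 : σ₁.reg 8 = 2 := by simpa [hσ₁, applyAll, Instr.apply, St.set] using h8
      have e0 : σ₁.reg 0 = σ.reg 0 := by simp [hσ₁, applyAll, Instr.apply, St.set]
      have e1 : σ₁.reg 1 = σ.reg 1 := by simp [hσ₁, applyAll, Instr.apply, St.set]
      have e2 : σ₁.reg 2 = σ.reg 2 := by simp [hσ₁, applyAll, Instr.apply, St.set]
      have hlog : (if σ.reg 9 / 2 = 0 then 0 else Nat.log 2 (σ.reg 9 / 2) + 1) =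
          Nat.log 2 (σ.reg 9) := by
        split
        · exact (Nat.log_of_lt (by omega)).symm
        · rw [Nat.log_of_one_lt_of_le (b := 2) (n := σ.reg 9) (by omega) (by omega)]
      rw [if_neg h0]
      refine (Ends.loopStep (C₁ := 0) (C₂ := 2) (C₃ := 4 * Nat.log 2 (σ.reg 9) + 1)
        (R := fun σ' => σ' = σ) (S := fun σ' => σ' = σ₁)
        (Ends.skip ⟨h0, rfl⟩) ?_ ?_).mono (by omega) fun _ => id
      · rintro _ rfl
        refine Ends.blk ?_ le_rfl hσ₁.symm
        simp [Safe, Instr.straight, Instr.value, Instr.apply, St.set, ArithOp.eval, h5, h8]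
        omega
      · rintro _ rfl
        have := ih e5 e8 (by omega) (by omega) (by omega) fun h0 C hC =>
          (Ends.loopDone (Ends.skip ⟨h0, by simp [h0, e5]⟩)).mono hC fun _ => id
        rw [e9, hlog, e4, e0, e1, e2] at this
        refine this.mono le_rfl fun σ' h' => ⟨by omega, h'.2⟩

theorem ends_setup {K L q k : ℕ} (hk : 1 ≤ k) (hkn : k ≤ n) (hK : 1 ≤ K)
    (hF : Fits w n m (sampleCount K n) (truncBound L n k) q) (hL : n * L + L < 2 ^ w) :
    Ends w G (setup K L q) ⟨(initConfig n m k).reg, fun _ => 0, []⟩ (4 * Nat.log 2 n + 20) fun σ =>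
      ∀ x, SampleState n m (sampleCount K n) (truncBound L n k) q k 0 x σ := by
  have hW := hF.lt_pow
  have hB := hF.le_B
  set B := sampleCount K n with hBdef
  set D := truncBound L n k with hDdef
  have hZ : B + D + n + 3 ≤ (B + D + n + 3) * (B + D + n + 3) := Nat.le_mul_self _
  have hn : n < 2 ^ n := Nat.lt_two_pow_self
  have hKn : K * n ≤ B := Nat.le_mul_of_pos_right _ (by omega)
  have hKB : K ≤ K * n := Nat.le_mul_of_pos_right _ (by omega)
  have hBn : K * n * (Nat.log 2 n + 1) = B := rfl
  have hDn : n * L / k + 1 = D := rfl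
  refine (Ends.seq (C₁ := 5) (C₂ := (4 * (Nat.log 2 n + 1) + 1) + 10) (R := fun σ' =>
      σ'.reg 5 = 1 ∧ σ'.reg 8 = 2 ∧ σ'.reg 4 = 0 ∧ σ'.reg 9 = n ∧ σ'.reg 0 = n ∧ σ'.reg 1 = m ∧
      σ'.reg 2 = k ∧ σ'.mem = (fun _ => 0) ∧ σ'.out = [])
    (Ends.blk ?_ le_rfl ?_) fun σ₁ h₁ => Ends.seq (R := fun σ' => σ'.reg 4 = Nat.log 2 n + 1 ∧
      σ'.reg 5 = 1 ∧ σ'.reg 0 = n ∧ σ'.reg 1 = m ∧ σ'.reg 2 = k ∧ σ'.mem = (fun _ => 0) ∧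
      σ'.out = []) ?_ fun σ₂ h₂ => Ends.blk ?_ le_rfl ?_).mono (by omega) fun _ => id
  · simp [Safe, Instr.straight, Instr.value, Instr.apply, St.set, ArithOp.eval, initConfig]
    refine ⟨?_, by omega, by omega⟩
    rintro rfl
    omega
  · simp [applyAll, Instr.apply, St.set, ArithOp.eval, initConfig]
  · obtain ⟨h5, h8, h4, h9, h0, h1, h2, hm, ho⟩ := h₁
    have := ends_halving (G := G) (w := w) (s := n) h5 h8 (by omega) (by omega) (by omega)
    rw [h9, if_neg (by omega), h4, h0, h1, h2, hm, ho, zero_add] at this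
    exact this
  · obtain ⟨h4, h5, h0, h1, h2, hm, ho⟩ := h₂
    simp [Safe, Instr.straight, Instr.value, Instr.apply, St.set, ArithOp.eval, h0, h4, h5, h2,
      hBn, hDn]
    have : n * L / k ≤ D := Nat.le_succ _
    have hD1 : 1 ≤ D := Nat.succ_pos _
    clear hDn hDdef
    clear_value D
    generalize n * L / k = y at this ⊢
    omega
  · obtain ⟨h4, h5, h0, h1, h2, hm, ho⟩ := h₂
    intro x
    refine ⟨⟨?_, ?_, ?_, ?_, ?_, ?_, ?_⟩, ?_, ?_, ?_, fun r hr => absurd hr (by omega),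
      fun r hr => absurd hr (by omega), fun a _ => ?_⟩
    · simp [applyAll, Instr.apply, St.set, h0]
    · simp [applyAll, Instr.apply, St.set, h1]
    · simp [applyAll, Instr.apply, St.set, ArithOp.eval, h0, h4, hBn]
    · simp [applyAll, Instr.apply, St.set, ArithOp.eval, h0, h2, h5, hDn]
    · simp [applyAll, Instr.apply, St.set, h5]
    · simp [applyAll, Instr.apply, St.set, ArithOp.eval, h0, h4, hBn, two_mul]
    · simp [applyAll, Instr.apply, St.set]
    · simp [applyAll, Instr.apply, St.set, h2]
    · simp [applyAll, Instr.apply, St.set]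
    · simpa [applyAll, Instr.apply, St.set] using ho
    · simp [applyAll, Instr.apply, St.set, hm]
end

/-! ### The random sample -/

/-- A draw below `b` chooses from `Fin (max b 1)`: for `b = 0` the machine draws `0`. -/
instance neZero_max_one (b : ℕ) : NeZero (max b 1) := ⟨by omega⟩

theorem uniformBelow_eq_map (b : ℕ) :
    uniformBelow b = (PMF.uniformOfFintype (Fin (max b 1))).map Fin.val := by
  have hb : (Finset.range (max b 1)).Nonempty := ⟨0, by simp⟩
  ext v
  rw [show uniformBelow b = PMF.uniformOfFinset (Finset.range (max b 1)) hb from rfl,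
    PMF.uniformOfFinset_apply, PMF.map_apply, tsum_fintype]
  simp only [PMF.uniformOfFintype_apply, Finset.mem_range, Finset.card_range, Fintype.card_fin]
  by_cases hv : v < max b 1
  · rw [if_pos hv, Finset.sum_eq_single ⟨v, hv⟩]
    · simp
    · intro i _ hi
      rw [if_neg]
      rintro rfl
      exact hi rfl
    · simp
  · rw [if_neg hv, Finset.sum_eq_zero]
    intro i _
    rw [if_neg]
    rintro rfl
    exact hv i.2

/-- A uniformly random vector is drawn by drawing its entries one after the other. -/
theorem uniformOfFintype_snoc (α : Type*) [Fintype α] [Nonempty α] (i : ℕ) :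
    PMF.uniformOfFintype (Fin (i + 1) → α) = (PMF.uniformOfFintype (Fin i → α)).bind fun x =>
      (PMF.uniformOfFintype α).map fun v => Fin.snoc (α := fun _ => α) x v := by
  classical
  ext z
  have h : ∀ (x : Fin i → α) (v : α),
      (z = Fin.snoc (α := fun _ => α) x v) ↔ x = Fin.init z ∧ v = z (Fin.last i) := by
    intro x v
    constructor
    · rintro rfl; simp
    · rintro ⟨rfl, rfl⟩; simp
  rw [PMF.bind_apply, tsum_fintype, Finset.sum_eq_single (Fin.init z)]
  · rw [PMF.map_apply, tsum_fintype, Finset.sum_eq_single (z (Fin.last i))]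
    · simp only [Fin.snoc_init_self, if_true, PMF.uniformOfFintype_apply, Fintype.card_fun,
        Fintype.card_fin]
      rw [← ENNReal.mul_inv (by simp) (by simp), pow_succ]
      push_cast
      rfl
    · intro v _ hv
      rw [if_neg fun h' => hv ((h _ _).1 h').2]
    · simp
  · intro x _ hx
    rw [PMF.map_apply, tsum_fintype, Finset.sum_eq_zero, mul_zero]
    intro v _
    rw [if_neg fun h' => hx ((h _ _).1 h').1]
  · simp

/-- A vector, extended by zeros. -/
def extend {M i : ℕ} (x : Fin i → Fin M) (r : ℕ) : ℕ := if h : r < i then x ⟨r, h⟩ else 0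

theorem extend_snoc_lt {M i : ℕ} (x : Fin i → Fin M) (v : Fin M) {r : ℕ} (hr : r < i) :
    extend (Fin.snoc (α := fun _ => Fin M) x v) r = extend x r := by
  rw [extend, extend, dif_pos hr, dif_pos (by omega)]
  simp [Fin.snoc, hr]

section
variable {n m : ℕ} {w : ℕ} {G : CoverageInput n m} {P : Program}

/-- One round of the sampling loop appends a uniformly random element to the sample. -/
theorem SampleState.draw {B D q k o i : ℕ} {x : ℕ → ℕ} {σ : St}
    (hP : Located P o (sampling o)) (hF : Fits w n m B D q) (hi : i < B)
    (h : SampleState n m B D q k i x σ) :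
    ∃ f : ℕ → St, runFrom w G P 8 (σ.at o) = (uniformBelow m).map (fun v => (f v).at o) ∧
      ∀ v < max m 1, ∀ y : ℕ → ℕ, (∀ r < i, y r = x r) → y i = v →
        SampleState n m B D q k (i + 1) y (f v) := by
  have hW := hF.lt_pow
  have hB := hF.le_B
  have hZ : B + D + n + 3 ≤ (B + D + n + 3) * (B + D + n + 3) := Nat.le_mul_self _
  obtain ⟨p0, hP⟩ := located_cons.1 hP
  obtain ⟨p1, hP⟩ := located_cons.1 hP
  obtain ⟨p2, hP⟩ := located_cons.1 hP
  have hP' : Located P (o + 1 + 1 + 1) ([.store 7 9, .arith .add 8 3 7, .store 8 5,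
    .arith .add 7 7 5] ++ [.jump o]) := hP
  obtain ⟨p3, p4⟩ := located_append.1 hP'
  obtain ⟨p4, -⟩ := located_cons.1 p4
  set σ₁ := σ.set 8 (B - i) with hσ₁
  have r1 : σ₁.reg 1 = m := by simpa [hσ₁, St.set] using h.consts.r1
  have r3 : σ₁.reg 3 = B := by simpa [hσ₁, St.set] using h.consts.r3
  have r5 : σ₁.reg 5 = 1 := by simpa [hσ₁, St.set] using h.consts.r5
  have r7 : σ₁.reg 7 = i := by simpa [hσ₁, St.set] using h.r7
  have s0 : runFrom w G P 1 (σ.at o) = PMF.pure (σ₁.at (o + 1)) := by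
    rw [runFrom_one, step_straight p0 rfl]
    · simp [Instr.apply, ArithOp.eval, h.consts.r3, h.r7, hσ₁]
    · simp [Instr.value, ArithOp.eval, h.consts.r3, h.r7]
      omega
  have s1 : runFrom w G P 1 (σ₁.at (o + 1)) = PMF.pure (σ₁.at (o + 1 + 1)) := by
    rw [runFrom_one, step_jumpZero p1, if_neg]
    simp [hσ₁, St.set]
    omega
  have s2 : runFrom w G P 1 (σ₁.at (o + 1 + 1)) =
      (uniformBelow m).map fun v => (σ₁.set 9 (v % 2 ^ w)).at (o + 1 + 1 + 1) := by
    rw [runFrom_one]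
    have hP' : P[(σ₁.at (o + 1 + 1)).pc]? = some (.rand 9 1) := p2
    unfold step
    rw [hP']
    simp only [exec]
    rw [show (σ₁.at (o + 1 + 1)).reg 1 = m from r1]
    rfl
  set g : ℕ → St := fun v => applyAll G [.store 7 9, .arith .add 8 3 7, .store 8 5,
    .arith .add 7 7 5] (σ₁.set 9 (v % 2 ^ w)) with hg
  have s3 : ∀ v, runFrom w G P (4 + 1) ((σ₁.set 9 (v % 2 ^ w)).at (o + 1 + 1 + 1)) =
      PMF.pure ((g v).at o) := by
    intro v
    refine runFrom_trans (runFrom_applyAll p3 ?_) ((runFrom_one _).trans (step_jump p4))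
    simp [Safe, Instr.straight, Instr.value, Instr.apply, St.set, ArithOp.eval, r3, r5, r7]
    omega
  refine ⟨g, ?_, ?_⟩
  · rw [show 8 = 1 + (1 + (1 + (4 + 1))) from rfl]
    refine runFrom_trans s0 (runFrom_trans s1 ?_)
    rw [runFrom_add, s2, PMF.bind_map]
    simp only [Function.comp_def, s3]
    rfl
  · intro v hv y hy hyi
    have hvW : v % 2 ^ w = v := Nat.mod_eq_of_lt (by omega)
    have hmem : (g v).mem = Function.update (Function.update σ.mem i v) (B + i) 1 := by
      simp [hg, applyAll, Instr.apply, St.set, ArithOp.eval, hvW, hσ₁, h.consts.r3, h.consts.r5,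
        h.r7]
    refine ⟨?_, ?_, ?_, ?_, ?_, ?_, ?_⟩
    · have h' : Consts n m B D q (((σ.set 8 (B - i)).set 9 (v % 2 ^ w)).set 8 (B + i)) :=
        ((h.consts.set (by decide)).set (by decide)).set (by decide)
      obtain ⟨c0, c1, c3, c4, c5, c6, c19⟩ := h.consts
      constructor <;> simpa [hg, hσ₁, applyAll, Instr.apply, St.set, ArithOp.eval]
    · simpa [hg, hσ₁, applyAll, Instr.apply, St.set] using h.r2
    · simp [hg, applyAll, Instr.apply, St.set, ArithOp.eval, r7, r5]
    · simpa [hg, hσ₁, applyAll, Instr.apply, St.set] using h.out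
    · intro r hr
      rw [hmem, Function.update_of_ne (by omega)]
      rcases Nat.lt_succ_iff_lt_or_eq.1 hr with hr | rfl
      · rw [Function.update_of_ne (by omega), h.x r hr, hy r hr]
      · rw [Function.update_self, hyi]
    · intro r hr
      rw [hmem]
      rcases Nat.lt_succ_iff_lt_or_eq.1 hr with hr | rfl
      · rw [Function.update_of_ne (by omega), Function.update_of_ne (by omega), h.val r hr]
      · rw [Function.update_self]
    · intro a ha
      rw [hmem, Function.update_of_ne (by omega), Function.update_of_ne (by omega), h.zero a ha]

/-- After `i` rounds of the sampling loop, the state is determined by a uniformly random vector of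
`i` elements. -/
theorem runFrom_sampling {B D q k o : ℕ} {σ : St}
    (hP : Located P o (sampling o)) (hF : Fits w n m B D q)
    (h : ∀ x, SampleState n m B D q k 0 x σ) {i : ℕ} (hi : i ≤ B) :
    ∃ f : (Fin i → Fin (max m 1)) → St,
      runFrom w G P (8 * i) (σ.at o) =
        (PMF.uniformOfFintype (Fin i → Fin (max m 1))).map (fun x => (f x).at o) ∧
      ∀ x, SampleState n m B D q k i (extend x) (f x) := by
  induction i with
  | zero =>
    refine ⟨fun _ => σ, ?_, fun x => h _⟩
    exact (PMF.map_const _ _).symm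
  | succ i ih =>
    obtain ⟨f, hf, hs⟩ := ih (by omega)
    choose g hg hg' using fun x => SampleState.draw (G := G) hP hF hi (hs x)
    refine ⟨fun z => g (Fin.init z) (z (Fin.last i)), ?_, fun z => ?_⟩
    · rw [mul_add, mul_one, runFrom_add, hf, PMF.bind_map, uniformOfFintype_snoc, PMF.map_bind]
      congr 1
      funext x
      rw [Function.comp_apply, hg, uniformBelow_eq_map, PMF.map_comp, PMF.map_comp]
      congr 1
      funext v
      simp
    · refine hg' _ _ (z (Fin.last i)).2 _ (fun r hr => ?_) ?_
      · conv_lhs => rw [← Fin.snoc_init_self (α := fun _ => Fin (max m 1)) z]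
        exact extend_snoc_lt _ _ hr
      · simp [extend, Fin.last]

/-- The final configuration is a function of the uniformly random sample; it is a halted
configuration whose output is approximately greedy for the sample. -/
theorem run_program {K L q k : ℕ} (hk : 1 ≤ k) (hkn : k ≤ n) (hK : 1 ≤ K) (hq : 1 ≤ q)
    (hF : Fits w n m (sampleCount K n) (truncBound L n k) q) (hL : n * L + L < 2 ^ w) :
    ∃ f : (Fin (sampleCount K n) → Fin (max m 1)) → Config,
      run w G k (program K L q) (timeBound K L q n) =
        (PMF.uniformOfFintype (Fin (sampleCount K n) → Fin (max m 1))).map f ∧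
      ∀ x, (f x).Halted (program K L q) ∧
        Outcome G (sampleCount K n) (truncBound L n k) q k (extend x) (f x).out := by
  set B := sampleCount K n with hB
  set D := truncBound L n k with hD
  set P := program K L q with hP
  set o := (setup K L q).size with ho
  have hW := hF.lt_pow
  have hall : Located P 0 P := fun i _ => by rw [zero_add]
  obtain ⟨hl, l3⟩ := located_append.1 (show Located P 0 (((setup K L q).code 0 ++ sampling o) ++
    cover.code (o + 8)) from hall)
  obtain ⟨l1, l2⟩ := located_append.1 hl
  rw [List.length_append, Stmt.length_code, zero_add] at l3
  rw [Stmt.length_code, zero_add] at l2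
  have hlen : P.length = o + 8 + cover.size := by
    rw [hP, program, List.length_append, List.length_append, Stmt.length_code, Stmt.length_code]
    rfl
  obtain ⟨t₁, ht₁, σ₁, he₁, hs₁⟩ := ends_setup (G := G) hk hkn hK hF hL
  have h₁ := he₁.runFrom l1
  rw [zero_add] at h₁
  obtain ⟨f, hf, hs⟩ := runFrom_sampling (G := G) l2 hF hs₁ (le_refl B)
  -- leaving the sampling loop
  have hexit : ∀ x, runFrom w G P 2 ((f x).at o) = PMF.pure (((f x).set 8 0).at (o + 8)) := by
    intro x
    obtain ⟨p0, p⟩ := located_cons.1 l2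
    obtain ⟨p1, -⟩ := located_cons.1 p
    have e0 : step w G P ((f x).at o) = PMF.pure (((f x).set 8 0).at (o + 1)) := by
      rw [step_straight p0 rfl]
      · simp [Instr.apply, ArithOp.eval, (hs x).consts.r3, (hs x).r7, ← ho]
      · simp [Instr.value, ArithOp.eval, (hs x).consts.r3, (hs x).r7]
    have e1 := step_jumpZero (w := w) (G := G) (σ := (f x).set 8 0) p1
    rw [if_pos (by simp [St.set])] at e1
    exact runFrom_trans ((runFrom_one _).trans e0) ((runFrom_one _).trans e1)
  have hx : ∀ (x : Fin B → Fin (max m 1)) r, extend x r ≤ m := by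
    intro x r
    unfold extend
    split
    · rename_i hr
      have := (x ⟨r, hr⟩).2
      omega
    · omega
  -- the deterministic part, after which the machine idles
  have hcov : ∀ x, ∃ c, runFrom w G P (10 + 15 * B + 41 * (B + D) + 22 * ((passes q B + 1) * n))
      (((f x).set 8 0).at (o + 8)) = PMF.pure c ∧ c.Halted P ∧
        Outcome G B D q k (extend x) c.out := by
    intro x
    have hs' : SampleState n m B D q k B (extend x) ((f x).set 8 0) := by
      have := hs x
      refine ⟨this.consts.set (by decide), ?_, ?_, this.out, this.x, this.val, this.zero⟩
      · simpa [St.set] using this.r2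
      · simpa [St.set] using this.r7
    obtain ⟨t, ht, σ', he, ho'⟩ := hs'.cover (G := G) hF (hx x) hk hkn hq
    have hh : (σ'.at (o + 8 + cover.size)).Halted P := hlen.le
    refine ⟨_, ?_, hh, ho'⟩
    obtain ⟨s, hs⟩ := Nat.exists_eq_add_of_le ht
    rw [hs]
    exact runFrom_trans (he.runFrom l3) (runFrom_of_halted hh s)
  choose c hc using hcov
  have hDn : D ≤ n * L + 1 := Nat.succ_le_succ (Nat.div_le_self _ _)
  set T₃ := 10 + 15 * B + 41 * (B + D) + 22 * ((passes q B + 1) * n) with hT₃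
  -- the time that is left over is spent in a halted configuration
  obtain ⟨s, hs'⟩ := Nat.exists_eq_add_of_le
    (show t₁ + (8 * B + (2 + T₃)) ≤ timeBound K L q n by
      unfold timeBound; rw [← hB]; omega)
  refine ⟨c, ?_, fun x => (hc x).2⟩
  rw [run_eq_runFrom, hs', add_assoc]
  refine runFrom_trans h₁ ?_
  rw [add_assoc, runFrom_add, hf, PMF.bind_map]
  change (PMF.uniformOfFintype _).bind _ = (PMF.uniformOfFintype _).bind _
  congr 1
  funext x
  exact runFrom_trans (runFrom_trans (hexit x) (hc x).1) (runFrom_of_halted (hc x).2.1 s)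
end

/-! ### Covering elements by few sets -/

section
variable {α β : Type*} [DecidableEq β]

/-- The number of elements of `E` that are covered by `S`, where `N e` is the family of the sets
that contain `e`. -/
def covCount (E : Finset α) (N : α → Finset β) (S : Finset β) : ℕ :=
  (E.filter fun e => ∃ s ∈ S, s ∈ N e).card

/-- The number of elements of `E` that are covered by `v` but not by `S`. -/
def gain (E : Finset α) (N : α → Finset β) (S : Finset β) (v : β) : ℕ :=
  (E.filter fun e => v ∈ N e ∧ ¬ ∃ s ∈ S, s ∈ N e).card

theorem covCount_empty (E : Finset α) (N : α → Finset β) : covCount E N ∅ = 0 := by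
  simp [covCount]

theorem covCount_mono (E : Finset α) (N : α → Finset β) {S T : Finset β} (h : S ⊆ T) :
    covCount E N S ≤ covCount E N T :=
  Finset.card_le_card (Finset.monotone_filter_right _ fun _ _ ⟨s, hs, hs'⟩ => ⟨s, h hs, hs'⟩)

theorem covCount_insert (E : Finset α) (N : α → Finset β) (S : Finset β) (v : β) :
    covCount E N (insert v S) = covCount E N S + gain E N S v := by
  classical
  rw [covCount, covCount, gain, ← Finset.card_union_of_disjoint]
  · congr 1
    ext e
    simp only [Finset.mem_filter, Finset.mem_union, Finset.mem_insert, exists_eq_or_imp]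
    generalize (∃ s ∈ S, s ∈ N e) = p
    tauto
  · exact Finset.disjoint_filter.2 fun e _ h h' => h'.2 h

/-- The sets of `O` outside of `S` cover together what `O` covers more than `S`. -/
theorem covCount_le_add_sum_gain (E : Finset α) (N : α → Finset β) (S O : Finset β) :
    covCount E N O ≤ covCount E N S + ∑ v ∈ O \ S, gain E N S v := by
  classical
  have h : (E.filter fun e => ∃ s ∈ O, s ∈ N e) ⊆ (E.filter fun e => ∃ s ∈ S, s ∈ N e) ∪
      (O \ S).biUnion fun v => E.filter fun e => v ∈ N e ∧ ¬ ∃ s ∈ S, s ∈ N e := by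
    intro e he
    obtain ⟨heE, v, hv, hve⟩ := Finset.mem_filter.1 he
    by_cases hS : ∃ s ∈ S, s ∈ N e
    · exact Finset.mem_union_left _ (Finset.mem_filter.2 ⟨heE, hS⟩)
    · refine Finset.mem_union_right _ (Finset.mem_biUnion.2 ⟨v, ?_, ?_⟩)
      · exact Finset.mem_sdiff.2 ⟨hv, fun hvS => hS ⟨v, hvS, hve⟩⟩
      · exact Finset.mem_filter.2 ⟨heE, hve, hS⟩
  exact (Finset.card_le_card h).trans ((Finset.card_union_le _ _).trans
    (Nat.add_le_add_left Finset.card_biUnion_le _))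

/-- Some subfamily of `O` of size `s` covers its share `s / |O|` of what `O` covers. -/
theorem exists_subset_covCount (E : Finset α) (N : α → Finset β) (O : Finset β) {s : ℕ}
    (hs : s ≤ O.card) : ∃ S ⊆ O, S.card = s ∧ s * covCount E N O ≤ O.card * covCount E N S := by
  induction s with
  | zero => exact ⟨∅, by simp, rfl, by simp⟩
  | succ s ih =>
    obtain ⟨S, hSO, hS, hcov⟩ := ih (by omega)
    have hcard : (O \ S).card = O.card - s := by rw [Finset.card_sdiff_of_subset hSO, hS]
    have hne : (O \ S).Nonempty := Finset.card_pos.1 (by omega)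
    obtain ⟨v, hv, hmax⟩ := Finset.exists_max_image (O \ S) (gain E N S) hne
    have hv' := Finset.mem_sdiff.1 hv
    have hsum := covCount_le_add_sum_gain E N S O
    have hle := Finset.sum_le_card_nsmul (O \ S) (gain E N S) _ hmax
    rw [hcard, smul_eq_mul] at hle
    refine ⟨insert v S, Finset.insert_subset hv'.1 hSO, by
      rw [Finset.card_insert_of_notMem hv'.2, hS], ?_⟩
    rw [covCount_insert]
    obtain ⟨j, hj⟩ : ∃ j, O.card = s + (j + 1) := ⟨O.card - s - 1, by omega⟩
    have hj' : O.card - s = j + 1 := by omega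
    rw [hj'] at hle
    rw [hj] at hcov ⊢
    generalize covCount E N O = C at *
    generalize covCount E N S = c at *
    generalize gain E N S v = g at *
    have h1 : C ≤ c + (j + 1) * g := hsum.trans (Nat.add_le_add_left hle _)
    refine Nat.le_of_mul_le_mul_left (c := j + 1) ?_ (by omega)
    nlinarith [Nat.mul_le_mul_left j hcov, Nat.mul_le_mul_left (s + (j + 1)) h1]

/-- Averaging: some set `v` of the ground family covers at least the average part of `U`. -/
theorem exists_hit (V : Finset β) (hV : V.Nonempty) (U : Finset α) (N : α → Finset β)
    (hN : ∀ e ∈ U, N e ⊆ V) :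
    ∃ v ∈ V, ∑ e ∈ U, (N e).card ≤ V.card * (U.filter fun e => v ∈ N e).card := by
  classical
  obtain ⟨v, hv, hmax⟩ := Finset.exists_max_image V (fun v => (U.filter fun e => v ∈ N e).card) hV
  refine ⟨v, hv, ?_⟩
  rw [← smul_eq_mul]
  refine le_trans ?_ (Finset.sum_le_card_nsmul V _ _ hmax)
  simp only [Finset.card_filter]
  rw [Finset.sum_comm]
  refine Finset.sum_le_sum fun e he => ?_
  rw [← Finset.card_filter]
  exact Finset.card_le_card fun v hv => Finset.mem_filter.2 ⟨hN e he hv, hv⟩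

/-- If every element of `U` lies in at least `D` of the sets in `V`, then some `t` sets leave at
most the part `(1 - D / |V|) ^ t` of `U` uncovered. -/
theorem exists_hitting_set (V : Finset β) (hV : V.Nonempty) (U : Finset α) (N : α → Finset β)
    (hN : ∀ e ∈ U, N e ⊆ V) {D : ℕ} (hD : ∀ e ∈ U, D ≤ (N e).card) (hDV : D ≤ V.card) (t : ℕ) :
    ∃ T ⊆ V, T.card ≤ t ∧ ((U.filter fun e => ¬ ∃ s ∈ T, s ∈ N e).card : ℝ) ≤
      (1 - (D : ℝ) / V.card) ^ t * U.card := by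
  induction t with
  | zero => exact ⟨∅, by simp, by simp, by simp⟩
  | succ t ih =>
    obtain ⟨T, hTV, hT, hcov⟩ := ih
    set W := U.filter fun e => ¬ ∃ s ∈ T, s ∈ N e with hW
    obtain ⟨v, hv, hvW⟩ := exists_hit V hV W N fun e he => hN e (Finset.mem_filter.1 he).1
    have h1 : W.card * D ≤ ∑ e ∈ W, (N e).card := by
      rw [← smul_eq_mul]
      exact Finset.card_nsmul_le_sum _ _ _ fun e he => hD e (Finset.mem_filter.1 he).1
    refine ⟨insert v T, Finset.insert_subset hv hTV, (Finset.card_insert_le _ _).trans (by omega),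
      ?_⟩
    have h2 : (U.filter fun e => ¬ ∃ s ∈ insert v T, s ∈ N e) = W.filter fun e => ¬ v ∈ N e := by
      ext e
      simp only [hW, Finset.mem_filter, Finset.mem_insert, exists_eq_or_imp]
      generalize (∃ s ∈ T, s ∈ N e) = p
      tauto
    have h3 := Finset.card_filter_add_card_filter_not (s := W) (fun e => v ∈ N e)
    have hVpos : (0 : ℝ) < V.card := by exact_mod_cast Finset.card_pos.2 hV
    have h4 : (W.card : ℝ) * D ≤ V.card * (W.filter fun e => v ∈ N e).card := by
      exact_mod_cast h1.trans hvW
    have h5 : ((W.filter fun e => v ∈ N e).card : ℝ) + (W.filter fun e => ¬ v ∈ N e).card =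
      W.card := by exact_mod_cast h3
    have h6 : ((W.filter fun e => ¬ v ∈ N e).card : ℝ) ≤ (1 - (D : ℝ) / V.card) * W.card := by
      have : (D : ℝ) / V.card * W.card ≤ (W.filter fun e => v ∈ N e).card := by
        rw [div_mul_eq_mul_div, div_le_iff₀ hVpos]; linarith
      linarith
    have h7 : (0 : ℝ) ≤ 1 - (D : ℝ) / V.card := by
      rw [sub_nonneg, div_le_one hVpos]; exact_mod_cast hDV
    rw [h2, pow_succ']
    calc _ ≤ (1 - (D : ℝ) / V.card) * W.card := h6
      _ ≤ _ := by rw [mul_assoc]; exact mul_le_mul_of_nonneg_left hcov h7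

/-- If no element lies in more than `D` sets, then some `i` sets cover so many elements that the
number of all edges is bounded in terms of this number. These sets are chosen greedily: by
averaging, the next set covers at least the part `1 / |V|` of the edges at uncovered elements, and
the covered elements have at most `D` edges each. -/
theorem exists_covCount_ge (V : Finset β) (hV : V.Nonempty) (E : Finset α) (N : α → Finset β)
    (hN : ∀ e ∈ E, N e ⊆ V) {D : ℕ} (hD : ∀ e ∈ E, (N e).card ≤ D) (i : ℕ) :
    ∃ S ⊆ V, S.card ≤ i ∧
      i * ∑ e ∈ E, (N e).card ≤ V.card * covCount E N S + i * D * covCount E N S := by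
  induction i with
  | zero => exact ⟨∅, by simp, by simp, by simp⟩
  | succ i ih =>
    obtain ⟨S, hSV, hS, hcov⟩ := ih
    set W := E.filter fun e => ¬ ∃ s ∈ S, s ∈ N e with hW
    obtain ⟨v, hv, hvW⟩ := exists_hit V hV W N fun e he => hN e (Finset.mem_filter.1 he).1
    refine ⟨insert v S, Finset.insert_subset hv hSV, (Finset.card_insert_le _ _).trans (by omega),
      ?_⟩
    have h1 : (W.filter fun e => v ∈ N e).card = gain E N S v := by
      rw [gain, hW, Finset.filter_filter]
      simp only [and_comm]
    have h2 : ∑ e ∈ E, (N e).card ≤ D * covCount E N S + ∑ e ∈ W, (N e).card := by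
      rw [← Finset.sum_filter_add_sum_filter_not E (fun e => ∃ s ∈ S, s ∈ N e)]
      refine Nat.add_le_add_right ?_ _
      rw [mul_comm, ← smul_eq_mul]
      exact Finset.sum_le_card_nsmul _ _ _ fun e he => hD e (Finset.mem_filter.1 he).1
    rw [covCount_insert]
    rw [h1] at hvW
    generalize ∑ e ∈ E, (N e).card = Z at *
    generalize ∑ e ∈ W, (N e).card = Y at *
    generalize covCount E N S = c at *
    generalize gain E N S v = g at *
    nlinarith [Nat.zero_le ((i + 1) * D * g)]

/-- The analysis of the greedy algorithm: if every step gains at least the part `b / k` of the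
optimal improvement, then after `i` steps at most the part `(1 - b / k) ^ i` is missing. -/
theorem greedy_step {C c g b k : ℝ} {i : ℕ} (hk : 0 < k) (hbk : b ≤ k)
    (h : C - c ≤ (1 - b / k) ^ i * C) (hg : b * (C - c) ≤ k * g) :
    C - (c + g) ≤ (1 - b / k) ^ (i + 1) * C := by
  have h1 : b / k * (C - c) ≤ g := by rw [div_mul_eq_mul_div, div_le_iff₀ hk]; linarith
  have h2 : 0 ≤ 1 - b / k := by rw [sub_nonneg, div_le_one hk]; exact hbk
  have h3 := mul_le_mul_of_nonneg_left h h2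
  rw [pow_succ']
  nlinarith
end

/-! ### Truncated instances -/

section
variable {n m : ℕ}

/-- The first `D` sets in the edge list of the element `e`, as a finite set. -/
def CoverageInput.nbrs (G : CoverageInput n m) (D e : ℕ) : Finset ℕ := (G.trunc D e).toFinset

theorem CoverageInput.nbrs_subset (G : CoverageInput n m) (D e : ℕ) :
    G.nbrs D e ⊆ Finset.range n := fun _ hv =>
  Finset.mem_range.2 (G.lt_of_mem_trunc (List.mem_toFinset.1 hv))

theorem CoverageInput.card_nbrs (G : CoverageInput n m) (D e : ℕ) :
    (G.nbrs D e).card = (G.trunc D e).length :=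
  List.toFinset_card_of_nodup (G.nodup_trunc D e)

theorem CoverageInput.card_nbrs_le (G : CoverageInput n m) (D e : ℕ) : (G.nbrs D e).card ≤ D :=
  (G.card_nbrs D e).trans_le (G.length_trunc_le D e)

theorem CoverageInput.length_elemList_le (G : CoverageInput n m) (e : Fin m) :
    (G.elemList e).length ≤ n := by
  simpa using (G.nodup_elemList e).length_le_card

theorem CoverageInput.nbrs_of_length_le (G : CoverageInput n m) {D : ℕ} (e : Fin m)
    (h : (G.elemList e).length ≤ D) : G.nbrs D e = G.nbrs n e := by
  simp [nbrs, trunc, List.take_of_length_le, h, G.length_elemList_le e]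

theorem CoverageInput.nbrs_eq_of_card_ne (G : CoverageInput n m) {D : ℕ} {e : ℕ} (he : e < m)
    (h : (G.nbrs D e).card ≠ D) : G.nbrs D e = G.nbrs n e := by
  refine G.nbrs_of_length_le ⟨e, he⟩ ?_
  rw [G.card_nbrs] at h
  simp [trunc, he] at h
  exact h.le

theorem CoverageInput.nbrs_subset_nbrs (G : CoverageInput n m) (D e : ℕ) :
    G.nbrs D e ⊆ G.nbrs n e := by
  by_cases he : e < m
  · intro v hv
    have h := G.length_elemList_le ⟨e, he⟩
    simp only [nbrs, trunc, he, dif_pos, List.mem_toFinset] at hv ⊢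
    rw [List.take_of_length_le (by simpa using h)]
    exact List.mem_of_mem_take hv
  · simp [nbrs, trunc, he]

theorem CoverageInput.covCount_trunc_le (G : CoverageInput n m) (D : ℕ) (S : Finset ℕ) :
    covCount (Finset.range m) (G.nbrs D) S ≤ covCount (Finset.range m) (G.nbrs n) S :=
  Finset.card_le_card (Finset.monotone_filter_right _ fun _ _ ⟨s, hs, hs'⟩ =>
    ⟨s, hs, G.nbrs_subset_nbrs _ _ hs'⟩)

theorem CoverageInput.coverage_eq_covCount (G : CoverageInput n m) (S : Finset (Fin n)) :
    G.coverage S = covCount (Finset.range m) (G.nbrs n) (S.map Fin.valEmbedding) := by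
  unfold coverage covCount
  rw [← Finset.card_map Fin.valEmbedding]
  congr 1
  ext e
  have key : ∀ (he : e < m) (s : Fin n),
      (s : ℕ) ∈ G.nbrs n e ↔ (⟨e, he⟩ : Fin m) ∈ G.setList s := by
    intro he s
    have h := G.length_elemList_le ⟨e, he⟩
    rw [G.mem_iff]
    simp only [nbrs, trunc, he, dif_pos, List.mem_toFinset]
    rw [List.take_of_length_le (by simpa using h), List.mem_map]
    constructor
    · rintro ⟨s', hs', h'⟩
      rwa [← Fin.ext h']
    · intro hs
      exact ⟨s, hs, rfl⟩
  simp only [Finset.mem_map, Finset.mem_biUnion, List.mem_toFinset, Finset.mem_filter,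
    Finset.mem_range, Fin.valEmbedding_apply]
  constructor
  · rintro ⟨e', ⟨s, hs, he'⟩, rfl⟩
    exact ⟨e'.2, s, ⟨s, hs, rfl⟩, (key e'.2 s).2 he'⟩
  · rintro ⟨he, _, ⟨s, hs, rfl⟩, hse⟩
    exact ⟨⟨e, he⟩, ⟨s, hs, (key he s).1 hse⟩, rfl⟩

theorem CoverageInput.exists_opt (G : CoverageInput n m) {k : ℕ} (hk : k ≤ n) :
    ∃ O ⊆ Finset.range n, O.card = k ∧ covCount (Finset.range m) (G.nbrs n) O = G.opt k := by
  obtain ⟨O, hO, hopt⟩ := Finset.exists_mem_eq_sup ((Finset.univ : Finset (Fin n)).powersetCard k)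
    (Finset.powersetCard_nonempty.2 (by simpa using hk)) G.coverage
  refine ⟨O.map Fin.valEmbedding, ?_, ?_, ?_⟩
  · intro v hv
    obtain ⟨s, -, rfl⟩ := Finset.mem_map.1 hv
    exact Finset.mem_range.2 s.2
  · rw [Finset.card_map]; exact (Finset.mem_powersetCard.1 hO).2
  · rw [← G.coverage_eq_covCount, opt, hopt]

theorem mul_truncBound_le {L n k : ℕ} (hkn : k ≤ n) : k * truncBound L n k ≤ n * (L + 1) := by
  have := Nat.mul_div_le (n * L) k
  rw [truncBound, mul_add, mul_add]
  omega

theorem le_mul_truncBound {L n k : ℕ} (hk : 1 ≤ k) : n * L ≤ k * truncBound L n k :=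
  (Nat.lt_mul_div_succ (n * L) hk).le

/-- Truncation of the edge lists costs little: the best `k` sets lose at most the part `2 / q`. All
but `k / q` of the sets keep their share of the coverage, and `k / q` other sets suffice to hit all
but the part `1 / q` of the elements whose lists are actually truncated, since these elements have
large degree. -/
theorem CoverageInput.exists_trunc_near_opt (G : CoverageInput n m) {k q : ℕ} (hk : 1 ≤ k)
    (hkn : k ≤ n) (hq : 2 ≤ q) :
    ∃ O ⊆ Finset.range n, O.card = k ∧ (1 - 2 / (q : ℝ)) * G.opt k ≤
      covCount (Finset.range m) (G.nbrs (truncBound (2 * q ^ 2) n k)) O := by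
  classical
  set D := truncBound (2 * q ^ 2) n k with hD
  obtain ⟨O, hO, hOk, hopt⟩ := G.exists_opt hkn
  have hq0 : (0 : ℝ) < q := by exact_mod_cast (by omega : 0 < q)
  have hq2 : (2 : ℝ) ≤ q := by exact_mod_cast hq
  by_cases hDn : n ≤ D
  · refine ⟨O, hO, hOk, ?_⟩
    have h : covCount (Finset.range m) (G.nbrs D) O = covCount (Finset.range m) (G.nbrs n) O := by
      unfold covCount
      congr 1
      refine Finset.filter_congr fun e he => ?_
      rw [G.nbrs_of_length_le ⟨e, Finset.mem_range.1 he⟩ ((G.length_elemList_le _).trans hDn)]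
    rw [h, hopt]
    have : (0 : ℝ) ≤ 2 / q := by positivity
    nlinarith [Nat.cast_nonneg (α := ℝ) (G.opt k)]
  · have hDk : n * (2 * q ^ 2) ≤ k * D := le_mul_truncBound hk
    have hkq : q ≤ k := by
      by_contra h
      push Not at h
      have h1 : k * D ≤ k * n := Nat.mul_le_mul_left _ (by omega)
      have h2 : n * q ≤ n * (2 * q ^ 2) := Nat.mul_le_mul_left _ (by nlinarith)
      have h3 : k * n < n * q := by rw [mul_comm]; exact Nat.mul_lt_mul_of_pos_left h (by omega)
      omega
    set t := k / q with ht
    have ht1 : q * t ≤ k := Nat.mul_div_le k q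
    have ht2 : k < q * (t + 1) := Nat.lt_mul_div_succ k (by omega)
    have ht3 : 1 ≤ t := (Nat.one_le_div_iff (by omega)).2 hkq
    have htk : t ≤ k := Nat.div_le_self _ _
    obtain ⟨S, hSO, hS, hScov⟩ := exists_subset_covCount (Finset.range m) (G.nbrs n) O
      (s := k - t) (by omega)
    set U := (Finset.range m).filter fun e => (∃ s ∈ S, s ∈ G.nbrs n e) ∧ (G.nbrs D e).card = D
      with hU
    have hV : (Finset.range n).Nonempty := ⟨0, Finset.mem_range.2 (by omega)⟩
    obtain ⟨T, hT, hTt, hTcov⟩ := exists_hitting_set (Finset.range n) hV U (G.nbrs D)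
      (fun e _ => G.nbrs_subset D e) (D := D) (fun e he => (Finset.mem_filter.1 he).2.2.ge)
      (by simp; omega) t
    rw [Finset.card_range] at hTcov
    obtain ⟨O', hO'1, hO'2, hO'3⟩ := Finset.exists_subsuperset_card_eq (s := S ∪ T)
      (t := Finset.range n) (n := k) (Finset.union_subset (hSO.trans hO) hT)
      ((Finset.card_union_le _ _).trans (by omega)) (by simpa using hkn)
    refine ⟨O', hO'2, hO'3, ?_⟩
    have hk0 : (0 : ℝ) < k := by exact_mod_cast hk
    have hn0 : (0 : ℝ) < n := by exact_mod_cast (by omega : 0 < n)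
    -- the elements that `S` covers but that may get lost by truncation
    have h1 : covCount (Finset.range m) (G.nbrs n) S ≤ covCount (Finset.range m) (G.nbrs D) O' +
        (U.filter fun e => ¬ ∃ s ∈ T, s ∈ G.nbrs D e).card := by
      unfold covCount
      refine le_trans (Finset.card_le_card ?_) (Finset.card_union_le _ _)
      intro e he
      obtain ⟨hem, s, hs, hse⟩ := Finset.mem_filter.1 he
      by_cases hc : ∃ s ∈ O', s ∈ G.nbrs D e
      · exact Finset.mem_union_left _ (Finset.mem_filter.2 ⟨hem, hc⟩)
      · refine Finset.mem_union_right _ (Finset.mem_filter.2 ⟨Finset.mem_filter.2 ⟨hem,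
          ⟨s, hs, hse⟩, ?_⟩, fun ⟨s', hs', hs''⟩ =>
            hc ⟨s', hO'1 (Finset.mem_union_right _ hs'), hs''⟩⟩)
        by_contra hne
        rw [← G.nbrs_eq_of_card_ne (Finset.mem_range.1 hem) hne] at hse
        exact hc ⟨s, hO'1 (Finset.mem_union_left _ hs), hse⟩
    have h2 : U.card ≤ covCount (Finset.range m) (G.nbrs n) S :=
      Finset.card_le_card (Finset.monotone_filter_right _ fun _ _ h => h.1)
    -- `(1 - D / n) ^ t ≤ exp (- D t / n) ≤ exp (-q) ≤ 1 / q`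
    have h3 : (1 - (D : ℝ) / n) ^ t ≤ 1 / q := by
      have hDn1 : (D : ℝ) / n ≤ 1 := by
        rw [div_le_one hn0]; exact_mod_cast (by omega : D ≤ n)
      have e1 : (1 - (D : ℝ) / n) ^ t ≤ Real.exp (-((D : ℝ) / n)) ^ t :=
        pow_le_pow_left₀ (by linarith) (by linarith [Real.add_one_le_exp (-((D : ℝ) / n))]) t
      have e2 : (q : ℝ) ≤ t * (D / n) := by
        have c1 : (n : ℝ) * (2 * q ^ 2) ≤ k * D := by exact_mod_cast hDk
        have c2 : (k : ℝ) ≤ 2 * q * t := by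
          have : k ≤ 2 * q * t := by nlinarith
          exact_mod_cast this
        have c3 : (n : ℝ) * (2 * q ^ 2) ≤ 2 * q * t * D :=
          c1.trans (mul_le_mul_of_nonneg_right c2 (Nat.cast_nonneg _))
        rw [mul_div_assoc', le_div_iff₀ hn0]
        have c4 : 2 * (q : ℝ) * (q * n) ≤ 2 * q * (t * D) := by nlinarith
        exact le_of_mul_le_mul_left c4 (by positivity)
      refine e1.trans ?_
      rw [← Real.exp_nat_mul, mul_neg, Real.exp_neg, one_div]
      refine inv_anti₀ hq0 ?_
      linarith [Real.add_one_le_exp ((t : ℝ) * (D / n))]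
    have h4 : ((k : ℝ) - t) * G.opt k ≤ k * covCount (Finset.range m) (G.nbrs n) S := by
      rw [hOk, hopt] at hScov
      have : (((k - t : ℕ) : ℝ)) * G.opt k ≤ k * covCount (Finset.range m) (G.nbrs n) S := by
        exact_mod_cast hScov
      rwa [Nat.cast_sub htk] at this
    have h1' : (covCount (Finset.range m) (G.nbrs n) S : ℝ) ≤
        covCount (Finset.range m) (G.nbrs D) O' +
        (U.filter fun e => ¬ ∃ s ∈ T, s ∈ G.nbrs D e).card := by exact_mod_cast h1
    have h2' : (U.card : ℝ) ≤ covCount (Finset.range m) (G.nbrs n) S := by exact_mod_cast h2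
    have ht1' : (q : ℝ) * t ≤ k := by exact_mod_cast ht1
    generalize (covCount (Finset.range m) (G.nbrs D) O' : ℝ) = c' at *
    generalize (covCount (Finset.range m) (G.nbrs n) S : ℝ) = c at *
    have hopt0 : (0 : ℝ) ≤ G.opt k := Nat.cast_nonneg _
    generalize (G.opt k : ℝ) = a at *
    have h5 : (1 - (1 : ℝ) / q) * a ≤ c := by
      have : (1 - (1 : ℝ) / q) * k ≤ k - t := by
        have : (t : ℝ) ≤ 1 / q * k := by
          rw [one_div_mul_eq_div, le_div_iff₀ hq0]; linarith
        linarith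
      have := (mul_le_mul_of_nonneg_right this hopt0).trans h4
      refine le_of_mul_le_mul_left (a := (k : ℝ)) ?_ hk0
      linarith
    have h6 : (1 - (1 : ℝ) / q) * c ≤ c' := by
      have : (1 - (D : ℝ) / n) ^ t * U.card ≤ 1 / q * c :=
        mul_le_mul h3 h2' (Nat.cast_nonneg _) (by positivity)
      linarith
    have h7 : (0 : ℝ) ≤ 1 - 1 / q := by
      rw [sub_nonneg, div_le_one hq0]; linarith
    have h8 := mul_le_mul_of_nonneg_left h5 h7
    have h9 : (1 - 2 / (q : ℝ)) * a ≤ (1 - (1 : ℝ) / q) * ((1 - (1 : ℝ) / q) * a) := by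
      have : (2 : ℝ) / q = 2 * (1 / q) := by ring
      rw [this]
      nlinarith [sq_nonneg ((1 : ℝ) / q), mul_nonneg (sq_nonneg ((1 : ℝ) / q)) hopt0]
    linarith

/-- The best family `O` of `k` sets for the truncated instance is nearly optimal, and the number of
edges of the truncated instance is at most proportional to the number of elements it covers. -/
theorem CoverageInput.exists_trunc_opt (G : CoverageInput n m) {k q : ℕ} (hk : 1 ≤ k)
    (hkn : k ≤ n) (hq : 2 ≤ q) {D : ℕ} (hD : D = truncBound (2 * q ^ 2) n k) :
    ∃ O ⊆ Finset.range n, O.card = k ∧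
      (1 - 2 / (q : ℝ)) * G.opt k ≤ covCount (Finset.range m) (G.nbrs D) O ∧
      (∀ S ⊆ Finset.range n, S.card = k →
        covCount (Finset.range m) (G.nbrs D) S ≤ covCount (Finset.range m) (G.nbrs D) O) ∧
      k * ∑ e ∈ Finset.range m, (G.nbrs D e).card ≤
        n * (2 * q ^ 2 + 2) * covCount (Finset.range m) (G.nbrs D) O := by
  obtain ⟨O, hO, hmax⟩ := Finset.exists_max_image ((Finset.range n).powersetCard k)
    (covCount (Finset.range m) (G.nbrs D)) (Finset.powersetCard_nonempty.2 (by simpa using hkn))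
  obtain ⟨hO1, hO2⟩ := Finset.mem_powersetCard.1 hO
  have hmax' : ∀ S ⊆ Finset.range n, S.card = k →
      covCount (Finset.range m) (G.nbrs D) S ≤ covCount (Finset.range m) (G.nbrs D) O :=
    fun S h1 h2 => hmax S (Finset.mem_powersetCard.2 ⟨h1, h2⟩)
  refine ⟨O, hO1, hO2, ?_, hmax', ?_⟩
  · obtain ⟨O', h1, h2, h3⟩ := G.exists_trunc_near_opt hk hkn hq
    rw [← hD] at h3
    exact h3.trans (by exact_mod_cast hmax' O' h1 h2)
  · obtain ⟨S, h1, h2, h3⟩ := exists_covCount_ge (Finset.range n)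
      ⟨0, Finset.mem_range.2 (by omega)⟩ (Finset.range m) (G.nbrs D)
      (fun e _ => G.nbrs_subset D e) (fun e _ => G.card_nbrs_le D e) k
    obtain ⟨S', hS1, hS2, hS3⟩ := Finset.exists_subsuperset_card_eq h1 h2 (by simpa using hkn)
    have h4 := (covCount_mono (Finset.range m) (G.nbrs D) hS1).trans (hmax' S' hS2 hS3)
    have h5 : k * D ≤ n * (2 * q ^ 2 + 1) := by rw [hD]; exact mul_truncBound_le hkn
    rw [Finset.card_range] at h3
    calc _ ≤ _ := h3
      _ ≤ n * covCount (Finset.range m) (G.nbrs D) O +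
          n * (2 * q ^ 2 + 1) * covCount (Finset.range m) (G.nbrs D) O :=
        add_le_add (Nat.mul_le_mul_left _ h4) (Nat.mul_le_mul h5 h4)
      _ = _ := by ring

theorem CoverageInput.le_sum_card_nbrs (G : CoverageInput n m) (hG : G.NoIsolated) {D : ℕ}
    (hD : 1 ≤ D) : m ≤ ∑ e ∈ Finset.range m, (G.nbrs D e).card := by
  have h : ∀ e ∈ Finset.range m, 1 ≤ (G.nbrs D e).card := by
    intro e he
    have he' := Finset.mem_range.1 he
    obtain ⟨s, hs⟩ := hG ⟨e, he'⟩
    rw [G.mem_iff] at hs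
    have := List.length_pos_of_mem hs
    rw [G.card_nbrs]
    simp [trunc, he']
    omega
  simpa using Finset.sum_le_sum h

/-! ### The greedy solution for a sample -/

theorem CoverageInput.hits_resid_eq_gain (G : CoverageInput n m) (D : ℕ) (x : ℕ → ℕ) (R : ℕ)
    (S : List ℕ) (v : ℕ) :
    G.hits D (G.resid D x S) R v =
      gain (Finset.range R) (fun r => G.nbrs D (x r)) S.toFinset v := by
  rw [gain, Finset.card_filter]
  refine Finset.sum_congr rfl fun r _ => ?_
  simp only [nbrs, List.mem_toFinset]
  by_cases hS : ∃ s ∈ S, s ∈ G.trunc D (x r)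
  · rw [resid, if_pos hS, G.trunc_of_le D le_rfl, if_neg fun h => h.2 hS, List.count_nil]
  · rw [resid, if_neg hS]
    by_cases hv : v ∈ G.trunc D (x r)
    · rw [if_pos ⟨hv, hS⟩, List.count_eq_one_of_mem (G.nodup_trunc D _) hv]
    · rw [if_neg fun h => hv h.1, List.count_eq_zero_of_not_mem hv]

/-- After `i` selections at most the part `(1 - (1 - 1 / q) / k) ^ i` of the coverage of `O` on the
sample is missing. -/
theorem GreedySeq.sub_covCount_le {G : CoverageInput n m} {D : ℕ} {x : ℕ → ℕ} {R q k : ℕ}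
    {S : List ℕ} (h : GreedySeq G D x R q S) (hq : 1 ≤ q) (hk : 1 ≤ k) {O : Finset ℕ}
    (hO : O ⊆ Finset.range n) (hOk : O.card = k) :
    (covCount (Finset.range R) (fun r => G.nbrs D (x r)) O : ℝ) -
      covCount (Finset.range R) (fun r => G.nbrs D (x r)) S.toFinset ≤
      (1 - (1 - 1 / (q : ℝ)) / k) ^ S.length *
        covCount (Finset.range R) (fun r => G.nbrs D (x r)) O := by
  have hk0 : (0 : ℝ) < k := by exact_mod_cast hk
  have hk1 : (1 : ℝ) ≤ k := by exact_mod_cast hk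
  have hq0 : (0 : ℝ) < q := by exact_mod_cast hq
  induction h with
  | nil => simp [covCount_empty]
  | @snoc S u h hu hS hmax ih =>
    have hS' : (S ++ [u]).toFinset = insert u S.toFinset := by
      ext v; simp
    rw [hS', covCount_insert, List.length_append, List.length_singleton, Nat.cast_add]
    refine greedy_step hk0 (le_trans (sub_le_self _ (by positivity)) hk1) ih ?_
    have h1 := covCount_le_add_sum_gain (Finset.range R) (fun r => G.nbrs D (x r)) S.toFinset O
    simp only [G.hits_resid_eq_gain] at hmax
    generalize hg : gain (Finset.range R) (fun r => G.nbrs D (x r)) S.toFinset u = g at *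
    have h2 : (q - 1) * ∑ v ∈ O \ S.toFinset,
        gain (Finset.range R) (fun r => G.nbrs D (x r)) S.toFinset v ≤ k * (q * g) := by
      rw [Finset.mul_sum]
      refine (Finset.sum_le_card_nsmul _ _ (q * g) fun v hv => hmax v
        (Finset.mem_range.1 (hO (Finset.mem_sdiff.1 hv).1))).trans ?_
      rw [smul_eq_mul, ← hOk]
      exact Nat.mul_le_mul_right _ (Finset.card_le_card Finset.sdiff_subset)
    generalize ∑ v ∈ O \ S.toFinset,
        gain (Finset.range R) (fun r => G.nbrs D (x r)) S.toFinset v = z at *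
    generalize covCount (Finset.range R) (fun r => G.nbrs D (x r)) O = C at *
    generalize covCount (Finset.range R) (fun r => G.nbrs D (x r)) S.toFinset = c at *
    have h1' : (C : ℝ) - c ≤ z := by
      have : (C : ℝ) ≤ c + z := by exact_mod_cast h1
      linarith
    have h2' : ((q : ℝ) - 1) * z ≤ k * (q * g) := by
      have : (((q - 1 : ℕ) : ℝ)) * z ≤ k * (q * g) := by exact_mod_cast h2
      rwa [Nat.cast_sub hq, Nat.cast_one] at this
    have h3 : (0 : ℝ) ≤ (q : ℝ) - 1 := by
      have : (1 : ℝ) ≤ q := by exact_mod_cast hq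
      linarith
    have h4 := mul_le_mul_of_nonneg_left h1' h3
    refine le_of_mul_le_mul_left (a := (q : ℝ)) ?_ hq0
    have h5 : (q : ℝ) * ((1 - 1 / q) * (C - c)) = (q - 1) * (C - c) := by
      field_simp
    rw [h5]
    linarith

/-- The approximation ratio of the threshold greedy algorithm on a sample. -/
theorem GreedySeq.le_covCount {G : CoverageInput n m} {D : ℕ} {x : ℕ → ℕ} {R q k : ℕ}
    {S : List ℕ} (h : GreedySeq G D x R q S) (hq : 1 ≤ q) (hk : 1 ≤ k) (hS : S.length = k)
    {O : Finset ℕ} (hO : O ⊆ Finset.range n) (hOk : O.card = k) :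
    (1 - 1 / Real.exp 1 - 1 / q) *
        (covCount (Finset.range R) (fun r => G.nbrs D (x r)) O : ℝ) ≤
      covCount (Finset.range R) (fun r => G.nbrs D (x r)) S.toFinset := by
  have h1 := h.sub_covCount_le hq hk hO hOk
  rw [hS] at h1
  have hk0 : (0 : ℝ) < k := by exact_mod_cast hk
  have hk1 : (1 : ℝ) ≤ k := by exact_mod_cast hk
  have hq0 : (0 : ℝ) < q := by exact_mod_cast hq
  have hq1 : (1 : ℝ) / q ≤ 1 := by rw [div_le_one hq0]; exact_mod_cast hq
  set δ := (1 : ℝ) / q with hδ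
  have hδ0 : 0 < δ := by positivity
  have h2 : (1 - (1 - δ) / k) ^ k ≤ Real.exp (-(1 - δ)) := by
    have e1 : (1 - δ) / k ≤ 1 := by rw [div_le_one hk0]; linarith
    have e2 := pow_le_pow_left₀ (by linarith) (Real.one_sub_le_exp_neg ((1 - δ) / k)) k
    refine e2.trans_eq ?_
    rw [← Real.exp_nat_mul]
    congr 1
    field_simp
  have h3 : Real.exp (-(1 - δ)) ≤ 1 / Real.exp 1 + δ := by
    have e1 : Real.exp (-(1 - δ)) = Real.exp δ / Real.exp 1 := by
      rw [← Real.exp_sub]; congr 1; ring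
    have e2 : 1 - δ ≤ Real.exp (-δ) := Real.one_sub_le_exp_neg δ
    have e3 : Real.exp δ * Real.exp (-δ) = 1 := by rw [← Real.exp_add]; simp
    have e4 : Real.exp δ ≤ Real.exp 1 := Real.exp_le_exp.2 hq1
    have e5 := Real.exp_pos 1
    rw [e1, div_add' _ _ _ e5.ne', div_le_div_iff_of_pos_right e5]
    nlinarith [Real.exp_pos δ, mul_le_mul_of_nonneg_left e2 (Real.exp_pos δ).le]
  have h4 : (0 : ℝ) ≤ covCount (Finset.range R) (fun r => G.nbrs D (x r)) O := Nat.cast_nonneg _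
  have h5 := mul_le_mul_of_nonneg_right (h2.trans h3) h4
  linarith
end

/-! ### Concentration of the sample -/

section
variable {α : Type*} [Fintype α]

/-- The exponential moments of a sum of independent terms multiply; the last `B - R` elements do not
matter. -/
theorem sum_exp_eq {B R : ℕ} (hR : R ≤ B) (h : α → ℝ) :
    ∑ x : Fin B → α, Real.exp (∑ i : Fin B with i.val < R, h (x i)) =
      (∑ a, Real.exp (h a)) ^ R * (Fintype.card α : ℝ) ^ (B - R) := by
  classical
  have h1 : ∀ x : Fin B → α, Real.exp (∑ i : Fin B with i.val < R, h (x i)) =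
      ∏ i : Fin B, (if i.val < R then Real.exp (h (x i)) else 1) := by
    intro x
    rw [Real.exp_sum, Finset.prod_filter]
  simp only [h1]
  have h2 := Finset.prod_univ_sum (fun _ : Fin B => (Finset.univ : Finset α))
    (fun i a => if i.val < R then Real.exp (h a) else (1 : ℝ))
  rw [Fintype.piFinset_univ] at h2
  rw [← h2]
  have h3 : ∀ i : Fin B, (∑ a, if i.val < R then Real.exp (h a) else (1 : ℝ)) =
      if i.val < R then ∑ a, Real.exp (h a) else (Fintype.card α : ℝ) := by
    intro i
    split <;> simp
  simp only [h3]
  rw [Fin.prod_univ_eq_prod_range (fun i => if i < R then ∑ a, Real.exp (h a)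
    else (Fintype.card α : ℝ)) B, ← Finset.prod_range_mul_prod_Ico _ hR]
  congr 1
  · rw [Finset.prod_congr rfl fun i hi => if_pos (Finset.mem_range.1 hi)]
    simp
  · rw [Finset.prod_congr rfl fun i hi => if_neg (not_lt.2 (Finset.mem_Ico.1 hi).1)]
    simp

open Classical in
/-- The exponential moment bound for the sum of `h` over the first `R` of `B` independent uniformly
random elements, in terms of numbers of vectors. -/
theorem card_tail_le {B R : ℕ} (hR : R ≤ B) (h : α → ℝ) {y s : ℝ}
    (hy : ∑ a, Real.exp (h a) ≤ Fintype.card α * Real.exp y) :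
    ((Finset.univ.filter fun x : Fin B → α =>
      s ≤ ∑ i : Fin B with i.val < R, h (x i)).card : ℝ) ≤
      (Fintype.card α : ℝ) ^ B * Real.exp (R * y - s) := by
  have h1 : ((Finset.univ.filter fun x : Fin B → α =>
      s ≤ ∑ i : Fin B with i.val < R, h (x i)).card : ℝ) * Real.exp s ≤
      ∑ x : Fin B → α, Real.exp (∑ i : Fin B with i.val < R, h (x i)) := by
    rw [← nsmul_eq_mul]
    refine (Finset.card_nsmul_le_sum _ (fun x : Fin B → α =>
      Real.exp (∑ i : Fin B with i.val < R, h (x i))) _ fun x hx => ?_).trans ?_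
    · exact Real.exp_le_exp.2 (Finset.mem_filter.1 hx).2
    · exact Finset.sum_le_sum_of_subset_of_nonneg (Finset.filter_subset _ _) fun x _ _ =>
        (Real.exp_pos _).le
  rw [sum_exp_eq hR] at h1
  have h2 : (∑ a, Real.exp (h a)) ^ R ≤ (Fintype.card α * Real.exp y) ^ R :=
    pow_le_pow_left₀ (Finset.sum_nonneg fun _ _ => (Real.exp_pos _).le) hy R
  have h3 := h1.trans (mul_le_mul_of_nonneg_right h2
    (pow_nonneg (Nat.cast_nonneg (Fintype.card α)) (B - R)))
  rw [mul_pow, mul_right_comm, ← pow_add, Nat.add_sub_cancel' hR, ← Real.exp_nat_mul] at h3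
  rw [Real.exp_sub, ← mul_div_assoc, le_div_iff₀ (Real.exp_pos s)]
  exact h3

theorem exp_le_one_add_add_sq {x : ℝ} (hx : |x| ≤ 1) : Real.exp x ≤ 1 + x + x ^ 2 := by
  have := (abs_le.1 (Real.abs_exp_sub_one_sub_id_le hx)).2
  linarith

open Classical in
/-- The exponential moments of the indicator function of a set `A`. -/
theorem sum_exp_indicator_le (A : Finset α) {l : ℝ} (hl : |l| ≤ 1) (hα : 0 < Fintype.card α) :
    ∑ a, Real.exp (if a ∈ A then l else 0) ≤
      Fintype.card α * Real.exp (A.card / Fintype.card α * (l + l ^ 2)) := by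
  have hc : (0 : ℝ) < Fintype.card α := by exact_mod_cast hα
  have h1 : ∀ a : α, Real.exp (if a ∈ A then l else 0) ≤ 1 + if a ∈ A then l + l ^ 2 else 0 := by
    intro a
    split
    · linarith [exp_le_one_add_add_sq hl]
    · simp
  refine (Finset.sum_le_sum fun a _ => h1 a).trans ?_
  rw [Finset.sum_add_distrib, Finset.sum_ite_mem, Finset.univ_inter, Finset.sum_const,
    Finset.sum_const, nsmul_eq_mul, nsmul_eq_mul, mul_one, Finset.card_univ]
  calc (Fintype.card α : ℝ) + A.card * (l + l ^ 2)
      = Fintype.card α * (A.card / Fintype.card α * (l + l ^ 2) + 1) := by field_simp; ring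
    _ ≤ _ := mul_le_mul_of_nonneg_left (Real.add_one_le_exp _) hc.le

theorem sum_indicator_eq {α : Type*} {B R : ℕ} (A : Finset α) [DecidableEq α] (l : ℝ)
    (x : Fin B → α) :
    ∑ i : Fin B with i.val < R, (if x i ∈ A then l else 0) =
      l * (Finset.univ.filter fun i : Fin B => i.val < R ∧ x i ∈ A).card := by
  rw [← Finset.sum_filter, Finset.filter_filter, Finset.sum_const, nsmul_eq_mul, mul_comm]

open Classical in
/-- Chernoff's bound for the upper tail: `M` is an upper bound for the expected number of hits of
`A` by the first `R` of `B` random elements. -/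
theorem card_upper_tail_le {B R : ℕ} (hR : R ≤ B) (A : Finset α) (hα : 0 < Fintype.card α)
    {δ M : ℝ} (hδ : 0 ≤ δ) (hδ1 : δ ≤ 1) (hM : R * ((A.card : ℝ) / Fintype.card α) ≤ M) :
    ((Finset.univ.filter fun x : Fin B → α => R * ((A.card : ℝ) / Fintype.card α) + δ * M ≤
      (Finset.univ.filter fun i : Fin B => i.val < R ∧ x i ∈ A).card).card : ℝ) ≤
      (Fintype.card α : ℝ) ^ B * Real.exp (-(δ ^ 2 * M / 4)) := by
  set μ := (A.card : ℝ) / Fintype.card α with hμ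
  have h1 := card_tail_le hR (fun a => if a ∈ A then δ / 2 else 0)
    (s := δ / 2 * (R * μ + δ * M))
    (sum_exp_indicator_le A (l := δ / 2) (by rw [abs_of_nonneg] <;> linarith) hα)
  simp only [sum_indicator_eq] at h1
  refine le_trans ?_ (h1.trans (mul_le_mul_of_nonneg_left (Real.exp_le_exp.2 ?_) (by positivity)))
  · refine Nat.cast_le.2 (Finset.card_le_card (Finset.monotone_filter_right _ fun x _ hx => ?_))
    exact mul_le_mul_of_nonneg_left hx (by linarith)
  · rw [← hμ]
    nlinarith [mul_le_mul_of_nonneg_left hM (sq_nonneg δ)]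

open Classical in
/-- Chernoff's bound for the lower tail. -/
theorem card_lower_tail_le {B R : ℕ} (hR : R ≤ B) (A : Finset α) (hα : 0 < Fintype.card α)
    {δ M : ℝ} (hδ : 0 ≤ δ) (hδ1 : δ ≤ 1) (hM : R * ((A.card : ℝ) / Fintype.card α) = M) :
    ((Finset.univ.filter fun x : Fin B → α =>
      ((Finset.univ.filter fun i : Fin B => i.val < R ∧ x i ∈ A).card : ℝ) ≤
        (1 - δ) * M).card : ℝ) ≤
      (Fintype.card α : ℝ) ^ B * Real.exp (-(δ ^ 2 * M / 4)) := by
  have h1 := card_tail_le hR (fun a => if a ∈ A then -(δ / 2) else 0)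
    (s := -(δ / 2) * ((1 - δ) * M))
    (sum_exp_indicator_le A (l := -(δ / 2)) (by rw [abs_neg, abs_of_nonneg] <;> linarith) hα)
  simp only [sum_indicator_eq] at h1
  refine le_trans ?_ (h1.trans (mul_le_mul_of_nonneg_left (Real.exp_le_exp.2 ?_) (by positivity)))
  · refine Nat.cast_le.2 (Finset.card_le_card (Finset.monotone_filter_right _ fun x _ hx => ?_))
    exact mul_le_mul_of_nonpos_left hx (by linarith)
  · rw [← mul_assoc, hM]
    nlinarith

open Classical in
/-- The upper tail of a sum of numbers in `{0, …, D}`, obtained from the exponential moments of the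
numbers `d a / D`. -/
theorem card_sum_tail_le {B R D : ℕ} (hR : R ≤ B) (d : α → ℕ) (hd : ∀ a, d a ≤ D) (hD : 0 < D)
    (hα : 0 < Fintype.card α) (s : ℝ) :
    ((Finset.univ.filter fun x : Fin B → α =>
      s ≤ ((∑ i : Fin B with i.val < R, d (x i) : ℕ) : ℝ)).card : ℝ) ≤
      (Fintype.card α : ℝ) ^ B *
        Real.exp ((2 * R * ((∑ a, d a : ℕ) : ℝ) / Fintype.card α - s) / D) := by
  have hc : (0 : ℝ) < Fintype.card α := by exact_mod_cast hα
  have hD0 : (0 : ℝ) < D := by exact_mod_cast hD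
  have h0 : ∑ a, Real.exp ((d a : ℝ) / D) ≤ Fintype.card α *
      Real.exp (2 * ((∑ a, d a : ℕ) : ℝ) / (D * Fintype.card α)) := by
    have e1 : ∀ a, Real.exp ((d a : ℝ) / D) ≤ 1 + 2 / D * d a := by
      intro a
      have h01 : (d a : ℝ) / D ≤ 1 := by
        rw [div_le_one hD0]; exact_mod_cast hd a
      have h00 : 0 ≤ (d a : ℝ) / D := by positivity
      have := exp_le_one_add_add_sq (x := (d a : ℝ) / D) (by rwa [abs_of_nonneg h00])
      have e2 : 2 / (D : ℝ) * d a = 2 * ((d a : ℝ) / D) := by ring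
      rw [e2]
      nlinarith
    refine (Finset.sum_le_sum fun a _ => e1 a).trans ?_
    rw [Finset.sum_add_distrib, ← Finset.mul_sum, Finset.sum_const, nsmul_eq_mul, mul_one,
      Finset.card_univ, Nat.cast_sum]
    calc (Fintype.card α : ℝ) + 2 / D * ∑ a, (d a : ℝ)
        = Fintype.card α * (2 * (∑ a, (d a : ℝ)) / (D * Fintype.card α) + 1) := by
          field_simp; ring
      _ ≤ _ := mul_le_mul_of_nonneg_left (Real.add_one_le_exp _) hc.le
  have h1 := card_tail_le (B := B) hR (fun a => (d a : ℝ) / D) (s := s / D) h0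
  refine le_trans ?_ (h1.trans_eq ?_)
  · refine Nat.cast_le.2 (Finset.card_le_card (Finset.monotone_filter_right _ fun x _ hx => ?_))
    rw [← Finset.sum_div]
    refine (div_le_div_iff_of_pos_right hD0).2 ?_
    rw [Nat.cast_sum] at hx
    exact hx
  · congr 2
    field_simp
end

/-! ### The quality of the output -/

section
variable {n m : ℕ}

/-- Sums over an initial part of a sample, as sums over indices in `Fin B`. -/
theorem sum_extend {M B R : ℕ} (hR : R ≤ B) (x : Fin B → Fin M) (f : ℕ → ℕ) :
    ∑ r ∈ Finset.range R, f (extend x r) = ∑ i : Fin B with i.val < R, f (x i) := by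
  refine (Finset.sum_bij (fun i _ => i.val) ?_ ?_ ?_ ?_).symm
  · intro i hi
    exact Finset.mem_range.2 (Finset.mem_filter.1 hi).2
  · intro i _ j _ h
    exact Fin.ext h
  · intro r hr
    have hr' := Finset.mem_range.1 hr
    exact ⟨⟨r, by omega⟩, by simpa using hr', rfl⟩
  · intro i _
    simp [extend]

theorem covCount_extend {M B R : ℕ} (hR : R ≤ B) (x : Fin B → Fin M) (N : ℕ → Finset ℕ)
    (S : Finset ℕ) :
    covCount (Finset.range R) (fun r => N (extend x r)) S =
      (Finset.univ.filter fun i : Fin B => i.val < R ∧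
        x i ∈ Finset.univ.filter fun e : Fin M => ∃ s ∈ S, s ∈ N e).card := by
  rw [covCount, Finset.card_filter, sum_extend hR x fun e => if ∃ s ∈ S, s ∈ N e then 1 else 0,
    ← Finset.card_filter, Finset.filter_filter]
  simp

theorem covCount_range {M : ℕ} (N : ℕ → Finset ℕ) (S : Finset ℕ) :
    covCount (Finset.range M) N S =
      (Finset.univ.filter fun e : Fin M => ∃ s ∈ S, s ∈ N e).card := by
  rw [covCount, Finset.card_filter, Finset.card_filter,
    Finset.sum_range fun e => if ∃ s ∈ S, s ∈ N e then 1 else 0]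

/-- A sequence of `k` different sets that covers many elements of the truncated instance is an
approximate solution. -/
theorem GreedySeq.isApproxSolution {G : CoverageInput n m} {D : ℕ} {x : ℕ → ℕ} {R q k : ℕ}
    {out : List ℕ} (h : GreedySeq G D x R q out) (hk : out.length = k) {α : ℝ}
    (hα : α * G.opt k ≤ covCount (Finset.range m) (G.nbrs D) out.toFinset) :
    G.IsApproxSolution k α out := by
  have hval : (out.pmap (fun v hv => (⟨v, hv⟩ : Fin n)) h.lt).map Fin.val = out := by
    rw [List.map_pmap]
    exact List.pmap_eq_self.2 fun _ _ => rfl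
  refine ⟨_, hval.symm, ?_, by rw [List.length_pmap, hk], hα.trans ?_⟩
  · exact List.Nodup.of_map Fin.val (hval.symm ▸ h.nodup)
  · rw [G.coverage_eq_covCount]
    have h1 : (out.pmap (fun v hv => (⟨v, hv⟩ : Fin n)) h.lt).toFinset.map Fin.valEmbedding =
        out.toFinset := by
      ext v
      conv_rhs => rw [← hval]
      simp
    rw [h1]
    exact_mod_cast G.covCount_trunc_le D _

/-- If the sample is typical, then the output is good: the coverage of all families of `k` sets is
not much overestimated by any sufficiently long initial part of the sample, the coverage of the
optimal family `O` is not much underestimated, and the first `R₀` samples have less than `B` edges,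
so that at least these samples are read. Here `a` is the coverage of `O`. -/
theorem Outcome.isApproxSolution {G : CoverageInput n m} {B D q k R₀ : ℕ} {x : ℕ → ℕ}
    {out : List ℕ} (h : Outcome G B D q k x out) (hm : 1 ≤ m) (hq : 8 ≤ q) (hk : 1 ≤ k)
    {O : Finset ℕ} (hO : O ⊆ Finset.range n) (hOk : O.card = k) {a : ℕ}
    (hopt : (1 - 2 / (q : ℝ)) * G.opt k ≤ a) (hR₀ : 1 ≤ R₀) (hR₀B : R₀ ≤ B)
    (hupper : ∀ R, R₀ ≤ R → R ≤ B → ∀ S ⊆ Finset.range n, S.card = k →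
      (covCount (Finset.range R) (fun r => G.nbrs D (x r)) S : ℝ) <
        R * ((covCount (Finset.range m) (G.nbrs D) S : ℝ) / m) + 1 / q * (R * ((a : ℝ) / m)))
    (hlower : ∀ R, R₀ ≤ R → R ≤ B → (1 - 1 / (q : ℝ)) * (R * ((a : ℝ) / m)) <
      covCount (Finset.range R) (fun r => G.nbrs D (x r)) O)
    (htotal : G.total D x R₀ < B) :
    G.IsApproxSolution k (1 - 1 / Real.exp 1 - 5 / q) out := by
  obtain ⟨R, hRB, hR, hseq, hlen⟩ := h
  have hRR : R₀ ≤ R := by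
    by_contra hlt
    push Not at hlt
    have h1 : G.total D x R ≤ G.total D x R₀ :=
      Finset.sum_le_sum_of_subset (Finset.range_mono hlt.le)
    omega
  refine hseq.isApproxSolution hlen ?_
  have hsub : out.toFinset ⊆ Finset.range n := fun v hv =>
    Finset.mem_range.2 (hseq.lt v (List.mem_toFinset.1 hv))
  have hcard : out.toFinset.card = k := by
    rw [List.toFinset_card_of_nodup hseq.nodup, hlen]
  have h1 := hseq.le_covCount (by omega) hk hlen hO hOk
  have h2 := hupper R hRR hRB _ hsub hcard
  have h3 := hlower R hRR hRB
  generalize (covCount (Finset.range R) (fun r => G.nbrs D (x r)) O : ℝ) = F at *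
  generalize (covCount (Finset.range R) (fun r => G.nbrs D (x r)) out.toFinset : ℝ) = f at *
  generalize (covCount (Finset.range m) (G.nbrs D) out.toFinset : ℝ) = c at *
  have hq0 : (0 : ℝ) < q := by exact_mod_cast (by omega : 0 < q)
  have hδ8 : (1 : ℝ) / q ≤ 1 / 8 := one_div_le_one_div_of_le (by norm_num) (by exact_mod_cast hq)
  have h5δ : (5 : ℝ) / q = 5 * (1 / q) := by ring
  have h2δ : (2 : ℝ) / q = 2 * (1 / q) := by ring
  rw [h5δ]
  rw [h2δ] at hopt
  have hδ0 : (0 : ℝ) < 1 / q := by positivity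
  generalize (1 : ℝ) / q = δ at *
  have he : 1 / Real.exp 1 ≤ 1 / 2 :=
    one_div_le_one_div_of_le (by norm_num) (by linarith [Real.add_one_le_exp (1 : ℝ)])
  have he0 : 0 < 1 / Real.exp 1 := by positivity
  generalize 1 / Real.exp 1 = η at *
  have hm0 : (0 : ℝ) < m := by exact_mod_cast hm
  have hRpos : (0 : ℝ) < R := by exact_mod_cast (by omega : 0 < R)
  have hz : (0 : ℝ) < R / m := by positivity
  have e1 : (R : ℝ) * (c / m) = R / m * c := by ring
  have e2 : (R : ℝ) * ((a : ℝ) / m) = R / m * a := by ring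
  rw [e1, e2] at h2
  rw [e2] at h3
  generalize (R : ℝ) / m = z at *
  have ha0 : (0 : ℝ) ≤ a := Nat.cast_nonneg a
  have h4 : (1 - η - δ) * ((1 - δ) * (z * a)) ≤ z * c + δ * (z * a) :=
    (mul_le_mul_of_nonneg_left h3.le (by linarith)).trans (h1.trans h2.le)
  have h5 : ((1 - η - δ) * (1 - δ) - δ) * a ≤ c := by
    refine le_of_mul_le_mul_left (a := z) ?_ hz
    linarith
  have h6 : (1 - η - 3 * δ) * a ≤ c := by
    refine le_trans (mul_le_mul_of_nonneg_right ?_ ha0) h5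
    nlinarith
  have h7 := mul_le_mul_of_nonneg_left hopt (show 0 ≤ 1 - η - 3 * δ by linarith)
  have hopt0 : (0 : ℝ) ≤ G.opt k := Nat.cast_nonneg _
  have h8 : (1 - η - 5 * δ) * G.opt k ≤ (1 - η - 3 * δ) * ((1 - 2 * δ) * G.opt k) := by
    rw [← mul_assoc]
    refine mul_le_mul_of_nonneg_right ?_ hopt0
    nlinarith
  linarith

theorem exp_neg_natCast_le (t : ℕ) : Real.exp (-(t : ℝ)) ≤ 1 / (2 : ℝ) ^ t := by
  have h1 : (2 : ℝ) ≤ Real.exp 1 := by linarith [Real.add_one_le_exp (1 : ℝ)]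
  rw [Real.exp_neg, ← one_div, ← mul_one (t : ℝ), Real.exp_nat_mul]
  exact one_div_le_one_div_of_le (by positivity) (pow_le_pow_left₀ (by norm_num) h1 t)

/-- The arithmetic of the union bound over all families of `k` sets and all lengths of the sample.
-/
theorem failure_bound {K g k : ℕ} (hn : 1 ≤ n) (hk : 1 ≤ k) (hK : 1 ≤ K) (hg : 4 ≤ g)
    (hKg : 8 * K ≤ 2 ^ (g - 4)) :
    ((sampleCount K n : ℝ) + 1) * ((n : ℝ) ^ k + 1) *
        Real.exp (-((k * (Nat.log 2 n + 1) * g : ℕ) : ℝ)) +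
      Real.exp (-((g * (Nat.log 2 n + 1) : ℕ) : ℝ)) ≤ 1 / n := by
  set l := Nat.log 2 n + 1 with hl
  set N := 2 ^ l with hN
  have hnN : n < N := Nat.lt_pow_succ_log_self (by norm_num) n
  have hlN : l < N := Nat.lt_two_pow_self
  have hN2 : 2 ≤ N := by rw [hN, hl, pow_succ]; have := Nat.one_le_two_pow (n := Nat.log 2 n); omega
  have h1 := exp_neg_natCast_le (k * l * g)
  have h2 := exp_neg_natCast_le (g * l)
  have hB : sampleCount K n + 1 ≤ 2 * K * N ^ 2 := by
    have e1 : K * n * l ≤ K * N * N := Nat.mul_le_mul (Nat.mul_le_mul_left _ hnN.le) hlN.le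
    have e2 : 1 ≤ K * N * N := Nat.mul_pos (Nat.mul_pos hK (by omega)) (by omega)
    calc sampleCount K n + 1 ≤ K * N * N + K * N * N := add_le_add e1 e2
      _ = _ := by ring
  have hnk : n ^ k + 1 ≤ 2 * N ^ k := by
    have e1 : n ^ k ≤ N ^ k := Nat.pow_le_pow_left hnN.le k
    have e2 : 1 ≤ N ^ k := Nat.one_le_pow _ _ (by omega)
    omega
  have hpow : 8 * K * N ^ (k + 3) ≤ N ^ (k * g) := by
    have e1 : 2 ^ (g - 4) ≤ N ^ (g - 4) := Nat.pow_le_pow_left hN2 _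
    have e2 : g - 4 + (k + 3) ≤ k * g := by
      obtain ⟨k', rfl⟩ : ∃ k', k = k' + 1 := ⟨k - 1, by omega⟩
      have : k' ≤ k' * g := Nat.le_mul_of_pos_right _ (by omega)
      rw [add_mul]; omega
    calc 8 * K * N ^ (k + 3) ≤ N ^ (g - 4) * N ^ (k + 3) :=
          Nat.mul_le_mul_right _ (hKg.trans e1)
      _ = N ^ (g - 4 + (k + 3)) := (pow_add _ _ _).symm
      _ ≤ N ^ (k * g) := Nat.pow_le_pow_right (by omega) e2
  have hpow' : 2 * N ≤ N ^ g := by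
    calc 2 * N ≤ N ^ 2 := by rw [sq]; exact Nat.mul_le_mul_right _ hN2
      _ ≤ N ^ g := Nat.pow_le_pow_right (by omega) (by omega)
  have e1 : (2 : ℝ) ^ (k * l * g) = (N : ℝ) ^ (k * g) := by
    rw [hN]; push_cast; rw [← pow_mul]; congr 1; ring
  have e2 : (2 : ℝ) ^ (g * l) = (N : ℝ) ^ g := by
    rw [hN]; push_cast; rw [← pow_mul]; congr 1; ring
  rw [e1] at h1
  rw [e2] at h2
  have hN0 : (0 : ℝ) < N := by exact_mod_cast (by omega : 0 < N)
  have hn0 : (0 : ℝ) < n := by exact_mod_cast hn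
  have hB' : (sampleCount K n : ℝ) + 1 ≤ 2 * K * N ^ 2 := by exact_mod_cast hB
  have hnk' : (n : ℝ) ^ k + 1 ≤ 2 * N ^ k := by exact_mod_cast hnk
  have hpow1 : 8 * (K : ℝ) * N ^ (k + 3) ≤ N ^ (k * g) := by exact_mod_cast hpow
  have hpow2 : 2 * (N : ℝ) ≤ N ^ g := by exact_mod_cast hpow'
  have f1 : ((sampleCount K n : ℝ) + 1) * ((n : ℝ) ^ k + 1) *
      Real.exp (-((k * l * g : ℕ) : ℝ)) ≤ 1 / (2 * N) := by
    calc _ ≤ 2 * K * N ^ 2 * (2 * N ^ k) * (1 / (N : ℝ) ^ (k * g)) :=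
          mul_le_mul (mul_le_mul hB' hnk' (by positivity) (by positivity)) h1
            (Real.exp_pos _).le (by positivity)
      _ ≤ 1 / (2 * N) := by
          rw [mul_one_div, div_le_div_iff₀ (by positivity) (by positivity)]
          calc _ = 8 * (K : ℝ) * N ^ (k + 3) := by ring
            _ ≤ _ := by rw [one_mul]; exact hpow1
  have f2 : Real.exp (-((g * l : ℕ) : ℝ)) ≤ 1 / (2 * N) :=
    h2.trans (one_div_le_one_div_of_le (by positivity) hpow2)
  have f3 : (1 : ℝ) / N ≤ 1 / n := one_div_le_one_div_of_le hn0 (by exact_mod_cast hnN.le)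
  have f4 : (1 : ℝ) / (2 * N) + 1 / (2 * N) = 1 / N := by field_simp; norm_num
  linarith

/-- The arithmetic behind the number `R₀` of samples that suffice: it is at least
`4 q² k g (log n + 1) m / a`, where `a` is the optimal coverage, and the first `R₀` samples have on
average at most `B / 4` edges. -/
theorem exists_sampleSize {K L q g k a E D : ℕ} (hk : 1 ≤ k) (hg : 1 ≤ g) (hq : 1 ≤ q)
    (hm : 1 ≤ m) (ha : a ≤ m) (hE : m ≤ E) (hkE : k * E ≤ n * (L + 2) * a)
    (hkD : k * D ≤ n * (L + 1)) (hK : K = 32 * q ^ 2 * (L + 2) * g) :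
    ∃ R₀, 1 ≤ R₀ ∧ R₀ ≤ sampleCount K n ∧
      4 * q ^ 2 * (k * (Nat.log 2 n + 1) * g) * m ≤ R₀ * a ∧ 4 * R₀ * E ≤ m * sampleCount K n ∧
      2 * D * (g * (Nat.log 2 n + 1)) ≤ sampleCount K n := by
  set l := Nat.log 2 n + 1 with hl
  have hl1 : 1 ≤ l := by omega
  have hB : sampleCount K n = 32 * q ^ 2 * (L + 2) * g * n * l := by rw [sampleCount, hK]
  have ha1 : 1 ≤ a := by
    by_contra h
    have ha0 : a = 0 := by omega
    rw [ha0, mul_zero] at hkE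
    have : 0 < k * E := Nat.mul_pos hk (by omega)
    omega
  set Γ := 4 * q ^ 2 * (k * l * g) with hΓ
  have hΓ1 : 1 ≤ Γ := by
    have : 0 < Γ := by positivity
    exact this
  have h1 : Γ * m ≤ a * (Γ * m / a + 1) := (Nat.lt_mul_div_succ _ ha1).le
  have h2 : a * (Γ * m / a + 1) ≤ 2 * (Γ * m) := by
    have e1 := Nat.mul_div_le (Γ * m) a
    have e2 : m ≤ Γ * m := Nat.le_mul_of_pos_left _ hΓ1
    rw [mul_add]; omega
  have hR1 : 1 ≤ Γ * m / a + 1 := Nat.succ_pos _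
  generalize Γ * m / a + 1 = R at *
  have h3 : 4 * R * E ≤ m * sampleCount K n := by
    refine Nat.le_of_mul_le_mul_left (c := k * a) ?_ (Nat.mul_pos hk ha1)
    calc k * a * (4 * R * E) = 4 * (k * E) * (a * R) := by ring
      _ ≤ 4 * (n * (L + 2) * a) * (2 * (Γ * m)) :=
          Nat.mul_le_mul (Nat.mul_le_mul_left _ hkE) h2
      _ = _ := by rw [hΓ, hB]; ring
  refine ⟨R, hR1, ?_, by rw [mul_comm R]; exact h1, h3, ?_⟩
  · have e1 : R * m ≤ R * E := Nat.mul_le_mul_left _ hE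
    have e2 : m * R ≤ m * sampleCount K n := by nlinarith
    exact Nat.le_of_mul_le_mul_left e2 hm
  · have e1 : D ≤ n * (L + 1) := (Nat.le_mul_of_pos_left _ hk).trans hkD
    have e2 : n * (L + 1) ≤ n * (L + 2) := Nat.mul_le_mul_left _ (by omega)
    have e3 : 1 ≤ q ^ 2 := Nat.one_le_pow _ _ hq
    calc 2 * D * (g * l) ≤ 2 * (n * (L + 2)) * (g * l) :=
          Nat.mul_le_mul_right _ (Nat.mul_le_mul_left _ (e1.trans e2))
      _ ≤ (16 * q ^ 2) * (2 * (n * (L + 2)) * (g * l)) :=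
          Nat.le_mul_of_pos_left _ (by omega)
      _ = _ := by rw [hB]; ring

end

/-! ### The failure probability -/

section
variable {n m : ℕ}

open Classical in
/-- Few samples overestimate the coverage of the family `S`, given that it is at most `a`. -/
theorem card_upper_bad_le {G : CoverageInput n m} (hm : 1 ≤ m) {B D q R a z : ℕ} (hq : 1 ≤ q)
    (hR : R ≤ B) {S : Finset ℕ} (hS : covCount (Finset.range m) (G.nbrs D) S ≤ a)
    (hz : 4 * q ^ 2 * z * m ≤ R * a) :
    ((Finset.univ.filter fun x : Fin B → Fin m =>
      R * ((covCount (Finset.range m) (G.nbrs D) S : ℝ) / m) + 1 / q * (R * ((a : ℝ) / m)) ≤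
        covCount (Finset.range R) (fun r => G.nbrs D (extend x r)) S).card : ℝ) ≤
      (m : ℝ) ^ B * Real.exp (-(z : ℝ)) := by
  have hm0 : (0 : ℝ) < m := by exact_mod_cast hm
  have hq0 : (0 : ℝ) < q := by exact_mod_cast hq
  have h := card_upper_tail_le hR (Finset.univ.filter fun e : Fin m => ∃ s ∈ S, s ∈ G.nbrs D e)
    (by rw [Fintype.card_fin]; omega) (δ := 1 / q) (M := R * ((a : ℝ) / m)) (by positivity)
    (by rw [div_le_one hq0]; exact_mod_cast hq) (by
      rw [Fintype.card_fin, ← covCount_range]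
      have : (covCount (Finset.range m) (G.nbrs D) S : ℝ) ≤ a := by exact_mod_cast hS
      gcongr)
  rw [Fintype.card_fin, ← covCount_range] at h
  refine le_trans (le_of_eq ?_) (h.trans (mul_le_mul_of_nonneg_left (Real.exp_le_exp.2 ?_)
    (by positivity)))
  · simp only [covCount_extend hR]
    congr!
  · have hz' : 4 * (q : ℝ) ^ 2 * z * m ≤ R * a := by exact_mod_cast hz
    rw [neg_le_neg_iff, div_pow, one_pow, mul_div_assoc', div_mul_div_comm, one_mul, div_div,
      le_div_iff₀ (by positivity)]
    linarith

open Classical in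
/-- Few samples underestimate the coverage of the family `O`. -/
theorem card_lower_bad_le {G : CoverageInput n m} (hm : 1 ≤ m) {B D q R z : ℕ} (hq : 1 ≤ q)
    (hR : R ≤ B) {O : Finset ℕ}
    (hz : 4 * q ^ 2 * z * m ≤ R * covCount (Finset.range m) (G.nbrs D) O) :
    ((Finset.univ.filter fun x : Fin B → Fin m =>
      (covCount (Finset.range R) (fun r => G.nbrs D (extend x r)) O : ℝ) ≤
        (1 - 1 / q) * (R * ((covCount (Finset.range m) (G.nbrs D) O : ℝ) / m))).card : ℝ) ≤
      (m : ℝ) ^ B * Real.exp (-(z : ℝ)) := by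
  have hm0 : (0 : ℝ) < m := by exact_mod_cast hm
  have hq0 : (0 : ℝ) < q := by exact_mod_cast hq
  have h := card_lower_tail_le hR (Finset.univ.filter fun e : Fin m => ∃ s ∈ O, s ∈ G.nbrs D e)
    (by rw [Fintype.card_fin]; omega) (δ := 1 / q)
    (M := R * ((covCount (Finset.range m) (G.nbrs D) O : ℝ) / m)) (by positivity)
    (by rw [div_le_one hq0]; exact_mod_cast hq) (by rw [Fintype.card_fin, ← covCount_range])
  rw [Fintype.card_fin] at h
  refine le_trans (le_of_eq ?_) (h.trans (mul_le_mul_of_nonneg_left (Real.exp_le_exp.2 ?_)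
    (by positivity)))
  · simp only [covCount_extend hR]
    congr!
  · have hz' : 4 * (q : ℝ) ^ 2 * z * m ≤ R * covCount (Finset.range m) (G.nbrs D) O := by
      exact_mod_cast hz
    rw [neg_le_neg_iff, div_pow, one_pow, mul_div_assoc', div_mul_div_comm, one_mul, div_div,
      le_div_iff₀ (by positivity)]
    linarith

open Classical in
/-- Few samples have `B` or more edges among their first `R` elements, given that the expected
number is at most `B / 4`. -/
theorem card_total_bad_le {G : CoverageInput n m} (hm : 1 ≤ m) {B D R z : ℕ} (hR : R ≤ B)
    (hD : 1 ≤ D) (hE : 4 * R * ∑ e ∈ Finset.range m, (G.nbrs D e).card ≤ m * B)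
    (hz : 2 * D * z ≤ B) :
    ((Finset.univ.filter fun x : Fin B → Fin m => B ≤ G.total D (extend x) R).card : ℝ) ≤
      (m : ℝ) ^ B * Real.exp (-(z : ℝ)) := by
  have hm0 : (0 : ℝ) < m := by exact_mod_cast hm
  have hD0 : (0 : ℝ) < D := by exact_mod_cast hD
  have h := card_sum_tail_le hR (fun e : Fin m => (G.nbrs D e).card)
    (fun e => G.card_nbrs_le D e) hD (by rw [Fintype.card_fin]; omega) B
  rw [Fintype.card_fin, ← Finset.sum_range fun e => (G.nbrs D e).card] at h
  refine le_trans (le_of_eq ?_) (h.trans (mul_le_mul_of_nonneg_left (Real.exp_le_exp.2 ?_)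
    (by positivity)))
  · have h1 : ∀ x : Fin B → Fin m, G.total D (extend x) R =
        ∑ i : Fin B with i.val < R, (G.nbrs D (x i)).card := by
      intro x
      rw [← sum_extend hR x fun e => (G.nbrs D e).card]
      simp only [CoverageInput.total, G.card_nbrs]
    simp only [h1, Nat.cast_le]
  · have hE' : 4 * (R : ℝ) * (∑ e ∈ Finset.range m, (G.nbrs D e).card : ℕ) ≤ m * B := by
      exact_mod_cast hE
    have hz' : 2 * (D : ℝ) * z ≤ B := by exact_mod_cast hz
    rw [div_le_iff₀ hD0]
    have h1 : 2 * (R : ℝ) * (∑ e ∈ Finset.range m, (G.nbrs D e).card : ℕ) / m ≤ B / 2 := by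
      rw [div_le_iff₀ hm0]; linarith
    linarith

open Classical in
/-- At most the part `1 / n` of all samples lead to a bad output. The number of elements that the
program reads depends on the sample, so the bad events are united over all these numbers. -/
theorem card_bad_samples_le {G : CoverageInput n m} (hG : G.NoIsolated) {q g k K : ℕ}
    (hq : 8 ≤ q) (hg : 4 ≤ g) (hK : K = 32 * q ^ 2 * (2 * q ^ 2 + 2) * g)
    (hKg : 8 * K ≤ 2 ^ (g - 4)) (hk : 1 ≤ k) (hkn : k ≤ n) :
    ((Finset.univ.filter fun x : Fin (sampleCount K n) → Fin (max m 1) =>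
      ¬ ∀ out, Outcome G (sampleCount K n) (truncBound (2 * q ^ 2) n k) q k (extend x) out →
        G.IsApproxSolution k (1 - 1 / Real.exp 1 - 5 / q) out).card : ℝ) ≤
      ((max m 1 : ℕ) : ℝ) ^ (sampleCount K n) * (1 / n) := by
  set D := truncBound (2 * q ^ 2) n k with hD
  have hD1 : 1 ≤ D := Nat.succ_pos _
  have hK1 : 1 ≤ K := by
    have : 0 < K := by rw [hK]; positivity
    exact this
  have hbound := failure_bound (n := n) (by omega) hk hK1 hg hKg
  rcases Nat.eq_zero_or_pos m with hm | hm
  · -- without elements there is nothing to cover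
    rw [Finset.filter_false_of_mem]
    · rw [Finset.card_empty, Nat.cast_zero]; positivity
    · rintro x - hx
      refine hx fun out ⟨_, _, _, hseq, hlen⟩ => hseq.isApproxSolution hlen ?_
      obtain ⟨O, -, -, hopt⟩ := G.exists_opt hkn
      have h0 : ∀ (N : ℕ → Finset ℕ) (S : Finset ℕ), covCount (Finset.range m) N S = 0 :=
        fun N S => by simp [covCount, hm]
      rw [← hopt]
      simp only [h0, Nat.cast_zero, mul_zero, le_refl]
  · rw [max_eq_left hm]
    obtain ⟨O, hO, hOk, hopt, hmax, hkE⟩ := G.exists_trunc_opt hk hkn (by omega : 2 ≤ q) hD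
    set a := covCount (Finset.range m) (G.nbrs D) O with ha
    have ham : a ≤ m := by
      have := Finset.card_filter_le (Finset.range m) fun e => ∃ s ∈ O, s ∈ G.nbrs D e
      rwa [Finset.card_range] at this
    obtain ⟨R₀, hR1, hRB, hRa, hRE, hRD⟩ := exists_sampleSize (D := D) hk (by omega)
      (by omega : 1 ≤ q) hm ham (G.le_sum_card_nbrs hG hD1) hkE (mul_truncBound_le hkn) hK
    set B := sampleCount K n with hB
    set z := k * (Nat.log 2 n + 1) * g with hz
    set bad₁ : ℕ → Finset ℕ → Finset (Fin B → Fin m) := fun R S =>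
      Finset.univ.filter fun x : Fin B → Fin m =>
        R * ((covCount (Finset.range m) (G.nbrs D) S : ℝ) / m) + 1 / q * (R * ((a : ℝ) / m)) ≤
          covCount (Finset.range R) (fun r => G.nbrs D (extend x r)) S with hbad₁
    set bad₂ : ℕ → Finset (Fin B → Fin m) := fun R =>
      Finset.univ.filter fun x : Fin B → Fin m =>
        (covCount (Finset.range R) (fun r => G.nbrs D (extend x r)) O : ℝ) ≤
          (1 - 1 / q) * (R * ((a : ℝ) / m)) with hbad₂
    set bad₃ : Finset (Fin B → Fin m) :=
      Finset.univ.filter fun x : Fin B → Fin m => B ≤ G.total D (extend x) R₀ with hbad₃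
    set p := (m : ℝ) ^ B * Real.exp (-(z : ℝ)) with hp
    have hp0 : 0 ≤ p := by positivity
    have hsub : (Finset.univ.filter fun x : Fin B → Fin m => ¬ ∀ out, Outcome G B D q k (extend x)
        out → G.IsApproxSolution k (1 - 1 / Real.exp 1 - 5 / q) out) ⊆
        (Finset.Icc R₀ B).biUnion (fun R =>
          ((Finset.range n).powersetCard k).biUnion (bad₁ R) ∪ bad₂ R) ∪ bad₃ := by
      intro x hx
      by_contra hgood
      simp only [Finset.mem_union, Finset.mem_biUnion, Finset.mem_Icc, Finset.mem_powersetCard,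
        not_or, not_exists, not_and, hbad₁, hbad₂, hbad₃, Finset.mem_filter, Finset.mem_univ,
        true_and, not_le] at hgood
      refine (Finset.mem_filter.1 hx).2 fun out hout => hout.isApproxSolution hm hq hk hO hOk hopt
        hR1 hRB (fun R h1 h2 S h3 h4 => (hgood.1 R ⟨h1, h2⟩).1 S ⟨h3, h4⟩)
        (fun R h1 h2 => (hgood.1 R ⟨h1, h2⟩).2) hgood.2
    have hle : ∀ R ∈ Finset.Icc R₀ B, 4 * q ^ 2 * z * m ≤ R * a := fun R hR =>
      hRa.trans (Nat.mul_le_mul_right _ (Finset.mem_Icc.1 hR).1)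
    have c1 : ∀ R ∈ Finset.Icc R₀ B, ∀ S ∈ (Finset.range n).powersetCard k,
        ((bad₁ R S).card : ℝ) ≤ p := fun R hR S hS =>
      card_upper_bad_le hm (by omega) (Finset.mem_Icc.1 hR).2
        (hmax S (Finset.mem_powersetCard.1 hS).1 (Finset.mem_powersetCard.1 hS).2) (hle R hR)
    have c2 : ∀ R ∈ Finset.Icc R₀ B, ((bad₂ R).card : ℝ) ≤ p := fun R hR =>
      card_lower_bad_le hm (by omega) (Finset.mem_Icc.1 hR).2 (hle R hR)
    have c3 : (bad₃.card : ℝ) ≤ (m : ℝ) ^ B * Real.exp (-((g * (Nat.log 2 n + 1) : ℕ) : ℝ)) :=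
      card_total_bad_le hm hRB hD1 hRE hRD
    have hchoose : (((Finset.range n).powersetCard k).card : ℝ) ≤ (n : ℝ) ^ k := by
      rw [Finset.card_powersetCard, Finset.card_range]
      exact_mod_cast Nat.choose_le_pow n k
    have hIcc : ((Finset.Icc R₀ B).card : ℝ) ≤ B + 1 := by
      have : (Finset.Icc R₀ B).card ≤ B + 1 := by rw [Nat.card_Icc]; omega
      exact_mod_cast this
    have d1 : ∀ R ∈ Finset.Icc R₀ B,
        (((((Finset.range n).powersetCard k).biUnion (bad₁ R) ∪ bad₂ R).card : ℕ) : ℝ) ≤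
          ((n : ℝ) ^ k + 1) * p := by
      intro R hR
      calc _ ≤ (((((Finset.range n).powersetCard k).biUnion (bad₁ R)).card +
            (bad₂ R).card : ℕ) : ℝ) := Nat.cast_le.2 (Finset.card_union_le _ _)
        _ ≤ ∑ S ∈ (Finset.range n).powersetCard k, ((bad₁ R S).card : ℝ) + p := by
            rw [Nat.cast_add]
            refine add_le_add ?_ (c2 R hR)
            exact_mod_cast Finset.card_biUnion_le
        _ ≤ ((Finset.range n).powersetCard k).card • p + p :=
            add_le_add_left (Finset.sum_le_card_nsmul _ _ _ (c1 R hR)) _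
        _ ≤ _ := by
            rw [nsmul_eq_mul, add_mul, one_mul]
            exact add_le_add_left (mul_le_mul_of_nonneg_right hchoose hp0) _
    calc _ ≤ ((((Finset.Icc R₀ B).biUnion (fun R =>
          ((Finset.range n).powersetCard k).biUnion (bad₁ R) ∪ bad₂ R)).card +
            bad₃.card : ℕ) : ℝ) :=
          Nat.cast_le.2 ((Finset.card_le_card hsub).trans (Finset.card_union_le _ _))
      _ ≤ ∑ R ∈ Finset.Icc R₀ B,
          (((((Finset.range n).powersetCard k).biUnion (bad₁ R) ∪ bad₂ R).card : ℕ) : ℝ) +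
            (m : ℝ) ^ B * Real.exp (-((g * (Nat.log 2 n + 1) : ℕ) : ℝ)) := by
          rw [Nat.cast_add]
          refine add_le_add ?_ c3
          exact_mod_cast Finset.card_biUnion_le
      _ ≤ (Finset.Icc R₀ B).card • (((n : ℝ) ^ k + 1) * p) +
            (m : ℝ) ^ B * Real.exp (-((g * (Nat.log 2 n + 1) : ℕ) : ℝ)) :=
          add_le_add_left (Finset.sum_le_card_nsmul _ _ _ d1) _
      _ ≤ (B + 1) * (((n : ℝ) ^ k + 1) * p) +
            (m : ℝ) ^ B * Real.exp (-((g * (Nat.log 2 n + 1) : ℕ) : ℝ)) := by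
          rw [nsmul_eq_mul]
          exact add_le_add_left (mul_le_mul_of_nonneg_right hIcc (by positivity)) _
      _ = (m : ℝ) ^ B * (((B : ℝ) + 1) * ((n : ℝ) ^ k + 1) * Real.exp (-(z : ℝ)) +
            Real.exp (-((g * (Nat.log 2 n + 1) : ℕ) : ℝ))) := by rw [hp]; ring
      _ ≤ _ := mul_le_mul_of_nonneg_left hbound (by positivity)
end

/-! ### Running time, word length, and success probability -/

/-- Each pass lowers the threshold by the factor `1 - 1 / q`, so logarithmically many suffice. -/
theorem passes_le {q : ℕ} (hq : 1 ≤ q) (t : ℕ) (ht : 1 ≤ t) :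
    (passes q t : ℝ) ≤ 1 + q * Real.log t := by
  induction t using Nat.strong_induction_on with
  | _ t ih =>
    have hq0 : (0 : ℝ) < q := by exact_mod_cast hq
    have ht0 : (0 : ℝ) < t := by exact_mod_cast ht
    rw [passes_of_pos q ht]
    set t₁ := t - 1 - (t - 1) / q with ht₁
    rcases Nat.eq_zero_or_pos t₁ with h0 | hpos
    · rw [h0, passes]
      have := mul_nonneg hq0.le (Real.log_natCast_nonneg t)
      push_cast
      linarith
    · have h := ih t₁ ((Nat.sub_le _ _).trans_lt (Nat.sub_lt ht one_pos)) hpos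
      have hle : q * t₁ + t ≤ q * t := by
        have h1 : t - 1 < q * ((t - 1) / q + 1) := Nat.lt_mul_div_succ _ hq
        have h2 : t₁ + ((t - 1) / q + 1) = t := by
          have := Nat.div_le_self (t - 1) q
          rw [ht₁] at hpos ⊢
          revert this hpos
          generalize (t - 1) / q = y
          intros
          omega
        calc q * t₁ + t ≤ q * t₁ + q * ((t - 1) / q + 1) := by omega
          _ = q * t := by rw [← mul_add, h2]
      have hle' : (q : ℝ) * t₁ + t ≤ q * t := by exact_mod_cast hle
      have hpos' : (0 : ℝ) < t₁ := by exact_mod_cast hpos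
      have h3 := Real.log_le_sub_one_of_pos (div_pos hpos' ht0)
      rw [Real.log_div hpos'.ne' ht0.ne'] at h3
      have h4 : (t₁ : ℝ) / t ≤ 1 - 1 / q := by
        rw [div_le_iff₀ ht0, sub_mul, one_div, one_mul, inv_mul_eq_div, le_sub_iff_add_le,
          ← mul_le_mul_iff_right₀ hq0, mul_add, mul_div_cancel₀ _ hq0.ne']
        exact hle'
      have h5 : (q : ℝ) * (Real.log t₁ - Real.log t) ≤ q * (-(1 / q)) :=
        mul_le_mul_of_nonneg_left (by linarith) hq0.le
      rw [mul_neg, mul_one_div_cancel hq0.ne', mul_sub] at h5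
      push_cast
      linarith

theorem isSoftLinear_timeBound {K q : ℕ} (L : ℕ) (hK : 1 ≤ K) (hq : 1 ≤ q) :
    IsSoftLinear (timeBound K L q) := by
  refine ⟨1, IsBigO.of_bound (125 + 192 * K + 41 * L + 22 * (q * (K + 2))) ?_⟩
  filter_upwards [eventually_ge_atTop 3] with n hn
  have hn3 : (3 : ℝ) ≤ n := by exact_mod_cast hn
  have hn0 : (0 : ℝ) < n := by linarith
  have hK1 : (1 : ℝ) ≤ K := by exact_mod_cast hK
  have hl1 : 1 ≤ Real.log n := by
    rw [Real.le_log_iff_exp_le hn0]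
    linarith [Real.exp_one_lt_d9]
  set l := Real.log n with hl
  have hlog : (Nat.log 2 n : ℝ) ≤ 2 * l := by
    have h1 : ((2 : ℝ)) ^ Nat.log 2 n ≤ n := by
      exact_mod_cast Nat.pow_log_le_self 2 (by omega : n ≠ 0)
    have h2 := Real.log_le_log (by positivity) h1
    rw [Real.log_pow] at h2
    have h3 : (Nat.log 2 n : ℝ) * (1 / 2) ≤ Nat.log 2 n * Real.log 2 :=
      mul_le_mul_of_nonneg_left (by linarith [Real.log_two_gt_d9]) (Nat.cast_nonneg _)
    linarith
  have hN1 : (n : ℝ) ≤ n * l := le_mul_of_one_le_right hn0.le hl1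
  have hN2 : l ≤ n * l := le_mul_of_one_le_left (by linarith) (by linarith)
  have hB : (sampleCount K n : ℝ) ≤ 3 * K * (n * l) := by
    unfold sampleCount
    push_cast
    calc (K : ℝ) * n * (Nat.log 2 n + 1) ≤ K * n * (3 * l) :=
          mul_le_mul_of_nonneg_left (by linarith) (by positivity)
      _ = 3 * K * (n * l) := by ring
  have hB1 : 1 ≤ sampleCount K n := by
    unfold sampleCount
    exact Nat.mul_pos (Nat.mul_pos hK (by omega)) (Nat.succ_pos _)
  have hB2 : Real.log (sampleCount K n) ≤ (K + 2) * l := by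
    have h1 : sampleCount K n ≤ K * n * n := by
      unfold sampleCount
      exact Nat.mul_le_mul_left _ (Nat.log_lt_self 2 (by omega))
    have h2 : (sampleCount K n : ℝ) ≤ K * n * n := by exact_mod_cast h1
    have h3 := Real.log_le_log (by exact_mod_cast hB1) h2
    rw [Real.log_mul (by positivity) hn0.ne', Real.log_mul (by positivity) hn0.ne'] at h3
    have h4 : Real.log K ≤ K := (Real.log_le_sub_one_of_pos (by linarith)).trans (by linarith)
    have h5 : (K : ℝ) ≤ K * l := le_mul_of_one_le_right (by linarith) hl1
    linarith
  have hp : (passes q (sampleCount K n) : ℝ) * n ≤ n + q * (K + 2) * (n * l) := by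
    have h1 := passes_le hq _ hB1
    have h2 : (q : ℝ) * Real.log (sampleCount K n) ≤ q * ((K + 2) * l) :=
      mul_le_mul_of_nonneg_left hB2 (Nat.cast_nonneg _)
    calc (passes q (sampleCount K n) : ℝ) * n ≤ (1 + q * ((K + 2) * l)) * n :=
          mul_le_mul_of_nonneg_right (h1.trans (by linarith)) hn0.le
      _ = n + q * (K + 2) * (n * l) := by ring
  have hL : (n : ℝ) * L ≤ L * (n * l) := by
    rw [mul_comm]
    exact mul_le_mul_of_nonneg_left hN1 (Nat.cast_nonneg _)
  rw [pow_one, Real.norm_of_nonneg (Nat.cast_nonneg _), Real.norm_of_nonneg (by positivity)]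
  unfold timeBound
  push_cast
  rw [add_mul _ (1 : ℝ) (n : ℝ)]
  linarith

/-- Words of `d * (log₂ (n + m) + 1)` bits, for a suitable constant `d`, hold all numbers that the
program computes. -/
theorem exists_fits {K : ℕ} (L q : ℕ) (hK : 1 ≤ K) :
    ∃ d : ℕ, ∀ n m k w : ℕ, 1 ≤ k → d * (Nat.log 2 (n + m) + 1) ≤ w →
      Fits w n m (sampleCount K n) (truncBound L n k) q ∧ n * L + L < 2 ^ w := by
  set c := K + L + 5 with hc
  set s := 4 * c ^ 2 + q + 2 with hs
  refine ⟨s + 4, fun n m k w hk hw => ?_⟩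
  set X := 2 ^ (Nat.log 2 (n + m) + 1) with hX
  have hnm : n + m < X := Nat.lt_pow_succ_log_self one_lt_two _
  have hX2 : 2 ≤ X := by
    rw [hX, pow_succ]
    exact Nat.le_mul_of_pos_left _ (by positivity)
  have hXw : X ^ (s + 4) ≤ 2 ^ w := by
    rw [hX, ← pow_mul, mul_comm]
    exact Nat.pow_le_pow_right two_pos hw
  have hsX : s + 1 ≤ X ^ s := (Nat.lt_two_pow_self).trans_le (Nat.pow_le_pow_left hX2 s)
  have hXX : X ≤ X ^ 2 := Nat.le_self_pow (by norm_num) X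
  have hX1 : 1 ≤ X := by omega
  have hXX' : X ≤ X ^ 4 := Nat.le_self_pow (by norm_num) X
  have hB : sampleCount K n ≤ K * X ^ 2 := by
    unfold sampleCount
    have h1 : Nat.log 2 n + 1 ≤ X := by
      have := Nat.log_le_self 2 n
      omega
    calc K * n * (Nat.log 2 n + 1) ≤ K * X * X :=
          Nat.mul_le_mul (Nat.mul_le_mul_left _ (by omega)) h1
      _ = K * X ^ 2 := by ring
  have hnL : n * L + L ≤ L * X := by
    calc n * L + L = L * (n + 1) := by ring
      _ ≤ L * X := Nat.mul_le_mul_left _ (by omega)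
  have hD : truncBound L n k ≤ L * X ^ 2 + 1 := by
    unfold truncBound
    have h1 := Nat.div_le_self (n * L) k
    have h2 : L * X ≤ L * X ^ 2 := Nat.mul_le_mul_left _ hXX
    omega
  have hsum : sampleCount K n + truncBound L n k + n + 3 ≤ c * X ^ 2 := by
    rw [hc]
    have : (K + L + 5) * X ^ 2 = K * X ^ 2 + L * X ^ 2 + 5 * X ^ 2 := by ring
    omega
  have hbig : s * X ^ 4 < 2 ^ w := by
    calc s * X ^ 4 < X ^ s * X ^ 4 := Nat.mul_lt_mul_of_pos_right hsX (by positivity)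
      _ = X ^ (s + 4) := (pow_add _ _ _).symm
      _ ≤ 2 ^ w := hXw
  refine ⟨⟨?_, ?_⟩, ?_⟩
  · unfold sampleCount
    calc n ≤ K * n := Nat.le_mul_of_pos_left _ hK
      _ ≤ K * n * (Nat.log 2 n + 1) := Nat.le_mul_of_pos_right _ (Nat.succ_pos _)
  · refine lt_of_le_of_lt ?_ hbig
    have h1 := Nat.mul_le_mul hsum hsum
    have h2 : s * X ^ 4 = 4 * (c * X ^ 2 * (c * X ^ 2)) + q * X ^ 4 + 2 * X ^ 4 := by
      rw [hs]; ring
    have h3 : q ≤ q * X ^ 4 := Nat.le_mul_of_pos_right _ (by positivity)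
    omega
  · refine lt_of_le_of_lt (hnL.trans ?_) hbig
    refine Nat.mul_le_mul ?_ hXX'
    rw [hs, hc]
    nlinarith

/-- A number `g` for which the union bound succeeds: `2 ^ g` outgrows all multiples of `g`. -/
theorem exists_mul_le_two_pow (a : ℕ) :
    ∃ g, 4 ≤ g ∧ 8 * (a * g) ≤ 2 ^ (g - 4) := by
  refine ⟨2 * (256 * a) + 4, by omega, ?_⟩
  -- `2 ^ (2 j) ≥ (j + 1) ²` for `j = 256 a`
  set j := 256 * a with hj
  have h1 : j + 1 ≤ 2 ^ j := Nat.lt_two_pow_self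
  rw [Nat.add_sub_cancel, mul_comm 2 j, pow_mul, sq]
  refine le_trans ?_ (Nat.mul_le_mul h1 h1)
  nlinarith

theorem CoverageInput.IsApproxSolution.mono {n m : ℕ} {G : CoverageInput n m} {k : ℕ} {α β : ℝ}
    {out : List ℕ} (h : G.IsApproxSolution k α out) (hβ : β ≤ α) : G.IsApproxSolution k β out := by
  obtain ⟨l, h1, h2, h3, h4⟩ := h
  exact ⟨l, h1, h2, h3, (mul_le_mul_of_nonneg_right hβ (Nat.cast_nonneg _)).trans h4⟩

/-- Counting outcomes of a uniform distribution: a property that fails for at most the part `δ` of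
all points holds with probability at least `1 - δ` for the image of a uniform point. -/
theorem le_toOuterMeasure_map_uniform {α β : Type*} [Fintype α] [Nonempty α] {f : α → β}
    {s : Set β} {bad : Finset α} {δ : ℝ} (hδ : (bad.card : ℝ) ≤ Fintype.card α * δ)
    (hbad : ∀ x, x ∉ bad → f x ∈ s) :
    ENNReal.ofReal (1 - δ) ≤ ((PMF.uniformOfFintype α).map f).toOuterMeasure s := by
  classical
  rw [PMF.toOuterMeasure_map_apply, PMF.toOuterMeasure_uniformOfFintype_apply]
  have h0 : (0 : ℝ) < Fintype.card α := by exact_mod_cast Fintype.card_pos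
  have h1 : Fintype.card α ≤ bad.card + Fintype.card (f ⁻¹' s) := by
    rw [Fintype.card_subtype, ← Finset.card_add_card_compl bad]
    refine Nat.add_le_add_left (Finset.card_le_card fun x hx => ?_) _
    exact Finset.mem_filter.2 ⟨Finset.mem_univ _, hbad x (Finset.mem_compl.1 hx)⟩
  have h2 : (Fintype.card α : ℝ) ≤ bad.card + Fintype.card (f ⁻¹' s) := by exact_mod_cast h1
  have h3 : 1 - δ ≤ Fintype.card (f ⁻¹' s) / Fintype.card α := by
    rw [le_div_iff₀ h0]
    linarith
  refine (ENNReal.ofReal_le_ofReal h3).trans (le_of_eq ?_)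
  rw [ENNReal.ofReal_div_of_pos h0, ENNReal.ofReal_natCast, ENNReal.ofReal_natCast]

end KCover

theorem mainTheorem3 (ε : ℝ) (hε : 0 < ε) (hε' : ε ≤ 1) :
    ∃ (P : KCover.Program) (d : ℕ) (T : ℕ → ℕ), KCover.IsSoftLinear T ∧
      ∀ (n m k : ℕ) (G : KCover.CoverageInput n m), G.NoIsolated → 1 ≤ k → k ≤ n →
        ∀ w : ℕ, d * (Nat.log 2 (n + m) + 1) ≤ w → n + m < 2 ^ w →
          (∀ c ∈ (KCover.run w G k P (T n)).support, c.Halted P) ∧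
          ENNReal.ofReal (1 - 1 / (n : ℝ)) ≤
            (KCover.run w G k P (T n)).toOuterMeasure
              {c | G.IsApproxSolution k (1 - 1 / Real.exp 1 - ε) c.out} := by
  classical
  -- truncation costs `2 / q`, the threshold rule `1 / q`, and the two sampling errors `2 / q`
  set q := max 8 ⌈5 / ε⌉₊ with hq
  have hq8 : 8 ≤ q := le_max_left _ _
  have hqε : 5 / (q : ℝ) ≤ ε := by
    have h1 : 5 / ε ≤ q := (Nat.le_ceil _).trans (by exact_mod_cast le_max_right _ _)
    have hq0 : (0 : ℝ) < q := by exact_mod_cast (by omega : 0 < q)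
    rw [div_le_iff₀ hq0, mul_comm]
    exact (div_le_iff₀ hε).1 h1
  obtain ⟨g, hg, hKg⟩ := KCover.exists_mul_le_two_pow (32 * q ^ 2 * (2 * q ^ 2 + 2))
  set K := 32 * q ^ 2 * (2 * q ^ 2 + 2) * g with hK
  have hK1 : 1 ≤ K := Nat.mul_pos (by positivity) (by omega)
  obtain ⟨d, hd⟩ := KCover.exists_fits (2 * q ^ 2) q hK1
  refine ⟨KCover.program K (2 * q ^ 2) q, d, KCover.timeBound K (2 * q ^ 2) q,
    KCover.isSoftLinear_timeBound _ hK1 (by omega), fun n m k G hG hk hkn w hw _ => ?_⟩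
  obtain ⟨hF, hL⟩ := hd n m k w hk hw
  obtain ⟨f, hf, hout⟩ := KCover.run_program (G := G) hk hkn hK1 (by omega) hF hL
  rw [hf]
  constructor
  · intro c hc
    obtain ⟨x, -, rfl⟩ := (PMF.mem_support_map_iff _ _ _).1 hc
    exact (hout x).1
  · refine KCover.le_toOuterMeasure_map_uniform
      ((KCover.card_bad_samples_le hG hq8 hg hK hKg hk hkn).trans (by simp)) fun x hx => ?_
    simp only [Finset.mem_filter, Finset.mem_univ, true_and, not_not] at hx
    exact (hx _ (hout x).2).mono (by linarith)
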